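/- Let $n=p+q\ge 1$ and let $f\in\mathbb{R}[x_1,\dots,x_n]$ be a quadratic form of rank $n$ and signature $(p,q)$. Write $f_{p,q}=x_1^2+\cdots+x_p^2-x_{p+1}^2-\cdots-x_{p+q}^2$; let $\mathrm{SO}(p,q)$ be the group of real $n\times n$ matrices of determinant $1$ that preserve $f_{p,q}$, let $\mathrm{SO}^+(p,q)$ be its identity component, and let $G\subset \mathrm{SO}^+(p,q)$ be the stabilizer of $\{\{x_1^2,\dots,x_p^2\},\{x_{p+1}^2,\dots,x_n^2\}\}$ for the action $(g\cdot h)(x)=h(g^{-1}x)$. A set of $n$ points $(a_{i1}:\cdots:a_{in})$, $i=1,\dots,n$, of $\mathbb{P}^{n-1}(\mathbb{C})$ is a point of the Hilbert scheme $\mathrm{Hilb}_n(\mathbb{P}^{n-1})$. Let $\mathrm{VSP}(f)$ be the Zariski closure in $\mathrm{Hilb}_n(\mathbb{P}^{n-1})$ of the set of those configurations for which $f=\sum_{i=1}^n\lambda_i(a_{i1}x_1+\cdots+a_{in}x_n)^2$ for some $\lambda_i\in\mathbb{C}$; let $\mathrm{VSP}(f)_{\mathbb{R}}$ be the set of its real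 points, i.e. the points whose ideal is invariant under complex conjugation; and let $\mathrm{SSP}(f)_{\mathbb{R}}$ be the set of those configurations for which $f$ has such a decomposition with all $a_{ij}$ and $\lambda_i$ real. These sets carry the classical (Euclidean) topology, and $\overline{\phantom{x}}$ denotes the closure in it. 1. There is an invertible real matrix $L$ with $f(x)=f_{p,q}(Lx)$. For each such $L$, the map that sends $g$ to the configuration of the rows of $g^{-1}L$ (which belongs to the decomposition $f(x)=f_{p,q}(g^{-1}Lx)$) induces a homeomorphism $\mathrm{SO}^{+}(p,q)/G\cong\mathrm{SSP}(f)_{\mathbb{R}}$. 2. If $f$ is (positive or negative) definite, then $\mathrm{SSP}(f)_{\mathbb{R}}=\mathrm{VSP}(f)_{\mathbb{R}}$ and $\mathrm{SO}^+(p,q)=\mathrm{SO}(n)$, so that both spaces are identified with $\mathrm{SO}(n)/G$. 3. If $f$ is not definite, then $\overline{\mathrm{SSP}(f)_{\mathbb{R}}}\subsetneq\mathrm{VSP}(f)_{\mathbb{R}}$. -/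

import Mathlib

open MvPolynomial
open scoped Pointwise

attribute [local instance] MvPolynomial.gradedAlgebra

noncomputable section

namespace PowerSums

/-! ### Complex points of the Hilbert scheme of points in projective space -/

/-- The degree `d` piece of an ideal of `ℂ[x₁,…,xₙ]`, as a subspace of the space of forms of
degree `d`. -/
def degPart {n : ℕ} (I : Ideal (MvPolynomial (Fin n) ℂ)) (d : ℕ) :
    Submodule ℂ (homogeneousSubmodule (Fin n) ℂ d) :=
  (I.restrictScalars ℂ).comap (homogeneousSubmodule (Fin n) ℂ d).subtype

/-- A complex point of the Hilbert scheme `Hilb_r(ℙⁿ⁻¹)`: a closed subscheme of `ℙⁿ⁻¹` of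
length `r`, given by its saturated homogeneous ideal. The Hilbert polynomial of the quotient ring
is the constant `r`. (For a saturated ideal with constant Hilbert polynomial `r` the Hilbert
function is equal to `r` in every degree `d ≥ r`, so that bound loses nothing.) -/
@[ext]
structure HilbPoint (n r : ℕ) where
  ideal : Ideal (MvPolynomial (Fin n) ℂ)
  isHomogeneous : ideal.IsHomogeneous (homogeneousSubmodule (Fin n) ℂ)
  isSaturated : ∀ p, (∀ i, X i * p ∈ ideal) → p ∈ ideal
  hilbertFunction : ∀ d, r ≤ d →
    Module.finrank ℂ (homogeneousSubmodule (Fin n) ℂ d ⧸ degPart ideal d) = r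

/-- The exponents of the monomials of degree `d` in `n` variables. -/
abbrev Mon (n d : ℕ) : Type := ↥(Finset.finsuppAntidiag (Finset.univ : Finset (Fin n)) d)

/-- The space of forms of degree `d` that are annihilated by the `r` linear functionals which are
given by the rows of `M` (in the coordinates dual to the monomials). -/
def frameKernel {n r d : ℕ} (M : Matrix (Fin r) (Mon n d) ℂ) :
    Submodule ℂ (homogeneousSubmodule (Fin n) ℂ d) where
  carrier := {p | ∀ i, ∑ m : Mon n d, M i m * coeff m.1 p.1 = 0}
  zero_mem' := by intro i; simp
  add_mem' := by
    intro p q hp hq i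
    have h1 := hp i
    have h2 := hq i
    simp only [Submodule.coe_add, coeff_add, mul_add, Finset.sum_add_distrib, h1, h2, add_zero]
  smul_mem' := by
    intro c p hp i
    have h1 := hp i
    simp only [Submodule.coe_smul, coeff_smul, smul_eq_mul, mul_left_comm _ c, ← Finset.mul_sum,
      h1, mul_zero]

/-- The (dual) Stiefel manifold: `r × N` matrices of rank `r`, where `N` is the number of
monomials of degree `d`. It carries the subspace topology. -/
abbrev Frame (n d r : ℕ) : Type :=
  {M : Matrix (Fin r) (Mon n d) ℂ // LinearIndependent ℂ (fun i => M i)}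

/-- The classical (Euclidean) topology on the Grassmannian of subspaces of codimension `r` in the
space of forms of degree `d`: the quotient topology from the Stiefel manifold. (Subspaces of
other codimensions, which do not matter, become isolated points.) -/
abbrev grassmannTopology (n d r : ℕ) :
    TopologicalSpace (Submodule ℂ (homogeneousSubmodule (Fin n) ℂ d)) :=
  TopologicalSpace.coinduced (fun M : Frame n d r => frameKernel M.1) inferInstance

/-- The classical topology on the complex points of the Hilbert scheme, through the closed
embedding `I ↦ I_r` of `Hilb_r(ℙⁿ⁻¹)` into the Grassmannian of subspaces of codimension `r` in the
space of forms of degree `r` (`r` is the Gotzmann number of the constant polynomial `r`). -/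
instance (n r : ℕ) : TopologicalSpace (HilbPoint n r) :=
  TopologicalSpace.induced (fun J => degPart J.ideal r) (grassmannTopology n r r)

/-- The closure in the Zariski topology of the Hilbert scheme, again as a subspace of the
Grassmannian. A set of subspaces is Zariski closed if and only if the set of all its frames is
Zariski closed in the Stiefel manifold, which is open in a space of matrices; the closure
consists of the points whose frames satisfy every polynomial equation that holds on all frames of
points of `T`. -/
def zariskiClosure {n r : ℕ} (T : Set (HilbPoint n r)) : Set (HilbPoint n r) :=
  {J | ∀ P : MvPolynomial (Fin r × Mon n r) ℂ,
    (∀ K ∈ T, ∀ M : Frame n r r, frameKernel M.1 = degPart K.ideal r →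
      eval (fun im => M.1 im.1 im.2) P = 0) →
    ∀ M : Frame n r r, frameKernel M.1 = degPart J.ideal r →
      eval (fun im => M.1 im.1 im.2) P = 0}

/-- A complex point of the Hilbert scheme is real if its ideal is stable under complex
conjugation of the coefficients. -/
def HilbPoint.IsReal {n r : ℕ} (J : HilbPoint n r) : Prop :=
  ∀ p ∈ J.ideal, map (starRingEnd ℂ) p ∈ J.ideal

/-! ### Sums of powers -/

/-- The linear form with coefficient vector `a`. -/
def linForm {n : ℕ} {K : Type*} [CommSemiring K] (a : Fin n → K) : MvPolynomial (Fin n) K :=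
  ∑ j, C (a j) * X j

/-- The homogeneous radical ideal of the points `(a i)` of `ℙⁿ⁻¹`: the polynomials that vanish on
the affine cone over these points. -/
def configIdeal {n r : ℕ} (a : Fin r → Fin n → ℂ) : Ideal (MvPolynomial (Fin n) ℂ) :=
  vanishingIdeal ℂ {x | ∃ (i : Fin r) (c : ℂ), x = c • a i}

/-- The configurations of `n` points in `ℙⁿ⁻¹(ℂ)` that occur in a decomposition
`f = ∑ λᵢ ℓᵢ²` of the quadric `f` in `n` variables. -/
def powerSumConfigs {n : ℕ} (f : MvPolynomial (Fin n) ℂ) : Set (HilbPoint n n) :=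
  {J | ∃ (a : Fin n → Fin n → ℂ) (c : Fin n → ℂ),
    f = ∑ i, C (c i) * linForm (a i) ^ 2 ∧ J.ideal = configIdeal a}

/-- The variety of sums of powers of a real quadric (its complex points). -/
def VSP {n : ℕ} (f : MvPolynomial (Fin n) ℝ) : Set (HilbPoint n n) :=
  zariskiClosure (powerSumConfigs (map Complex.ofRealHom f))

/-- The real points of the variety of sums of powers. -/
def VSPReal {n : ℕ} (f : MvPolynomial (Fin n) ℝ) : Set (HilbPoint n n) :=
  {J | J ∈ VSP f ∧ J.IsReal}

/-- The ideal of a configuration of real points. -/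
def realConfigIdeal {n r : ℕ} (a : Fin r → Fin n → ℝ) : Ideal (MvPolynomial (Fin n) ℂ) :=
  configIdeal (fun i j => (a i j : ℂ))

/-- The space of real sums of powers: the configurations of real points that occur in a
decomposition `f = ∑ λᵢ ℓᵢ²`. -/
def SSPReal {n : ℕ} (f : MvPolynomial (Fin n) ℝ) : Set (HilbPoint n n) :=
  {J | ∃ (a : Fin n → Fin n → ℝ) (c : Fin n → ℝ),
    f = ∑ i, C (c i) * linForm (a i) ^ 2 ∧ J.ideal = realConfigIdeal a}

/-! ### Quadrics and orthogonal groups -/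

/-- `f` is a quadric (homogeneous of degree 2) of signature `(p, q)`. -/
def HasSignature {n : ℕ} (f : MvPolynomial (Fin n) ℝ) (p q : ℕ) : Prop :=
  f.IsHomogeneous 2 ∧ ∃ Q : QuadraticForm ℝ (Fin n → ℝ),
    (∀ x, Q x = eval x f) ∧ sigPos Q = p ∧ sigNeg Q = q

/-- `f` is positive definite or negative definite. -/
def IsDefinite {n : ℕ} (f : MvPolynomial (Fin n) ℝ) : Prop :=
  (∀ x : Fin n → ℝ, x ≠ 0 → 0 < eval x f) ∨ (∀ x : Fin n → ℝ, x ≠ 0 → eval x f < 0)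

/-- The substitution `f(x) ↦ f(A x)`. -/
def linSubst {n : ℕ} (A : Matrix (Fin n) (Fin n) ℝ) :
    MvPolynomial (Fin n) ℝ →ₐ[ℝ] MvPolynomial (Fin n) ℝ :=
  aeval (fun i => linForm (A i))

theorem linSubst_comp {n : ℕ} (A B : Matrix (Fin n) (Fin n) ℝ) :
    (linSubst A).comp (linSubst B) = linSubst (B * A) := by
  apply MvPolynomial.algHom_ext
  intro i
  simp only [linSubst, linForm, AlgHom.comp_apply, aeval_X, map_sum, map_mul, algHom_C,
    algebraMap_eq, Matrix.mul_apply, Finset.mul_sum, Finset.sum_mul]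
  rw [Finset.sum_comm]
  simp only [mul_assoc]

theorem linSubst_one {n : ℕ} : linSubst (1 : Matrix (Fin n) (Fin n) ℝ) = AlgHom.id ℝ _ := by
  apply MvPolynomial.algHom_ext
  intro i
  simp [linSubst, linForm, Matrix.one_apply, apply_ite, ite_mul]

/-- The action of `GL(n, ℝ)` on polynomials by linear changes of coordinates,
`(g • f)(x) = f(g⁻¹ x)`. -/
def changeCoords (n : ℕ) :
    GL (Fin n) ℝ →* (MvPolynomial (Fin n) ℝ ≃ₐ[ℝ] MvPolynomial (Fin n) ℝ) where
  toFun g := AlgEquiv.ofAlgHom (linSubst (g⁻¹).1) (linSubst g.1)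
    (by rw [linSubst_comp, ← Units.val_mul, mul_inv_cancel, Units.val_one, linSubst_one])
    (by rw [linSubst_comp, ← Units.val_mul, inv_mul_cancel, Units.val_one, linSubst_one])
  map_one' := by
    ext p : 1
    change linSubst ((1 : GL (Fin n) ℝ)⁻¹).1 p = p
    rw [inv_one, Units.val_one, linSubst_one]; rfl
  map_mul' g h := by
    ext p : 1
    change linSubst ((g * h)⁻¹).1 p = linSubst (g⁻¹).1 (linSubst (h⁻¹).1 p)
    rw [← AlgHom.comp_apply, linSubst_comp, ← Units.val_mul, ← mul_inv_rev]

/-- The standard quadric `x₁² + ⋯ + xₚ² - xₚ₊₁² - ⋯ - xₚ₊q²`. -/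
def stdQuadric (p q : ℕ) : MvPolynomial (Fin (p + q)) ℝ :=
  ∑ i : Fin p, X (Fin.castAdd q i) ^ 2 - ∑ j : Fin q, X (Fin.natAdd p j) ^ 2

/-- `SO(p,q)`: the matrices of determinant one that stabilize the standard quadric. -/
def SO (p q : ℕ) : Subgroup (GL (Fin (p + q)) ℝ) :=
  (MulAction.stabilizer (MvPolynomial (Fin (p + q)) ℝ ≃ₐ[ℝ] MvPolynomial (Fin (p + q)) ℝ)
    (stdQuadric p q)).comap (changeCoords (p + q)) ⊓ Matrix.GeneralLinearGroup.det.ker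

/-- `SO⁺(p,q)`: the connected component of the identity in `SO(p,q)`. -/
def SOPlus (p q : ℕ) : Subgroup (GL (Fin (p + q)) ℝ) :=
  (Subgroup.connectedComponentOfOne (SO p q)).map (SO p q).subtype

/-- The stabilizer `G` in `SO⁺(p,q)` of the set `{{x₁², …, xₚ²}, {xₚ₊₁², …, xₚ₊q²}}`. -/
def squaresStabilizer (p q : ℕ) : Subgroup (SOPlus p q) :=
  ((MulAction.stabilizer (MvPolynomial (Fin (p + q)) ℝ ≃ₐ[ℝ] MvPolynomial (Fin (p + q)) ℝ)
    ({Set.range fun i : Fin p => X (Fin.castAdd q i) ^ 2,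
      Set.range fun j : Fin q => X (Fin.natAdd p j) ^ 2} :
        Set (Set (MvPolynomial (Fin (p + q)) ℝ)))).comap
    (changeCoords (p + q))).subgroupOf (SOPlus p q)

end PowerSums

end

noncomputable section

namespace PowerSums

/-! ### Forms and their coefficients -/

/-! Since `f` has rank `n`, the `n` linear forms of any decomposition are independent, their
coefficients are nonzero, and they are mutually orthogonal for the inverse `b` of the matrix of `f`
(`isUnit_det_of_gram`, `mul_inv_gram_mul`). Everything rests on this orthogonality.

Assertion 1. By Sylvester's law a real decomposition can be sorted and rescaled to `f(x) = f_{p,q}(A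
x)`, and then `L A⁻¹` lies in `O(p,q)`. Rotations and boosts in coordinate planes reduce it, modulo
`SO⁺(p,q)`, to a diagonal matrix of signs (`exists_mul_eq_diagonal`). Signs do not move the points
of a configuration, so `SO⁺(p,q)` is transitive on the real configurations (`mem_SSPReal_iff`). Two
group elements give the same configuration exactly if they differ by a monomial matrix, that is, by
an element of `G` (`inv_mul_mem_squaresStabilizer_iff`). It remains to see that the continuous
bijection is closed. When configurations converge, their rows divided by their norms converge along
an ultrafilter to points of the support of the limit (`exists_ultrafilter_limit`). If the limit is
again a real decomposition, these points are not isotropic for `b`, while the rows have `b`-length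
`±1`; so the norms converge, and with them the matrices (`exists_mem_closure_of_mem_closure`).

Assertion 2. The degree `n` piece of an ideal in the Hilbert scheme is the common kernel of `n`
functionals. Contracting these with monomials of degree `n - 2` gives symmetric matrices. For a
decomposition they are combinations of the matrices `a aᵗ` with orthogonal vectors `a`, hence `C b
C' = C' b C`. This is polynomial and persists on the Zariski closure. At a real point the real and
imaginary parts of the matrices inherit it. If `f` is definite, `b` becomes `±1` in suitable real
coordinates, the matrices commute, and the spectral theorem diagonalizes all of them at once. So the
ideal contains all products of two distinct coordinate forms, and it is the ideal of `n` orthogonal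
real points (`ideal_eq_configIdeal`).

Assertion 3. Polynomial equations and reality are closed conditions; for reality one needs that a
point of the Hilbert scheme is determined by a single graded piece (`ideal_le_of_degPart_le`). If
`f` is indefinite, replacing `v² - w²` by `½(v + iw)² + ½(v - iw)²` gives a real point of the
variety of sums of powers with only `n - 2` real points in its support. Were it a limit of real
decompositions, two of the `n` limits of normalized rows would be the same non-isotropic point,
although their orthogonality survives in the limit. -/

theorem degree_eq_of_mem_support {n d : ℕ} {R : Type*} [CommSemiring R] {p : MvPolynomial (Fin n) R}
    (hp : p.IsHomogeneous d) {m : Fin n →₀ ℕ} (hm : m ∈ p.support) : m.degree = d := by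
  rw [Finsupp.degree_eq_weight_one]
  exact hp (mem_support_iff.1 hm)

theorem mem_mon_iff {n d : ℕ} (m : Fin n →₀ ℕ) :
    m ∈ Finset.finsuppAntidiag (Finset.univ : Finset (Fin n)) d ↔ m.degree = d := by
  simp [Finset.mem_finsuppAntidiag, Finsupp.degree_eq_sum]

/-- A form of degree `d` is determined by its coefficients. -/
def coeffEquiv (n d : ℕ) : homogeneousSubmodule (Fin n) ℂ d ≃ₗ[ℂ] (Mon n d → ℂ) where
  toFun p m := coeff m.1 p.1
  map_add' p q := by ext m; simp
  map_smul' c p := by ext m; simp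
  invFun w := ⟨∑ m : Mon n d, monomial m.1 (w m), by
    refine Submodule.sum_mem _ fun m _ => ?_
    exact isHomogeneous_monomial _ ((mem_mon_iff m.1).1 m.2)⟩
  left_inv p := by
    ext m
    simp only [coeff_sum, coeff_monomial]
    by_cases hm : m.degree = d
    · rw [Finset.sum_eq_single (⟨m, (mem_mon_iff m).2 hm⟩ : Mon n d)]
      · simp
      · intro b _ hb
        rw [if_neg]
        intro h
        exact hb (Subtype.ext h)
      · simp
    · rw [Finset.sum_eq_zero]
      · by_contra hne
        exact hm (degree_eq_of_mem_support p.2 (mem_support_iff.2 (Ne.symm hne)))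
      · intro b _
        rw [if_neg]
        rintro rfl
        exact hm ((mem_mon_iff _).1 b.2)
  right_inv w := by
    ext m
    simp only [coeff_sum, coeff_monomial]
    rw [Finset.sum_eq_single m]
    · simp
    · intro b _ hb
      rw [if_neg]
      intro h
      exact hb (Subtype.ext h)
    · simp

instance finiteDimensional_forms (n d : ℕ) :
    FiniteDimensional ℂ (homogeneousSubmodule (Fin n) ℂ d) :=
  LinearEquiv.finiteDimensional (coeffEquiv n d).symm

/-- The linear functional on forms of degree `d` with the given coordinates. -/
def functional {n d : ℕ} (w : Mon n d → ℂ) : homogeneousSubmodule (Fin n) ℂ d →ₗ[ℂ] ℂ where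
  toFun p := ∑ m : Mon n d, w m * coeff m.1 p.1
  map_add' p q := by simp [mul_add, Finset.sum_add_distrib]
  map_smul' c p := by simp [Finset.mul_sum, mul_left_comm]

theorem functional_apply {n d : ℕ} (w : Mon n d → ℂ) (p : homogeneousSubmodule (Fin n) ℂ d) :
    functional w p = ∑ m : Mon n d, w m * coeff m.1 p.1 := rfl

theorem functional_monomial {n d : ℕ} (w : Mon n d → ℂ) (m : Mon n d) (c : ℂ) :
    functional w ⟨monomial m.1 c, isHomogeneous_monomial _ ((mem_mon_iff m.1).1 m.2)⟩ =
      w m * c := by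
  rw [functional_apply, Finset.sum_eq_single m]
  · simp
  · intro b _ hb
    rw [coeff_monomial, if_neg, mul_zero]
    intro h
    exact hb (Subtype.ext h.symm)
  · simp

theorem mem_frameKernel {n r d : ℕ} {M : Matrix (Fin r) (Mon n d) ℂ}
    {p : homogeneousSubmodule (Fin n) ℂ d} :
    p ∈ frameKernel M ↔ ∀ i, functional (M i) p = 0 := Iff.rfl

theorem mem_degPart {n d : ℕ} {I : Ideal (MvPolynomial (Fin n) ℂ)}
    {p : homogeneousSubmodule (Fin n) ℂ d} : p ∈ degPart I d ↔ p.1 ∈ I := Iff.rfl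

/-- The monomials of degree `d`, evaluated at a point. -/
def monomialVec {n : ℕ} (d : ℕ) (a : Fin n → ℂ) : Mon n d → ℂ := fun m => ∏ j, a j ^ m.1 j

theorem functional_monomialVec {n d : ℕ} (a : Fin n → ℂ)
    (p : homogeneousSubmodule (Fin n) ℂ d) : functional (monomialVec d a) p = eval a p.1 := by
  conv_rhs => rw [← (coeffEquiv n d).symm_apply_apply p]
  simp only [coeffEquiv, LinearEquiv.coe_symm_mk', map_sum, eval_monomial, functional_apply,
    monomialVec]
  refine Finset.sum_congr rfl fun m _ => ?_
  rw [mul_comm, Finsupp.prod_fintype _ _ (by simp)]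
  rfl

theorem continuous_monomialVec (n d : ℕ) :
    Continuous (monomialVec d : (Fin n → ℂ) → Mon n d → ℂ) := by
  unfold monomialVec
  fun_prop

theorem homogeneousComponent_X_mul {n : ℕ} (j : Fin n) (d : ℕ) (p : MvPolynomial (Fin n) ℂ) :
    homogeneousComponent (d + 1) (X j * p) = X j * homogeneousComponent d p := by
  ext m
  rw [coeff_homogeneousComponent, coeff_X_mul', coeff_X_mul', coeff_homogeneousComponent]
  by_cases hj : j ∈ m.support
  · have h1 : (m - Finsupp.single j 1).degree + 1 = m.degree := by
      have h2 : m - Finsupp.single j 1 + Finsupp.single j 1 = m := by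
        apply tsub_add_cancel_of_le
        rw [Finsupp.single_le_iff]
        exact Nat.one_le_iff_ne_zero.2 (Finsupp.mem_support_iff.1 hj)
      conv_rhs => rw [← h2]
      rw [map_add, Finsupp.degree_single]
    rw [if_pos hj, if_pos hj]
    congr 1
    rw [← h1]
    simp
  · rw [if_neg hj, if_neg hj, ite_self]

/-! ### Configurations of points -/

theorem eval_smul_of_isHomogeneous {n d : ℕ} {p : MvPolynomial (Fin n) ℂ}
    (hp : p.IsHomogeneous d) (c : ℂ) (a : Fin n → ℂ) : eval (c • a) p = c ^ d * eval a p := by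
  rw [eval_eq, eval_eq, Finset.mul_sum]
  refine Finset.sum_congr rfl fun m hm => ?_
  have h1 : m.degree = d := degree_eq_of_mem_support hp hm
  rw [← h1, Finsupp.degree_eq_sum]
  simp only [Pi.smul_apply, smul_eq_mul, mul_pow, Finset.prod_mul_distrib]
  have : ∏ x ∈ m.support, c ^ m x = c ^ ∑ i, m i := by
    rw [Finset.prod_pow_eq_pow_sum]
    congr 1
    exact Finset.sum_subset (Finset.subset_univ _) (by simp)
  rw [this]
  ring

theorem mem_configIdeal_iff {n r : ℕ} {a : Fin r → Fin n → ℂ} {p : MvPolynomial (Fin n) ℂ} :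
    p ∈ configIdeal a ↔ ∀ i (c : ℂ), eval (c • a i) p = 0 := by
  simp only [configIdeal, mem_vanishingIdeal_iff, Set.mem_ofPred_eq, forall_exists_index]
  constructor
  · intro h i c
    simpa using h _ i c rfl
  · rintro h x i c rfl
    simpa using h i c

/-- On the line through `a i` the polynomial is a polynomial in the scalar `c` whose coefficients
are the values of the homogeneous components. It vanishes for all `c` in the infinite field `ℂ` only
if every coefficient does. -/
theorem mem_configIdeal {n r : ℕ} {a : Fin r → Fin n → ℂ} {p : MvPolynomial (Fin n) ℂ} :
    p ∈ configIdeal a ↔ ∀ i d, eval (a i) (homogeneousComponent d p) = 0 := by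
  have key : ∀ i (c : ℂ), eval (c • a i) p =
      ∑ d ∈ Finset.range (p.totalDegree + 1), c ^ d * eval (a i) (homogeneousComponent d p) := by
    intro i c
    conv_lhs => rw [← sum_homogeneousComponent p]
    rw [map_sum]
    exact Finset.sum_congr rfl fun d _ =>
      eval_smul_of_isHomogeneous (homogeneousComponent_isHomogeneous d p) _ _
  rw [mem_configIdeal_iff]
  constructor
  · intro h i d
    let P : Polynomial ℂ := ∑ d ∈ Finset.range (p.totalDegree + 1),
      Polynomial.monomial d (eval (a i) (homogeneousComponent d p))
    have hP : P = 0 := by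
      apply Polynomial.funext
      intro c
      rw [Polynomial.eval_zero, ← h i c, key, Polynomial.eval_finsetSum]
      exact Finset.sum_congr rfl fun d _ => by rw [Polynomial.eval_monomial, mul_comm]
    by_cases hd : d < p.totalDegree + 1
    · have := congrArg (fun Q => Polynomial.coeff Q d) hP
      simpa [P, Polynomial.finsetSum_coeff, Polynomial.coeff_monomial, hd] using this
    · rw [homogeneousComponent_eq_zero _ _ (by omega), map_zero]
  · intro h i c
    rw [key]
    exact Finset.sum_eq_zero fun d _ => by rw [h, mul_zero]

theorem mem_configIdeal_of_isHomogeneous {n r d : ℕ} {a : Fin r → Fin n → ℂ}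
    {p : MvPolynomial (Fin n) ℂ} (hp : p.IsHomogeneous d) :
    p ∈ configIdeal a ↔ ∀ i, eval (a i) p = 0 := by
  rw [mem_configIdeal]
  constructor
  · intro h i
    simpa [homogeneousComponent_eq_self hp] using h i d
  · intro h i e
    rw [homogeneousComponent_of_mem hp]
    split_ifs
    · exact h i
    · simp

theorem configIdeal_isHomogeneous {n r : ℕ} (a : Fin r → Fin n → ℂ) :
    (configIdeal a).IsHomogeneous (homogeneousSubmodule (Fin n) ℂ) := by
  intro d p hp
  have h1 : ((DirectSum.decompose (homogeneousSubmodule (Fin n) ℂ) p d :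
      homogeneousSubmodule (Fin n) ℂ d) : MvPolynomial (Fin n) ℂ) = homogeneousComponent d p :=
    decomposition.decompose'_apply p d
  rw [h1, mem_configIdeal_of_isHomogeneous (homogeneousComponent_isHomogeneous d p)]
  exact fun i => mem_configIdeal.1 hp i d

theorem configIdeal_isSaturated {n r : ℕ} {a : Fin r → Fin n → ℂ} (ha : ∀ i, a i ≠ 0)
    (p : MvPolynomial (Fin n) ℂ) (h : ∀ j, X j * p ∈ configIdeal a) : p ∈ configIdeal a := by
  rw [mem_configIdeal]
  intro i d
  obtain ⟨j, hj⟩ := Function.ne_iff.1 (ha i)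
  have h1 := mem_configIdeal.1 (h j) i (d + 1)
  rw [homogeneousComponent_X_mul, map_mul, eval_X] at h1
  exact (mul_eq_zero.1 h1).resolve_left hj

/-- The linear forms that are dual to the rows of an invertible matrix. -/
def dualForm {n : ℕ} (A : Fin n → Fin n → ℂ) (l : Fin n) : MvPolynomial (Fin n) ℂ :=
  linForm (fun j => (Matrix.of A)⁻¹ j l)

theorem eval_linForm {n : ℕ} {K : Type*} [CommSemiring K] (a x : Fin n → K) :
    eval x (linForm a) = a ⬝ᵥ x := by
  simp [linForm, dotProduct]

theorem isHomogeneous_linForm {n : ℕ} {K : Type*} [CommSemiring K] (a : Fin n → K) :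
    (linForm a).IsHomogeneous 1 := by
  refine IsHomogeneous.sum _ _ _ fun j _ => ?_
  simpa using (isHomogeneous_C (Fin n) (a j)).mul (isHomogeneous_X K j)

theorem eval_dualForm {n : ℕ} {A : Fin n → Fin n → ℂ} (hA : IsUnit (Matrix.of A).det) (k l : Fin n) :
    eval (A k) (dualForm A l) = if k = l then 1 else 0 := by
  rw [dualForm, eval_linForm, dotProduct_comm, ← Matrix.one_apply, ← Matrix.mul_nonsing_inv _ hA]
  rfl

theorem isHomogeneous_dualForm {n : ℕ} (A : Fin n → Fin n → ℂ) (l : Fin n) :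
    (dualForm A l).IsHomogeneous 1 := isHomogeneous_linForm _

/-- Evaluation at the points is onto in every positive degree, since the `d`-th powers of the dual
forms take the values of a Kronecker delta there. In degree `0` this would fail for more than one
point. -/
theorem finrank_degPart_configIdeal {n : ℕ} {A : Fin n → Fin n → ℂ}
    (hA : IsUnit (Matrix.of A).det) {d : ℕ} (hd : 1 ≤ d) :
    Module.finrank ℂ (homogeneousSubmodule (Fin n) ℂ d ⧸ degPart (configIdeal A) d) = n := by
  let φ : homogeneousSubmodule (Fin n) ℂ d →ₗ[ℂ] (Fin n → ℂ) :=
    LinearMap.pi fun i => functional (monomialVec d (A i))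
  have hφ : ∀ p i, φ p i = eval (A i) p.1 := fun p i => functional_monomialVec _ _
  have hker : LinearMap.ker φ = degPart (configIdeal A) d := by
    ext p
    rw [LinearMap.mem_ker, mem_degPart, mem_configIdeal_of_isHomogeneous p.2, funext_iff]
    simp only [hφ, Pi.zero_apply]
  have hsurj : Function.Surjective φ := by
    intro v
    have hy : ∀ l, (dualForm A l ^ d).IsHomogeneous d := fun l => by
      simpa using (isHomogeneous_dualForm A l).pow d
    refine ⟨∑ l, v l • ⟨dualForm A l ^ d, hy l⟩, ?_⟩
    · ext i
      rw [map_sum, Finset.sum_apply, Finset.sum_eq_single i]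
      · simp [hφ, eval_dualForm hA]
      · intro l _ hl
        simp [hφ, eval_dualForm hA, hl.symm, Nat.one_le_iff_ne_zero.1 hd]
      · simp
  rw [← hker, (LinearMap.quotKerEquivOfSurjective φ hsurj).finrank_eq]
  simp

theorem row_ne_zero {n : ℕ} {K : Type*} [Field K] {A : Fin n → Fin n → K}
    (hA : IsUnit (Matrix.of A).det) (i : Fin n) : A i ≠ 0 := by
  intro h
  rw [Matrix.det_eq_zero_of_row_eq_zero (A := Matrix.of A) i (fun j => congrFun h j)] at hA
  exact not_isUnit_zero hA

/-- The point of the Hilbert scheme that is given by `n` independent points. -/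
def configPoint {n : ℕ} (hn : 1 ≤ n) (A : Fin n → Fin n → ℂ) (hA : IsUnit (Matrix.of A).det) :
    HilbPoint n n where
  ideal := configIdeal A
  isHomogeneous := configIdeal_isHomogeneous A
  isSaturated := configIdeal_isSaturated (row_ne_zero hA)
  hilbertFunction _ hd := finrank_degPart_configIdeal hA (hn.trans hd)

theorem eval_single_of_isHomogeneous {n d : ℕ} {p : MvPolynomial (Fin n) ℂ}
    (hp : p.IsHomogeneous d) (l : Fin n) :
    eval (Pi.single l 1) p = coeff (Finsupp.single l d) p := by
  rw [eval_eq']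
  have h0 : ∀ m ∈ p.support, m ≠ Finsupp.single l d →
      coeff m p * ∏ i, (Pi.single l 1 : Fin n → ℂ) i ^ m i = 0 := by
    intro m hm hne
    have h1 : m.degree = d := degree_eq_of_mem_support hp hm
    have h2 : ∃ k, k ≠ l ∧ m k ≠ 0 := by
      by_contra! hcon
      apply hne
      have h3 : m = Finsupp.single l (m l) := by
        ext k
        by_cases hk : k = l
        · simp [hk]
        · simp [hcon k hk, Ne.symm hk]
      rw [h3, Finsupp.degree_single] at h1
      rw [h3, h1]
    obtain ⟨k, hk, hmk⟩ := h2
    rw [Finset.prod_eq_zero (Finset.mem_univ k), mul_zero]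
    simp [hk, hmk]
  rw [Finset.sum_eq_single (Finsupp.single l d) h0]
  · have : ∏ i, (Pi.single l 1 : Fin n → ℂ) i ^ (Finsupp.single l d) i = 1 := by
      refine Finset.prod_eq_one fun k _ => ?_
      by_cases hk : k = l
      · simp [hk]
      · simp [hk]
    rw [this, mul_one]
  · intro h
    rw [notMem_support_iff.1 h, zero_mul]

/-! ### Recovering a configuration from its quadrics and from its points -/

/-- In the coordinates given by the dual forms the points are the coordinate points. A form
vanishing there contains no pure power of a coordinate, so each of its monomials is divisible by a
product of two distinct coordinates. -/
theorem configIdeal_le_of_dualForm_mul_mem {n : ℕ} (hn : 1 ≤ n) {A : Fin n → Fin n → ℂ}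
    (hA : IsUnit (Matrix.of A).det) {I : Ideal (MvPolynomial (Fin n) ℂ)}
    (h : ∀ k l, k ≠ l → dualForm A k * dualForm A l ∈ I) : configIdeal A ≤ I := by
  have key : ∀ (d : ℕ) (q : MvPolynomial (Fin n) ℂ), q.IsHomogeneous d →
      (∀ i, eval (A i) q = 0) → q ∈ I := by
    intro d q hq h0
    -- `θ q` is `q` written as a polynomial in the dual forms.
    let θ : MvPolynomial (Fin n) ℂ →ₐ[ℂ] MvPolynomial (Fin n) ℂ :=
      aeval fun j => linForm (fun l => A l j)
    have hθ : (θ q).IsHomogeneous d := by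
      have := hq.aeval (fun j => linForm (fun l => A l j)) (fun j => isHomogeneous_linForm _)
      rwa [one_mul] at this
    have hback : aeval (dualForm A) (θ q) = q := by
      have : (aeval (dualForm A)).comp θ = AlgHom.id ℂ (MvPolynomial (Fin n) ℂ) := by
        apply algHom_ext
        intro j
        have h1 : ∀ m, ∑ l, A l j * (Matrix.of A)⁻¹ m l = if m = j then 1 else 0 := by
          intro m
          rw [← Matrix.one_apply, ← Matrix.nonsing_inv_mul _ hA, Matrix.mul_apply]
          exact Finset.sum_congr rfl fun l _ => mul_comm _ _
        simp only [θ, AlgHom.comp_apply, aeval_X, linForm, map_sum, map_mul, algHom_C,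
          algebraMap_eq, dualForm, Finset.mul_sum, AlgHom.coe_id, id]
        rw [Finset.sum_comm]
        simp only [← mul_assoc, ← C_mul, ← Finset.sum_mul, ← map_sum, h1]
        simp [apply_ite, ite_mul]
      exact DFunLike.congr_fun this q
    have hpure : ∀ l, coeff (Finsupp.single l d) (θ q) = 0 := by
      intro l
      rw [← eval_single_of_isHomogeneous hθ, ← h0 l]
      change eval (Pi.single l 1) (aeval _ q) = _
      rw [aeval_def, algebraMap_eq, eval_eval₂, ← eval₂_id]
      congr 1
      · ext c
        simp
      · ext j
        rw [eval_linForm]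
        simp
    rw [← hback, aeval_def, eval₂_eq']
    refine Ideal.sum_mem _ fun m hm => ?_
    have h1 : m.degree = d := degree_eq_of_mem_support hθ hm
    by_cases hkl : ∃ k l, k ≠ l ∧ m k ≠ 0 ∧ m l ≠ 0
    · obtain ⟨k, l, hne, hk, hl⟩ := hkl
      apply Ideal.mul_mem_left
      have h2 : dualForm A k * dualForm A l ∣ ∏ i, dualForm A i ^ m i := by
        rw [← Finset.prod_pair hne]
        refine (Finset.prod_dvd_prod_of_dvd _ (fun i => dualForm A i ^ m i) fun i hi => ?_).trans
          (Finset.prod_dvd_prod_of_subset _ _ _ (Finset.subset_univ {k, l}))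
        refine dvd_pow_self _ ?_
        rcases Finset.mem_insert.1 hi with rfl | hi
        · exact hk
        · rwa [Finset.mem_singleton.1 hi]
      exact Ideal.mem_of_dvd _ h2 (h k l hne)
    · push Not at hkl
      -- In degree `0` the constant monomial counts as a pure power; choosing its index is where `1
      -- ≤ n` enters.
      have : ∃ l, m = Finsupp.single l d := by
        by_cases hm0 : m = 0
        · refine ⟨⟨0, hn⟩, ?_⟩
          rw [hm0] at h1 ⊢
          rw [← h1]
          simp
        · obtain ⟨l, hl⟩ := Finsupp.ne_iff.1 hm0
          refine ⟨l, ?_⟩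
          have h3 : m = Finsupp.single l (m l) := by
            ext k
            by_cases hk : k = l
            · simp [hk]
            · rw [Finsupp.single_apply, if_neg (Ne.symm hk)]
              by_contra hmk
              exact hl (hkl k l hk hmk)
          rw [h3, Finsupp.degree_single] at h1
          rw [h3, h1]
      obtain ⟨l, rfl⟩ := this
      rw [hpure, map_zero, zero_mul]
      exact Ideal.zero_mem _
  intro q hq
  rw [← sum_homogeneousComponent q]
  exact Ideal.sum_mem _ fun d _ => key d _ (homogeneousComponent_isHomogeneous d q)
    (fun i => mem_configIdeal.1 hq i d)

/-- One inclusion together with equal codimension `n` gives equality in all degrees `≥ n`. Lower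
degrees follow on multiplying by the `n`-th power of a variable that does not vanish at the given
point. -/
theorem ideal_eq_configIdeal {n : ℕ} (hn : 1 ≤ n) {A : Fin n → Fin n → ℂ}
    (hA : IsUnit (Matrix.of A).det) {J : HilbPoint n n}
    (h : ∀ k l, k ≠ l → dualForm A k * dualForm A l ∈ J.ideal) : J.ideal = configIdeal A := by
  have hle := configIdeal_le_of_dualForm_mul_mem hn hA h
  have heq : ∀ d, n ≤ d → degPart (configIdeal A) d = degPart J.ideal d := by
    intro d hd
    apply Submodule.eq_of_le_of_finrank_eq
    · intro p hp
      exact hle hp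
    · have h1 := Submodule.finrank_quotient_add_finrank (degPart (configIdeal A) d)
      have h2 := Submodule.finrank_quotient_add_finrank (degPart J.ideal d)
      rw [finrank_degPart_configIdeal hA (hn.trans hd)] at h1
      rw [J.hilbertFunction d hd] at h2
      omega
  refine le_antisymm ?_ hle
  intro p hp
  rw [mem_configIdeal]
  intro i d
  obtain ⟨j, hj⟩ := Function.ne_iff.1 (row_ne_zero hA i)
  have h1 := homogeneousComponent_mem_of_mem J.isHomogeneous hp d
  have h2 : X j ^ n * homogeneousComponent d p ∈ J.ideal := Ideal.mul_mem_left _ _ h1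
  have h3 : (X j ^ n * homogeneousComponent d p).IsHomogeneous (n + d) := by
    simpa using (isHomogeneous_X_pow j n).mul (homogeneousComponent_isHomogeneous d p)
  have h4 : (⟨_, h3⟩ : homogeneousSubmodule (Fin n) ℂ (n + d)) ∈ degPart J.ideal (n + d) := h2
  rw [← heq _ (by omega), mem_degPart, mem_configIdeal_of_isHomogeneous h3] at h4
  have h5 := h4 i
  rw [map_mul, map_pow, eval_X] at h5
  exact (mul_eq_zero.1 h5).resolve_left (pow_ne_zero _ hj)

/-- A common zero of the degree `n` piece alone is already one of the points: products of distinct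
dual forms vanish at `v`, so only one of its dual coordinates is nonzero. -/
theorem exists_smul_row_of_eval_eq_zero {n : ℕ} {A : Fin n → Fin n → ℂ}
    (hA : IsUnit (Matrix.of A).det) {v : Fin n → ℂ} (hv : v ≠ 0)
    (h : ∀ p ∈ degPart (configIdeal A) n, eval v p.1 = 0) :
    ∃ i, ∃ c : ℂ, c ≠ 0 ∧ v = c • A i := by
  have hexp : v = ∑ k, eval v (dualForm A k) • A k := by
    have h1 : v = Matrix.vecMul (Matrix.vecMul v (Matrix.of A)⁻¹) (Matrix.of A) := by
      rw [Matrix.vecMul_vecMul, Matrix.nonsing_inv_mul _ hA, Matrix.vecMul_one]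
    conv_lhs => rw [h1]
    ext j
    simp only [Matrix.vecMul, dualForm, eval_linForm, Finset.sum_apply, Pi.smul_apply, smul_eq_mul]
    refine Finset.sum_congr rfl fun k _ => ?_
    rw [dotProduct_comm]
    rfl
  have hprod : ∀ k l, k ≠ l → eval v (dualForm A k) * eval v (dualForm A l) = 0 := by
    intro k l hkl
    have hn2 : 2 ≤ n := by
      have := k.2; have := l.2
      by_contra hlt
      exact hkl (Fin.ext (by omega))
    -- The exponent `n - 1` raises the product of two dual forms to degree exactly `n`.
    have h3 : (dualForm A k ^ (n - 1) * dualForm A l).IsHomogeneous n := by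
      have := ((isHomogeneous_dualForm A k).pow (n - 1)).mul
        (isHomogeneous_dualForm A l)
      simpa [show n - 1 + 1 = n by omega] using this
    have h4 := h ⟨_, h3⟩ (by
      rw [mem_degPart, mem_configIdeal_of_isHomogeneous h3]
      intro i
      rw [map_mul, map_pow, eval_dualForm hA i k, eval_dualForm hA i l]
      by_cases hik : i = k
      · rw [if_neg (fun h => hkl (hik.symm.trans h)), mul_zero]
      · rw [if_neg hik, zero_pow (by omega), zero_mul])
    simp only [map_mul, map_pow] at h4
    rcases mul_eq_zero.1 h4 with h5 | h5
    · rw [pow_eq_zero_iff (by omega)] at h5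
      rw [h5, zero_mul]
    · rw [h5, mul_zero]
  have hex : ∃ i, eval v (dualForm A i) ≠ 0 := by
    by_contra! hcon
    apply hv
    rw [hexp]
    simp [hcon]
  obtain ⟨i, hi⟩ := hex
  refine ⟨i, _, hi, ?_⟩
  conv_lhs => rw [hexp]
  rw [Finset.sum_eq_single i]
  · intro k _ hk
    rw [(mul_eq_zero.1 (hprod k i hk)).resolve_right hi, zero_smul]
  · simp

theorem configIdeal_eq_of_rows {n r : ℕ} {a b : Fin r → Fin n → ℂ} (σ : Equiv.Perm (Fin r))
    {c : Fin r → ℂ} (hc : ∀ i, c i ≠ 0) (h : ∀ i, a i = c i • b (σ i)) :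
    configIdeal a = configIdeal b := by
  ext p
  simp only [mem_configIdeal_iff, h]
  constructor
  · intro H i t
    have := H (σ.symm i) (t * (c (σ.symm i))⁻¹)
    rwa [smul_smul, inv_mul_cancel_right₀ (hc _), Equiv.apply_symm_apply] at this
  · intro H i t
    rw [smul_smul]
    exact H _ _

theorem injective_of_row_eq_smul {n : ℕ} {K : Type*} [Field K] {A B : Fin n → Fin n → K}
    (hA : IsUnit (Matrix.of A).det) {σ : Fin n → Fin n} {c : Fin n → K} (hc : ∀ i, c i ≠ 0)
    (hσ : ∀ i, A i = c i • B (σ i)) : Function.Injective σ := by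
  intro i k hik
  by_contra hne
  apply hA.ne_zero
  have hi : A i = (c i * (c k)⁻¹) • A k := by
    rw [hσ i, hσ k, hik, smul_smul, inv_mul_cancel_right₀ (hc k)]
  have h2 : Matrix.of A = (Matrix.of A).updateRow i (A i) := by
    ext a b
    by_cases ha : a = i
    · rw [ha, Matrix.updateRow_self]; rfl
    · rw [Matrix.updateRow_ne ha]
  rw [h2, hi, Matrix.det_updateRow_smul]
  rw [Matrix.det_zero_of_row_eq hne, mul_zero]
  rw [Matrix.updateRow_self, Matrix.updateRow_ne (Ne.symm hne)]
  rfl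

theorem exists_perm_of_configIdeal_eq {n : ℕ} {A B : Fin n → Fin n → ℂ}
    (hA : IsUnit (Matrix.of A).det) (hB : IsUnit (Matrix.of B).det) (h : configIdeal A = configIdeal B) :
    ∃ (σ : Equiv.Perm (Fin n)) (c : Fin n → ℂ), (∀ i, c i ≠ 0) ∧ ∀ i, A i = c i • B (σ i) := by
  have h1 : ∀ i, ∃ j, ∃ c : ℂ, c ≠ 0 ∧ A i = c • B j := by
    intro i
    apply exists_smul_row_of_eval_eq_zero hB (row_ne_zero hA i)
    intro p hp
    rw [mem_degPart, ← h, mem_configIdeal_of_isHomogeneous p.2] at hp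
    exact hp i
  choose σ c hc hσ using h1
  have hinj := injective_of_row_eq_smul hA hc hσ
  exact ⟨Equiv.ofBijective σ (Finite.injective_iff_bijective.1 hinj), c, hc, hσ⟩

/-! ### Frames -/

/-- `functional` as a linear map. -/
def functionalHom (n d : ℕ) :
    (Mon n d → ℂ) →ₗ[ℂ] Module.Dual ℂ (homogeneousSubmodule (Fin n) ℂ d) where
  toFun := functional
  map_add' v w := by
    ext p
    simp [functional_apply, add_mul, Finset.sum_add_distrib]
  map_smul' c w := by
    ext p
    simp [functional_apply, Finset.mul_sum, mul_assoc]

theorem functionalHom_injective (n d : ℕ) : Function.Injective (functionalHom n d) := by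
  intro v w h
  ext m
  have h1 := DFunLike.congr_fun h
    ⟨monomial m.1 1, isHomogeneous_monomial _ ((mem_mon_iff m.1).1 m.2)⟩
  simpa using (functional_monomial v m 1).symm.trans (h1.trans (functional_monomial w m 1))

/-- The linear span of the rows of a matrix of functionals. -/
def rowSpan {n r d : ℕ} (M : Matrix (Fin r) (Mon n d) ℂ) : Submodule ℂ (Mon n d → ℂ) :=
  Submodule.span ℂ (Set.range fun i => M i)

/-- Finite-dimensional duality: a functional that vanishes on the common kernel of others is a
combination of them. -/
theorem mem_rowSpan_iff {n r d : ℕ} {M : Matrix (Fin r) (Mon n d) ℂ} {w : Mon n d → ℂ} :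
    w ∈ rowSpan M ↔ ∀ p ∈ frameKernel M, functional w p = 0 := by
  constructor
  · intro hw p hp
    have h1 : rowSpan M ≤
        LinearMap.ker ((Module.Dual.eval ℂ _ p).comp (functionalHom n d)) := by
      rw [rowSpan, Submodule.span_le]
      rintro _ ⟨i, rfl⟩
      exact hp i
    exact h1 hw
  · intro h
    have h1 : functionalHom n d w ∈
        Submodule.span ℂ (Set.range fun i => functionalHom n d (M i)) := by
      apply mem_span_of_iInf_ker_le_ker
      intro p hp
      rw [Submodule.mem_iInf] at hp
      exact h p hp
    have h2 : (Set.range fun i => functionalHom n d (M i)) =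
        functionalHom n d '' (Set.range fun i => M i) := by
      rw [← Set.range_comp]
      rfl
    rw [h2, Submodule.span_image] at h1
    obtain ⟨v, hv, hvw⟩ := h1
    rwa [functionalHom_injective n d hvw] at hv

/-- Linear independence is an open condition, so in this form membership passes to limits even while
the frame varies. -/
theorem mem_rowSpan_iff_not_linearIndependent {n d r : ℕ} (M : Frame n d r) {w : Mon n d → ℂ} :
    w ∈ rowSpan M.1 ↔
      ¬ LinearIndependent ℂ (Fin.cons w (fun i => M.1 i) : Fin (r + 1) → Mon n d → ℂ) := by
  rw [linearIndependent_finCons, not_and_not_right]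
  exact ⟨fun h _ => h, fun h => h M.2⟩

open Filter Topology in
theorem mem_rowSpan_of_tendsto {n d r : ℕ} {ι : Type*} {l : Filter ι} [l.NeBot]
    {M : ι → Frame n d r} {M₀ : Frame n d r} (hM : Tendsto M l (𝓝 M₀))
    {w : ι → Mon n d → ℂ} {w₀ : Mon n d → ℂ} (hw : Tendsto w l (𝓝 w₀))
    (h : ∀ᶠ i in l, w i ∈ rowSpan (M i).1) : w₀ ∈ rowSpan M₀.1 := by
  rw [mem_rowSpan_iff_not_linearIndependent]
  intro hli
  have hopen : IsOpen {v : Fin (r + 1) → Mon n d → ℂ | LinearIndependent ℂ v} :=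
    isOpen_setOfPred_linearIndependent
  have ht : Tendsto (fun i => (Fin.cons (w i) (fun k => (M i).1 k) : Fin (r + 1) → Mon n d → ℂ)) l
      (𝓝 (Fin.cons w₀ (fun k => M₀.1 k))) := by
    rw [tendsto_pi_nhds]
    intro k
    refine Fin.cases ?_ (fun k => ?_) k
    · simpa using hw
    · simp only [Fin.cons_succ]
      exact tendsto_pi_nhds.1 ((continuous_subtype_val.tendsto M₀).comp hM) k
  obtain ⟨i, hi1, hi2⟩ := ((ht.eventually (hopen.mem_nhds hli)).and h).exists
  exact (mem_rowSpan_iff_not_linearIndependent (M i)).1 hi2 hi1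

theorem rowSpan_eq_of_frameKernel_eq {n r d : ℕ} {M M' : Matrix (Fin r) (Mon n d) ℂ}
    (h : frameKernel M = frameKernel M') : rowSpan M = rowSpan M' := by
  ext w
  rw [mem_rowSpan_iff, mem_rowSpan_iff, h]

theorem row_mem_rowSpan {n r d : ℕ} (M : Matrix (Fin r) (Mon n d) ℂ) (i : Fin r) :
    M i ∈ rowSpan M := Submodule.subset_span ⟨i, rfl⟩

/-- Change of basis for frames. -/
def Frame.act {n d r : ℕ} (h : GL (Fin r) ℂ) (M : Frame n d r) : Frame n d r :=
  ⟨h.1 * M.1, by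
    have h1 : Function.Injective fun v => Matrix.vecMul v (h.1 * M.1) := by
      have h2 : Function.Injective fun v => Matrix.vecMul v h.1 :=
        Matrix.vecMul_injective_iff_isUnit.2 h.isUnit
      have h3 : Function.Injective fun v => Matrix.vecMul v M.1 :=
        Matrix.vecMul_injective_iff.2 M.2
      simpa only [Matrix.vecMul_vecMul, Function.comp_def] using h3.comp h2
    exact Matrix.vecMul_injective_iff.1 h1⟩

theorem Frame.frameKernel_act {n d r : ℕ} (h : GL (Fin r) ℂ) (M : Frame n d r) :
    frameKernel (M.act h).1 = frameKernel M.1 := by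
  have key : ∀ (h : GL (Fin r) ℂ) (M : Frame n d r),
      frameKernel M.1 ≤ frameKernel (M.act h).1 := by
    intro h M p hp i
    change ∑ m, (h.1 * M.1) i m * _ = 0
    simp only [Matrix.mul_apply, Finset.sum_mul]
    rw [Finset.sum_comm]
    refine Finset.sum_eq_zero fun j _ => ?_
    simp only [mul_assoc, ← Finset.mul_sum]
    rw [show ∑ m, M.1 j m * coeff m.1 p.1 = 0 from hp j, mul_zero]
  apply le_antisymm _ (key h M)
  have h1 := key h⁻¹ (M.act h)
  have h2 : (M.act h).act h⁻¹ = M := by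
    apply Subtype.ext
    change (h⁻¹).1 * (h.1 * M.1) = M.1
    rw [← Matrix.mul_assoc, ← Units.val_mul, inv_mul_cancel, Units.val_one, Matrix.one_mul]
  rwa [h2] at h1

/-- The fibres of the quotient map from frames to subspaces are orbits of the general linear group,
which makes that map open. -/
theorem Frame.exists_act_eq {n d r : ℕ} {M M' : Frame n d r}
    (h : frameKernel M.1 = frameKernel M'.1) : ∃ g : GL (Fin r) ℂ, M.act g = M' := by
  have h1 : ∀ i, ∃ c : Fin r → ℂ, ∑ j, c j • M.1 j = M'.1 i := by
    intro i
    have := row_mem_rowSpan M'.1 i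
    rw [← rowSpan_eq_of_frameKernel_eq h] at this
    exact (Submodule.mem_span_range_iff_exists_fun ℂ).1 this
  choose c hc using h1
  have h2 : Matrix.of c * M.1 = M'.1 := by
    ext i m
    rw [Matrix.mul_apply, ← hc i, Finset.sum_apply]
    rfl
  have h3 : IsUnit (Matrix.of c) := by
    rw [← Matrix.vecMul_injective_iff_isUnit]
    have h4 : Function.Injective fun v => Matrix.vecMul v M'.1 :=
      Matrix.vecMul_injective_iff.2 M'.2
    intro v w hvw
    apply h4
    simp only [← h2, ← Matrix.vecMul_vecMul] at hvw ⊢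
    rw [hvw]
  exact ⟨h3.unit, Subtype.ext h2⟩

theorem Frame.continuous_act {n d r : ℕ} (h : GL (Fin r) ℂ) :
    Continuous (Frame.act h : Frame n d r → Frame n d r) :=
  (continuous_const.matrix_mul continuous_subtype_val).subtype_mk _

/-- The frame consists of the coordinates of an isomorphism from the quotient to `ℂ^r`, evaluated on
the monomials. -/
theorem exists_frame {n d r : ℕ} (E : Submodule ℂ (homogeneousSubmodule (Fin n) ℂ d))
    (hE : Module.finrank ℂ (homogeneousSubmodule (Fin n) ℂ d ⧸ E) = r) :
    ∃ M : Frame n d r, frameKernel M.1 = E := by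
  let e : (homogeneousSubmodule (Fin n) ℂ d ⧸ E) ≃ₗ[ℂ] (Fin r → ℂ) :=
    LinearEquiv.ofFinrankEq _ _ (by simpa using hE)
  let M : Matrix (Fin r) (Mon n d) ℂ := fun i m => e (Submodule.Quotient.mk
    ⟨monomial m.1 1, isHomogeneous_monomial _ ((mem_mon_iff m.1).1 m.2)⟩) i
  have hM : ∀ i p, functional (M i) p = e (Submodule.Quotient.mk p) i := by
    intro i p
    conv_rhs => rw [← (coeffEquiv n d).symm_apply_apply p]
    have h1 : (coeffEquiv n d).symm (coeffEquiv n d p) = ∑ m : Mon n d, coeff m.1 p.1 •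
        (⟨monomial m.1 1, isHomogeneous_monomial _ ((mem_mon_iff m.1).1 m.2)⟩ :
          homogeneousSubmodule (Fin n) ℂ d) := by
      apply Subtype.ext
      simp [coeffEquiv, smul_monomial]
    rw [h1, ← Submodule.mkQ_apply, map_sum, map_sum, Finset.sum_apply, functional_apply]
    refine Finset.sum_congr rfl fun m _ => ?_
    rw [map_smul, map_smul, Pi.smul_apply, smul_eq_mul, mul_comm]
    rfl
  refine ⟨⟨M, ?_⟩, ?_⟩
  · rw [Fintype.linearIndependent_iff]
    intro g hg i
    obtain ⟨p, hp⟩ := Submodule.mkQ_surjective E (e.symm (Pi.single i 1))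
    have h2 : functionalHom n d (∑ i, g i • M i) p = 0 := by
      rw [hg, map_zero, LinearMap.zero_apply]
    rw [map_sum, LinearMap.sum_apply, Finset.sum_eq_single i] at h2
    · rw [map_smul, LinearMap.smul_apply, show functionalHom n d (M i) p = _ from hM i p,
        ← Submodule.mkQ_apply, hp, LinearEquiv.apply_symm_apply] at h2
      simpa using h2
    · intro k _ hk
      rw [map_smul, LinearMap.smul_apply, show functionalHom n d (M k) p = _ from hM k p,
        ← Submodule.mkQ_apply, hp, LinearEquiv.apply_symm_apply]
      simp [hk]
    · simp
  · ext p
    rw [mem_frameKernel]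
    simp only [hM]
    rw [← Submodule.Quotient.mk_eq_zero E (x := p), ← e.map_eq_zero_iff, funext_iff]
    rfl

open Topology in
/-- A frame of a point in the closure of `S` is a limit of frames of points of `S`. -/
theorem mem_closure_frames {n r : ℕ} {S : Set (HilbPoint n r)} {J : HilbPoint n r}
    (hJ : J ∈ closure S) {M : Frame n r r} (hM : frameKernel M.1 = degPart J.ideal r) :
    M ∈ closure {M' : Frame n r r | ∃ K ∈ S, frameKernel M'.1 = degPart K.ideal r} := by
  rw [mem_closure_iff]
  intro U hU hMU
  let V : Set (Submodule ℂ (homogeneousSubmodule (Fin n) ℂ r)) :=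
    (fun M : Frame n r r => frameKernel M.1) '' U
  -- The saturation of an open set of frames is a union of preimages of it under changes of basis.
  have hV : IsOpen[grassmannTopology n r r] V := by
    rw [isOpen_coinduced]
    have h1 : (fun M : Frame n r r => frameKernel M.1) ⁻¹' V =
        ⋃ h : GL (Fin r) ℂ, Frame.act h ⁻¹' U := by
      ext N
      simp only [V, Set.mem_preimage, Set.mem_image, Set.mem_iUnion]
      constructor
      · rintro ⟨N', hN', hk⟩
        obtain ⟨h, rfl⟩ := Frame.exists_act_eq hk.symm
        exact ⟨h, hN'⟩
      · rintro ⟨h, hh⟩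
        exact ⟨_, hh, Frame.frameKernel_act h N⟩
    rw [h1]
    exact isOpen_iUnion fun h => hU.preimage (Frame.continuous_act h)
  have hW : IsOpen ((fun K : HilbPoint n r => degPart K.ideal r) ⁻¹' V) :=
    (@isOpen_induced_iff _ _ (grassmannTopology n r r) _ _).2 ⟨V, hV, rfl⟩
  obtain ⟨K, hKV, hKS⟩ := mem_closure_iff.1 hJ _ hW ⟨M, hMU, hM⟩
  obtain ⟨M', hM'U, hM'⟩ := hKV
  exact ⟨M', hM'U, K, hKS, hM'⟩

/-- The topology is induced from a quotient of the space of frames, so a continuous choice of frames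
suffices. -/
theorem continuous_hilbPoint {n r : ℕ} {Y : Type*} [TopologicalSpace Y] {φ : Y → HilbPoint n r}
    (M : Y → Frame n r r) (hM : Continuous M)
    (h : ∀ y, frameKernel (M y).1 = degPart (φ y).ideal r) : Continuous φ := by
  let := grassmannTopology n r r
  apply continuous_induced_rng.2
  have h1 : (fun K : HilbPoint n r => degPart K.ideal r) ∘ φ =
      (fun M : Frame n r r => frameKernel M.1) ∘ M := funext fun y => (h y).symm
  rw [h1]
  exact continuous_coinduced_rng.comp hM

theorem linearIndependent_monomialVec {n d : ℕ} (hd : 1 ≤ d) {A : Fin n → Fin n → ℂ}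
    (hA : IsUnit (Matrix.of A).det) : LinearIndependent ℂ fun i => monomialVec d (A i) := by
  rw [Fintype.linearIndependent_iff]
  intro g hg i
  have hy : (dualForm A i ^ d).IsHomogeneous d := by
    simpa using (isHomogeneous_dualForm A i).pow d
  have h2 : functionalHom n d (∑ i, g i • monomialVec d (A i)) ⟨_, hy⟩ = 0 := by
    rw [hg, map_zero, LinearMap.zero_apply]
  have h3 : ∀ k, functionalHom n d (monomialVec d (A k)) ⟨_, hy⟩ = if k = i then 1 else 0 := by
    intro k
    refine (functional_monomialVec _ _).trans ?_
    rw [map_pow, eval_dualForm hA]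
    split_ifs <;> simp [Nat.one_le_iff_ne_zero.1 hd]
  simpa [map_sum, map_smul, LinearMap.sum_apply, h3] using h2

/-- The frame of a configuration that consists of the monomials evaluated at the points. -/
def configFrame {n d : ℕ} (hd : 1 ≤ d) (A : Fin n → Fin n → ℂ) (hA : IsUnit (Matrix.of A).det) :
    Frame n d n :=
  ⟨fun i => monomialVec d (A i), linearIndependent_monomialVec hd hA⟩

theorem frameKernel_configFrame {n d : ℕ} (hd : 1 ≤ d) {A : Fin n → Fin n → ℂ}
    (hA : IsUnit (Matrix.of A).det) :
    frameKernel (configFrame hd A hA).1 = degPart (configIdeal A) d := by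
  ext p
  rw [mem_frameKernel, mem_degPart, mem_configIdeal_of_isHomogeneous p.2]
  exact forall_congr' fun i => by
    rw [← functional_monomialVec]
    rfl

/-- This translates "`v` is a zero of the degree `d` piece" into membership of its Veronese vector
in a row span, which can be followed through limits. -/
theorem monomialVec_mem_rowSpan_iff {n r d : ℕ} {M : Matrix (Fin r) (Mon n d) ℂ}
    {I : Ideal (MvPolynomial (Fin n) ℂ)} (hM : frameKernel M = degPart I d) {v : Fin n → ℂ} :
    monomialVec d v ∈ rowSpan M ↔ ∀ p ∈ degPart I d, eval v p.1 = 0 := by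
  rw [mem_rowSpan_iff, hM]
  simp only [functional_monomialVec]

/-! ### Sums of squares of linear forms and their matrices -/

/-- The quadric with the given matrix. -/
def quadric {n : ℕ} {K : Type*} [CommSemiring K] (G : Matrix (Fin n) (Fin n) K) :
    MvPolynomial (Fin n) K := ∑ j, ∑ k, C (G j k) * (X j * X k)

/-- The matrix of a sum of multiples of squares of linear forms. -/
def gram {n : ℕ} {K : Type*} [CommSemiring K] (c : Fin n → K) (a : Fin n → Fin n → K) :
    Matrix (Fin n) (Fin n) K := (Matrix.of a).transpose * Matrix.diagonal c * Matrix.of a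

theorem gram_apply {n : ℕ} {K : Type*} [CommSemiring K] (c : Fin n → K) (a : Fin n → Fin n → K)
    (j k : Fin n) : gram c a j k = ∑ i, a i j * c i * a i k := by
  rw [gram, Matrix.mul_apply]
  refine Finset.sum_congr rfl fun i _ => ?_
  rw [Matrix.mul_diagonal]
  rfl

theorem sum_sq_eq_quadric {n : ℕ} {K : Type*} [CommSemiring K] (c : Fin n → K)
    (a : Fin n → Fin n → K) :
    ∑ i, C (c i) * linForm (a i) ^ 2 = quadric (gram c a) := by
  simp only [quadric, gram_apply, map_sum, Finset.sum_mul, linForm, sq, Finset.mul_sum,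
    C_mul]
  rw [Finset.sum_comm]
  refine Finset.sum_congr rfl fun j _ => ?_
  rw [Finset.sum_comm]
  exact Finset.sum_congr rfl fun k _ => Finset.sum_congr rfl fun i _ => by ring

theorem eval_quadric {n : ℕ} {K : Type*} [CommSemiring K] (G : Matrix (Fin n) (Fin n) K)
    (x : Fin n → K) : eval x (quadric G) = ∑ j, ∑ k, G j k * (x j * x k) := by
  simp [quadric]

theorem gram_symm {n : ℕ} {K : Type*} [CommSemiring K] (c : Fin n → K)
    (a : Fin n → Fin n → K) (j k : Fin n) : gram c a j k = gram c a k j := by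
  rw [gram_apply, gram_apply]
  exact Finset.sum_congr rfl fun i _ => by ring

/-- Polarization: the values at `e_i` and `e_i + e_l` determine a symmetric matrix, because `2` is
invertible. -/
theorem quadric_injOn_symm {n : ℕ} {K : Type*} [Field K] [CharZero K]
    {G H : Matrix (Fin n) (Fin n) K} (hG : ∀ j k, G j k = G k j) (hH : ∀ j k, H j k = H k j)
    (h : quadric G = quadric H) : G = H := by
  have key : ∀ x : Fin n → K, ∑ j, ∑ k, G j k * (x j * x k) = ∑ j, ∑ k, H j k * (x j * x k) := by
    intro x
    rw [← eval_quadric, ← eval_quadric, h]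
  have e1 : ∀ (M : Matrix (Fin n) (Fin n) K) (i : Fin n), ∑ j, ∑ k, M j k *
      ((Pi.single i 1 : Fin n → K) j * (Pi.single i 1 : Fin n → K) k) = M i i := by
    intro M i
    simp [Pi.single_apply]
  have e2 : ∀ (M : Matrix (Fin n) (Fin n) K) (i l : Fin n), ∑ j, ∑ k, M j k *
      ((Pi.single i 1 + Pi.single l 1 : Fin n → K) j *
        (Pi.single i 1 + Pi.single l 1 : Fin n → K) k) = M i i + M i l + M l i + M l l := by
    intro M i l
    simp [Pi.single_apply, mul_add, Finset.sum_add_distrib]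
    ring
  have hd : ∀ i, G i i = H i i := fun i => by rw [← e1 G, ← e1 H, key]
  ext i l
  have h1 := key (Pi.single i 1 + Pi.single l 1)
  rw [e2, e2, hd i, hd l, hG l i, hH l i] at h1
  have h2 : (2 : K) * G i l = 2 * H i l := by linear_combination h1
  exact mul_left_cancel₀ two_ne_zero h2

theorem sum_sq_eq_iff {n : ℕ} {K : Type*} [Field K] [CharZero K] {c d : Fin n → K}
    {a b : Fin n → Fin n → K} :
    ∑ i, C (c i) * linForm (a i) ^ 2 = ∑ i, C (d i) * linForm (b i) ^ 2 ↔
      gram c a = gram d b := by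
  rw [sum_sq_eq_quadric, sum_sq_eq_quadric]
  exact ⟨quadric_injOn_symm (gram_symm c a) (gram_symm d b), fun h => by rw [h]⟩

theorem isUnit_det_of_gram {n : ℕ} {K : Type*} [Field K] {c : Fin n → K}
    {a : Fin n → Fin n → K} (h : IsUnit (gram c a).det) :
    IsUnit (Matrix.of a).det ∧ ∀ i, c i ≠ 0 := by
  rw [gram, Matrix.det_mul, Matrix.det_mul, Matrix.det_transpose, Matrix.det_diagonal] at h
  have h1 := h.ne_zero
  refine ⟨isUnit_of_mul_isUnit_right h, fun i hi => h1 ?_⟩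
  rw [Finset.prod_eq_zero (Finset.mem_univ i) hi]
  ring

/-- In a decomposition of a nondegenerate quadric the linear forms are orthogonal for the inverse
of the quadric. -/
theorem mul_inv_gram_mul {n : ℕ} {K : Type*} [Field K] {c : Fin n → K}
    {a : Fin n → Fin n → K} (h : IsUnit (gram c a).det) :
    Matrix.of a * (gram c a)⁻¹ * (Matrix.of a).transpose = Matrix.diagonal fun i => (c i)⁻¹ := by
  obtain ⟨h1, h2⟩ := isUnit_det_of_gram h
  have h3 : IsUnit (Matrix.of a).transpose.det := by rwa [Matrix.det_transpose]
  have h4 : (Matrix.diagonal c)⁻¹ = Matrix.diagonal fun i => (c i)⁻¹ := by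
    apply Matrix.inv_eq_left_inv
    rw [Matrix.diagonal_mul_diagonal, ← Matrix.diagonal_one]
    congr 1
    ext i
    exact inv_mul_cancel₀ (h2 i)
  rw [gram, Matrix.mul_inv_rev, Matrix.mul_inv_rev, ← Matrix.mul_assoc, ← Matrix.mul_assoc,
    Matrix.mul_nonsing_inv _ h1, Matrix.one_mul, Matrix.mul_assoc, Matrix.nonsing_inv_mul _ h3,
    Matrix.mul_one, h4]

theorem det_gram {n : ℕ} {K : Type*} [Field K] (c : Fin n → K) (a : Fin n → Fin n → K) :
    (gram c a).det = (Matrix.of a).det ^ 2 * ∏ i, c i := by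
  rw [gram, Matrix.det_mul, Matrix.det_mul, Matrix.det_transpose, Matrix.det_diagonal]
  ring

/-! ### The standard quadric -/

/-- The coefficients of the standard quadric. -/
def signs (p q : ℕ) : Fin (p + q) → ℝ := Fin.addCases (fun _ => 1) fun _ => -1

@[simp] theorem signs_castAdd {p q : ℕ} (i : Fin p) : signs p q (Fin.castAdd q i) = 1 := by
  simp [signs]

@[simp] theorem signs_natAdd {p q : ℕ} (i : Fin q) : signs p q (Fin.natAdd p i) = -1 := by
  simp [signs]

theorem signs_eq {p q : ℕ} (i : Fin (p + q)) : signs p q i = 1 ∨ signs p q i = -1 := by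
  refine Fin.addCases (fun i => ?_) (fun i => ?_) i <;> simp

theorem signs_mul_self {p q : ℕ} (i : Fin (p + q)) : signs p q i * signs p q i = 1 := by
  rcases signs_eq i with h | h <;> simp [h]

theorem signs_ne_zero {p q : ℕ} (i : Fin (p + q)) : signs p q i ≠ 0 := by
  rcases signs_eq i with h | h <;> simp [h]

theorem stdQuadric_eq (p q : ℕ) : stdQuadric p q = ∑ i, C (signs p q i) * X i ^ 2 := by
  simp [stdQuadric, Fin.sum_univ_add, sub_eq_add_neg]

theorem linSubst_stdQuadric {p q : ℕ} (A : Matrix (Fin (p + q)) (Fin (p + q)) ℝ) :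
    linSubst A (stdQuadric p q) = ∑ i, C (signs p q i) * linForm (A i) ^ 2 := by
  simp [stdQuadric_eq, linSubst, algHom_C]

theorem linSubst_stdQuadric_eq_iff {p q : ℕ} {A B : Matrix (Fin (p + q)) (Fin (p + q)) ℝ} :
    linSubst A (stdQuadric p q) = linSubst B (stdQuadric p q) ↔
      A.transpose * Matrix.diagonal (signs p q) * A =
        B.transpose * Matrix.diagonal (signs p q) * B := by
  rw [linSubst_stdQuadric, linSubst_stdQuadric]
  exact sum_sq_eq_iff

theorem mem_SO_iff {p q : ℕ} {g : GL (Fin (p + q)) ℝ} :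
    g ∈ SO p q ↔ g.1.transpose * Matrix.diagonal (signs p q) * g.1 = Matrix.diagonal (signs p q) ∧
      g.1.det = 1 := by
  have key : ∀ g : GL (Fin (p + q)) ℝ, g⁻¹ ∈ SO p q ↔
      g.1.transpose * Matrix.diagonal (signs p q) * g.1 = Matrix.diagonal (signs p q) ∧
      g.1.det = 1 := by
    intro g
    have h1 : stdQuadric p q = linSubst 1 (stdQuadric p q) := by rw [linSubst_one]; rfl
    rw [SO, Subgroup.mem_inf, inv_mem_iff (H := Matrix.GeneralLinearGroup.det.ker),
      MonoidHom.mem_ker, Units.ext_iff]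
    refine and_congr ?_ Iff.rfl
    change linSubst (g⁻¹⁻¹).1 (stdQuadric p q) = stdQuadric p q ↔ _
    conv_lhs => rhs; rw [h1]
    rw [inv_inv, linSubst_stdQuadric_eq_iff, Matrix.transpose_one, Matrix.one_mul, Matrix.mul_one]
  rw [← inv_mem_iff]
  nth_rw 1 [← inv_inv g]
  rw [inv_inv]
  exact key g

/-! ### Sylvester's law of inertia -/

theorem exists_perm_signs {p q : ℕ} {c : Fin (p + q) → ℝ} (hp : {i | 0 < c i}.ncard = p)
    (hq : {i | c i < 0}.ncard = q) :
    ∃ σ : Equiv.Perm (Fin (p + q)), ∀ i, 0 < signs p q i * c (σ i) := by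
  have h1 : ∃ e : Fin p ≃ {i | 0 < c i}, True :=
    ⟨(Finite.equivFinOfCardEq hp).symm, trivial⟩
  have h2 : ∃ e : Fin q ≃ {i | c i < 0}, True :=
    ⟨(Finite.equivFinOfCardEq hq).symm, trivial⟩
  obtain ⟨e1, -⟩ := h1
  obtain ⟨e2, -⟩ := h2
  let σ : Fin (p + q) → Fin (p + q) := Fin.addCases (fun i => (e1 i).1) fun i => (e2 i).1
  have hσ1 : ∀ i, σ (Fin.castAdd q i) = (e1 i).1 := fun i => by simp [σ]
  have hσ2 : ∀ i, σ (Fin.natAdd p i) = (e2 i).1 := fun i => by simp [σ]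
  have h1 : ∀ i, 0 < c (e1 i).1 := fun i => (e1 i).2
  have h2 : ∀ i, c (e2 i).1 < 0 := fun i => (e2 i).2
  have hinj : Function.Injective σ := by
    intro i j
    refine Fin.addCases (fun i => ?_) (fun i => ?_) i <;>
      refine Fin.addCases (fun j => ?_) (fun j => ?_) j <;> intro hij <;>
      simp only [hσ1, hσ2] at hij
    · rw [e1.injective (Subtype.ext hij)]
    · have := h1 i
      rw [hij] at this
      exact absurd this (h2 j).not_gt
    · have := h1 j
      rw [← hij] at this
      exact absurd this (h2 i).not_gt
    · rw [e2.injective (Subtype.ext hij)]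
  refine ⟨Equiv.ofBijective σ (Finite.injective_iff_bijective.1 hinj), fun i => ?_⟩
  refine Fin.addCases (fun i => ?_) (fun i => ?_) i
  · simpa [hσ1] using h1 i
  · simpa [hσ2] using h2 i

theorem exists_normalized {p q : ℕ} {c : Fin (p + q) → ℝ} {a : Fin (p + q) → Fin (p + q) → ℝ}
    (hp : {i | 0 < c i}.ncard = p) (hq : {i | c i < 0}.ncard = q) :
    ∃ (σ : Equiv.Perm (Fin (p + q))) (t : Fin (p + q) → ℝ), (∀ i, t i ≠ 0) ∧
      ∑ i, C (c i) * linForm (a i) ^ 2 =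
        ∑ i, C (signs p q i) * linForm (t i • a (σ i)) ^ 2 := by
  obtain ⟨σ, hσ⟩ := exists_perm_signs hp hq
  -- The radicand is `|c (σ i)|`, because the permutation matches the signs.
  refine ⟨σ, fun i => Real.sqrt (signs p q i * c (σ i)), fun i => (Real.sqrt_pos.2 (hσ i)).ne', ?_⟩
  rw [← Equiv.sum_comp σ]
  refine Finset.sum_congr rfl fun i _ => ?_
  have h1 : ∀ (t : ℝ) (v : Fin (p + q) → ℝ), linForm (t • v) = C t * linForm v := by
    intro t v
    simp [linForm, Finset.mul_sum, mul_assoc]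
  rw [h1, mul_pow, ← C_pow, Real.sq_sqrt (hσ i).le, ← mul_assoc, ← C_mul, ← mul_assoc,
    signs_mul_self, one_mul]

/-- The independent linear forms are coordinates in which the quadratic form is diagonal with
entries `c`, so the law of inertia applies. -/
theorem card_signs_of_decomposition {p q : ℕ} {f : MvPolynomial (Fin (p + q)) ℝ}
    (hf : HasSignature f p q) {c : Fin (p + q) → ℝ} {a : Fin (p + q) → Fin (p + q) → ℝ}
    (ha : IsUnit (Matrix.of a).det) (h : f = ∑ i, C (c i) * linForm (a i) ^ 2) :
    {i | 0 < c i}.ncard = p ∧ {i | c i < 0}.ncard = q := by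
  obtain ⟨-, Q, hQ, hp, hq⟩ := hf
  have he : QuadraticMap.Equivalent Q (QuadraticMap.weightedSumSquares ℝ c) := by
    let e : (Fin (p + q) → ℝ) ≃ₗ[ℝ] (Fin (p + q) → ℝ) :=
      Matrix.toLinearEquiv' (Matrix.of a) (Matrix.invertibleOfIsUnitDet _ ha)
    refine ⟨⟨e, fun x => ?_⟩⟩
    have h1 : ∀ i, e x i = a i ⬝ᵥ x := fun i => rfl
    change QuadraticMap.weightedSumSquares ℝ c (e x) = Q x
    rw [hQ, h, QuadraticMap.weightedSumSquares_apply, map_sum]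
    refine Finset.sum_congr rfl fun i _ => ?_
    rw [map_mul, map_pow, eval_C, eval_linForm, h1, smul_eq_mul, sq]
  exact ⟨(QuadraticForm.sigPos_of_equiv_weightedSumSquares he).symm.trans hp,
    (QuadraticForm.sigNeg_of_equiv_weightedSumSquares he).symm.trans hq⟩

theorem exists_linSubst_stdQuadric {p q : ℕ} {f : MvPolynomial (Fin (p + q)) ℝ}
    (hf : HasSignature f p q) :
    ∃ L : GL (Fin (p + q)) ℝ, linSubst L.1 (stdQuadric p q) = f := by
  have hf' := hf
  obtain ⟨-, Q, hQ, hp, hq⟩ := hf'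
  have : Invertible (2 : ℝ) := invertibleOfNonzero two_ne_zero
  obtain ⟨w, ⟨e⟩⟩ := Q.equivalent_weightedSumSquares
  let τ : Fin (p + q) ≃ Fin (Module.finrank ℝ (Fin (p + q) → ℝ)) := finCongr (by simp)
  let a : Fin (p + q) → Fin (p + q) → ℝ := fun i j => e (Pi.single j 1) (τ i)
  have ha : ∀ i x, a i ⬝ᵥ x = e x (τ i) := by
    intro i x
    have h1 : x = ∑ j, x j • (Pi.single j 1 : Fin (p + q) → ℝ) := by
      simpa using pi_eq_sum_univ' x
    have h2 : e x = ∑ j, x j • e (Pi.single j 1) := by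
      conv_lhs => rw [h1]
      change e.toLinearEquiv _ = _
      rw [map_sum]
      refine Finset.sum_congr rfl fun j _ => ?_
      rw [map_smul]
      rfl
    rw [h2, Finset.sum_apply, dotProduct]
    exact Finset.sum_congr rfl fun j _ => mul_comm _ _
  have hdec : f = ∑ i, C (w (τ i)) * linForm (a i) ^ 2 := by
    apply MvPolynomial.funext
    intro x
    rw [← hQ, ← e.map_app, QuadraticMap.weightedSumSquares_apply, map_sum, ← Equiv.sum_comp τ]
    refine Finset.sum_congr rfl fun i _ => ?_
    rw [map_mul, map_pow, eval_C, eval_linForm, ha, smul_eq_mul, sq]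
  have hunit : IsUnit (Matrix.of a).det := by
    rw [← Matrix.isUnit_iff_isUnit_det, ← Matrix.mulVec_injective_iff_isUnit]
    intro x y hxy
    apply e.toLinearEquiv.injective
    ext i
    have h1 := congrFun hxy (τ.symm i)
    have h2 : ∀ x, (Matrix.of a).mulVec x (τ.symm i) = e x i := fun x => by
      rw [← τ.apply_symm_apply i, ← ha, τ.apply_symm_apply]
      rfl
    simp only [h2] at h1
    exact h1
  obtain ⟨h1, h2⟩ := card_signs_of_decomposition hf hunit hdec
  obtain ⟨σ, t, ht, hσ⟩ := exists_normalized (a := a) h1 h2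
  let B : Fin (p + q) → Fin (p + q) → ℝ := fun i => t i • a (σ i)
  have hB : IsUnit (Matrix.of B).det := by
    have h3 : gram (fun i => w (τ i)) a = gram (signs p q) B := sum_sq_eq_iff.1 hσ
    refine (isUnit_det_of_gram (c := signs p q) ?_).1
    rw [← h3, det_gram, isUnit_iff_ne_zero]
    refine mul_ne_zero (pow_ne_zero _ hunit.ne_zero) (Finset.prod_ne_zero_iff.2 fun i _ hi => ?_)
    obtain ⟨k, rfl⟩ := σ.surjective i
    -- The `p` positive and `q` negative weights already exhaust the `p + q` indices, so no weight
    -- is zero.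
    have h4 : {i | 0 < w (τ i)}ᶜ = {i | w (τ i) < 0} := by
      symm
      apply Set.eq_of_subset_of_ncard_le
      · intro i (hi : w (τ i) < 0) (h : 0 < w (τ i))
        exact hi.not_gt h
      · rw [h2]
        have := Set.ncard_add_ncard_compl {i | 0 < w (τ i)}
        rw [h1, Nat.card_fin] at this
        omega
      · exact Set.toFinite _
    have h5 : σ k ∈ {i | 0 < w (τ i)}ᶜ := fun h : 0 < w (τ (σ k)) => h.ne' hi
    rw [h4] at h5
    exact (show w (τ (σ k)) < 0 from h5).ne hi
  refine ⟨Matrix.nonsingInvUnit _ hB, ?_⟩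
  rw [linSubst_stdQuadric, hdec, hσ]
  rfl

theorem isDefinite_iff {p q : ℕ} (hn : 1 ≤ p + q) (L : GL (Fin (p + q)) ℝ) :
    IsDefinite (linSubst L.1 (stdQuadric p q)) ↔ p = 0 ∨ q = 0 := by
  have hev : ∀ x, eval x (linSubst L.1 (stdQuadric p q)) =
      ∑ i, signs p q i * (L.1.mulVec x) i ^ 2 := by
    intro x
    rw [linSubst_stdQuadric, map_sum]
    refine Finset.sum_congr rfl fun i _ => ?_
    rw [map_mul, map_pow, eval_C, eval_linForm]
    rfl
  have hL : ∀ y, L.1.mulVec ((L⁻¹).1.mulVec y) = y := by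
    intro y
    rw [Matrix.mulVec_mulVec, ← Units.val_mul, mul_inv_cancel, Units.val_one, Matrix.one_mulVec]
  have hval : ∀ i, eval ((L⁻¹).1.mulVec (Pi.single i 1)) (linSubst L.1 (stdQuadric p q)) =
      signs p q i := by
    intro i
    rw [hev, hL, Finset.sum_eq_single i]
    · simp
    · intro j _ hj
      simp [hj]
    · simp
  have hne : ∀ i, (L⁻¹).1.mulVec (Pi.single i 1) ≠ 0 := by
    intro i h
    have := hL (Pi.single i 1)
    rw [h, Matrix.mulVec_zero] at this
    have := congrFun this i
    simp at this
  have hpos : ∀ x, x ≠ 0 → 0 < ∑ i, (L.1.mulVec x) i ^ 2 := by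
    intro x hx
    have : L.1.mulVec x ≠ 0 := by
      intro h
      apply hx
      have h1 : (L⁻¹).1.mulVec (L.1.mulVec x) = x := by
        rw [Matrix.mulVec_mulVec, ← Units.val_mul, inv_mul_cancel, Units.val_one,
          Matrix.one_mulVec]
      rw [← h1, h, Matrix.mulVec_zero]
    obtain ⟨i, hi⟩ := Function.ne_iff.1 this
    exact Finset.sum_pos' (fun i _ => sq_nonneg _) ⟨i, Finset.mem_univ i, sq_pos_of_ne_zero hi⟩
  constructor
  · intro h
    by_contra! hpq
    let i : Fin (p + q) := Fin.castAdd q ⟨0, Nat.pos_of_ne_zero hpq.1⟩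
    let j : Fin (p + q) := Fin.natAdd p ⟨0, Nat.pos_of_ne_zero hpq.2⟩
    rcases h with h | h
    · have := h _ (hne j)
      rw [hval, signs_natAdd] at this
      linarith
    · have := h _ (hne i)
      rw [hval, signs_castAdd] at this
      linarith
  · rintro (rfl | rfl)
    · right
      intro x hx
      have h1 : ∀ i, signs 0 q i = -1 := fun i =>
        Fin.addCases (fun i => i.elim0) (fun i => signs_natAdd i) i
      rw [hev]
      simp only [h1, neg_one_mul, Finset.sum_neg_distrib]
      linarith [hpos x hx]
    · left
      intro x hx
      have h1 : ∀ i, signs p 0 i = 1 := fun i =>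
        Fin.addCases (fun i => signs_castAdd i) (fun i => i.elim0) i
      rw [hev]
      simp only [h1, one_mul]
      exact hpos x hx

/-! ### The identity component of `SO(p,q)` -/

theorem transpose_mul_signs_mul_iff {p q : ℕ} {A : Matrix (Fin (p + q)) (Fin (p + q)) ℝ} :
    A.transpose * Matrix.diagonal (signs p q) * A = Matrix.diagonal (signs p q) ↔
      ∀ x, ∑ i, signs p q i * A.mulVec x i ^ 2 = ∑ i, signs p q i * x i ^ 2 := by
  have h1 := @linSubst_stdQuadric_eq_iff p q A 1
  rw [Matrix.transpose_one, Matrix.one_mul, Matrix.mul_one] at h1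
  rw [← h1]
  have hev : ∀ (B : Matrix (Fin (p + q)) (Fin (p + q)) ℝ) x,
      eval x (linSubst B (stdQuadric p q)) = ∑ i, signs p q i * B.mulVec x i ^ 2 := by
    intro B x
    rw [linSubst_stdQuadric, map_sum]
    refine Finset.sum_congr rfl fun i _ => ?_
    rw [map_mul, map_pow, eval_C, eval_linForm]
    rfl
  constructor
  · intro h x
    have := congrArg (eval x) h
    rwa [hev, hev, Matrix.one_mulVec] at this
  · intro h
    apply MvPolynomial.funext
    intro x
    rw [hev, hev, Matrix.one_mulVec, h]

theorem SOPlus_le_SO (p q : ℕ) : SOPlus p q ≤ SO p q := by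
  rintro _ ⟨g, -, rfl⟩
  exact g.2

theorem mem_SOPlus_of_path {p q : ℕ} {γ : ℝ → GL (Fin (p + q)) ℝ} (hγ : Continuous γ)
    (h0 : γ 0 = 1) (hmem : ∀ t, γ t ∈ SO p q) (t : ℝ) : γ t ∈ SOPlus p q := by
  refine ⟨⟨γ t, hmem t⟩, ?_, rfl⟩
  let γ' : ℝ → SO p q := fun t => ⟨γ t, hmem t⟩
  have h1 : Continuous γ' := hγ.subtype_mk _
  have h2 : IsPreconnected (Set.range γ') := isPreconnected_range h1
  have h3 : (1 : SO p q) ∈ Set.range γ' := ⟨0, Subtype.ext h0⟩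
  exact h2.subset_connectedComponent h3 ⟨t, rfl⟩

/-- `SO(p,q)` is cut out of `GL` by polynomial equations, and a connected component is closed in it.
-/
theorem isClosed_SOPlus (p q : ℕ) : IsClosed (SOPlus p q : Set (GL (Fin (p + q)) ℝ)) := by
  have h1 : IsClosed (SO p q : Set (GL (Fin (p + q)) ℝ)) := by
    have h2 : (SO p q : Set (GL (Fin (p + q)) ℝ)) =
        {g | g.1.transpose * Matrix.diagonal (signs p q) * g.1 = Matrix.diagonal (signs p q)} ∩
          {g | g.1.det = 1} := by
      ext g
      exact mem_SO_iff
    have hv : Continuous fun g : GL (Fin (p + q)) ℝ => g.1 := Units.continuous_val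
    rw [h2]
    refine IsClosed.inter (isClosed_eq ?_ continuous_const) (isClosed_eq ?_ continuous_const)
    · exact (hv.matrix_transpose.matrix_mul continuous_const).matrix_mul hv
    · exact hv.matrix_det
  exact h1.isClosedEmbedding_subtypeVal.isClosedMap _ isClosed_connectedComponent

/-! ### Rotations and boosts in coordinate planes -/

/-- The linear map that acts on the coordinates `a` and `b` by `(x, y) ↦ (c x - e s y, s x + c y)`
and fixes the other coordinates. -/
def planeMatrix {n : ℕ} (a b : Fin n) (e c s : ℝ) : Matrix (Fin n) (Fin n) ℝ :=
  ((1 : Matrix (Fin n) (Fin n) ℝ).updateRow a (Pi.single a c + Pi.single b (-(e * s)))).updateRow b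
    (Pi.single a s + Pi.single b c)

theorem planeMatrix_mulVec_fst {n : ℕ} {a b : Fin n} (hab : a ≠ b) (e c s : ℝ) (v : Fin n → ℝ) :
    (planeMatrix a b e c s).mulVec v a = c * v a - e * s * v b := by
  rw [planeMatrix, Matrix.mulVec, Matrix.updateRow_ne hab, Matrix.updateRow_self, add_dotProduct,
    single_dotProduct, single_dotProduct]
  ring

theorem planeMatrix_mulVec_snd {n : ℕ} (a b : Fin n) (e c s : ℝ) (v : Fin n → ℝ) :
    (planeMatrix a b e c s).mulVec v b = s * v a + c * v b := by
  rw [planeMatrix, Matrix.mulVec, Matrix.updateRow_self, add_dotProduct,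
    single_dotProduct, single_dotProduct]

theorem planeMatrix_mulVec_of_ne {n : ℕ} {a b i : Fin n} (ha : i ≠ a) (hb : i ≠ b) (e c s : ℝ)
    (v : Fin n → ℝ) : (planeMatrix a b e c s).mulVec v i = v i := by
  rw [planeMatrix, Matrix.mulVec, Matrix.updateRow_ne hb, Matrix.updateRow_ne ha]
  exact congrFun (Matrix.one_mulVec v) i

theorem matrix_ext_mulVec {m n : ℕ} {A B : Matrix (Fin m) (Fin n) ℝ}
    (h : ∀ v i, A.mulVec v i = B.mulVec v i) : A = B := by
  ext i j
  simpa using h (Pi.single j 1) i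

/-- The pairs `(c, s)` multiply like `c + s j` with `j² = -e`: rotations arise for `e = 1` and
boosts for `e = -1`. -/
theorem planeMatrix_mul {n : ℕ} {a b : Fin n} (hab : a ≠ b) (e c s c' s' : ℝ) :
    planeMatrix a b e c s * planeMatrix a b e c' s' =
      planeMatrix a b e (c * c' - e * s * s') (s * c' + c * s') := by
  apply matrix_ext_mulVec
  intro v i
  rw [← Matrix.mulVec_mulVec]
  by_cases ha : i = a
  · subst ha
    rw [planeMatrix_mulVec_fst hab, planeMatrix_mulVec_fst hab, planeMatrix_mulVec_snd,
      planeMatrix_mulVec_fst hab]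
    ring
  · by_cases hb : i = b
    · subst hb
      rw [planeMatrix_mulVec_snd, planeMatrix_mulVec_fst hab, planeMatrix_mulVec_snd,
        planeMatrix_mulVec_snd]
      ring
    · rw [planeMatrix_mulVec_of_ne ha hb, planeMatrix_mulVec_of_ne ha hb,
        planeMatrix_mulVec_of_ne ha hb]

theorem planeMatrix_one {n : ℕ} {a b : Fin n} (hab : a ≠ b) (e : ℝ) :
    planeMatrix a b e 1 0 = 1 := by
  apply matrix_ext_mulVec
  intro v i
  rw [Matrix.one_mulVec]
  by_cases ha : i = a
  · subst ha
    rw [planeMatrix_mulVec_fst hab]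
    ring
  · by_cases hb : i = b
    · subst hb
      rw [planeMatrix_mulVec_snd]
      ring
    · rw [planeMatrix_mulVec_of_ne ha hb]

theorem continuous_planeMatrix {n : ℕ} (a b : Fin n) (e : ℝ) {c s : ℝ → ℝ}
    (hc : Continuous c) (hs : Continuous s) :
    Continuous fun t => planeMatrix a b e (c t) (s t) := by
  have h1 : ∀ (i : Fin n) {g : ℝ → ℝ}, Continuous g →
      Continuous fun t => (Pi.single i (g t) : Fin n → ℝ) := by
    intro i g hg
    exact (continuous_single i).comp hg
  refine Continuous.matrix_updateRow _ (Continuous.matrix_updateRow _ continuous_const ?_) ?_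
  · exact (h1 a hc).add (h1 b (continuous_const.mul hs).neg)
  · exact (h1 a hs).add (h1 b hc)

theorem planeMatrix_preserves {p q : ℕ} {a b : Fin (p + q)} (hab : a ≠ b) {c s : ℝ}
    (h : c ^ 2 + signs p q a * signs p q b * s ^ 2 = 1) :
    (planeMatrix a b (signs p q a * signs p q b) c s).transpose * Matrix.diagonal (signs p q) *
      planeMatrix a b (signs p q a * signs p q b) c s = Matrix.diagonal (signs p q) := by
  rw [transpose_mul_signs_mul_iff]
  intro x
  rw [← Finset.add_sum_erase _ _ (Finset.mem_univ a),
    ← Finset.add_sum_erase _ _ (Finset.mem_erase.2 ⟨hab.symm, Finset.mem_univ b⟩),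
    ← Finset.add_sum_erase Finset.univ (fun i => signs p q i * x i ^ 2) (Finset.mem_univ a),
    ← Finset.add_sum_erase _ (fun i => signs p q i * x i ^ 2)
      (Finset.mem_erase.2 ⟨hab.symm, Finset.mem_univ b⟩),
    planeMatrix_mulVec_fst hab, planeMatrix_mulVec_snd, ← add_assoc, ← add_assoc]
  congr 1
  · have ha := signs_mul_self a
    generalize signs p q a = ea at *
    generalize signs p q b = eb at *
    linear_combination (ea * x a ^ 2 + eb * x b ^ 2) * h +
      (-2 * eb * c * s * x a * x b + ea * eb ^ 2 * s ^ 2 * x b ^ 2 - eb * s ^ 2 * x a ^ 2) * ha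
  · refine Finset.sum_congr rfl fun i hi => ?_
    rw [Finset.mem_erase, Finset.mem_erase] at hi
    rw [planeMatrix_mulVec_of_ne hi.2.1 hi.1]

theorem exists_plane_path {p q : ℕ} {a b : Fin (p + q)} (hab : a ≠ b) {c s : ℝ → ℝ}
    (hc : Continuous c) (hs : Continuous s) (hc0 : c 0 = 1) (hs0 : s 0 = 0)
    (hcadd : ∀ x y, c (x + y) = c x * c y - signs p q a * signs p q b * s x * s y)
    (hsadd : ∀ x y, s (x + y) = s x * c y + c x * s y)
    (hrel : ∀ x, c x ^ 2 + signs p q a * signs p q b * s x ^ 2 = 1) (t : ℝ) :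
    ∃ g ∈ SOPlus p q, g.1 = planeMatrix a b (signs p q a * signs p q b) (c t) (s t) := by
  let P : ℝ → Matrix (Fin (p + q)) (Fin (p + q)) ℝ := fun t =>
    planeMatrix a b (signs p q a * signs p q b) (c t) (s t)
  have hP : Continuous P := continuous_planeMatrix a b _ hc hs
  have hmul : ∀ x y, P x * P y = P (x + y) := by
    intro x y
    simp only [P]
    rw [planeMatrix_mul hab, hcadd, hsadd]
  have hone : P 0 = 1 := by
    simp only [P, hc0, hs0]
    exact planeMatrix_one hab _
  let γ : ℝ → GL (Fin (p + q)) ℝ := fun t =>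
    ⟨P t, P (-t), by rw [hmul, add_neg_cancel, hone], by rw [hmul, neg_add_cancel, hone]⟩
  have hγ : Continuous γ := by
    rw [Units.continuous_iff]
    exact ⟨hP, hP.comp continuous_neg⟩
  have hpres : ∀ t, (P t).transpose * Matrix.diagonal (signs p q) * P t =
      Matrix.diagonal (signs p q) := fun t => planeMatrix_preserves hab (hrel t)
  have hD : (Matrix.diagonal (signs p q)).det ≠ 0 := by
    rw [Matrix.det_diagonal]
    exact Finset.prod_ne_zero_iff.2 fun i _ => signs_ne_zero i
  have hdet2 : ∀ t, (P t).det ^ 2 = 1 := by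
    intro t
    have h1 := congrArg Matrix.det (hpres t)
    rw [Matrix.det_mul, Matrix.det_mul, Matrix.det_transpose] at h1
    apply mul_right_cancel₀ hD
    linear_combination h1
  -- Each element of the one-parameter group is a square, which excludes determinant `-1`.
  have hdet : ∀ t, (P t).det = 1 := by
    intro t
    rw [show t = t / 2 + t / 2 by ring, ← hmul, Matrix.det_mul, ← sq, hdet2]
  exact ⟨γ t, mem_SOPlus_of_path hγ (Units.ext hone)
    (fun t => mem_SO_iff.2 ⟨hpres t, hdet t⟩) t, rfl⟩

/-- Equal signs: `(c, s)` is on the unit circle and the angle is an argument of `c + is`. Opposite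
signs: it is on a hyperbola, and `0 < c` selects the branch through `(1, 0)`, where `arsinh s` is
the parameter. -/
theorem exists_plane {p q : ℕ} {a b : Fin (p + q)} (hab : a ≠ b) {c s : ℝ}
    (h : c ^ 2 + signs p q a * signs p q b * s ^ 2 = 1)
    (hc : signs p q a * signs p q b = 1 ∨ 0 < c) :
    ∃ g ∈ SOPlus p q, g.1 = planeMatrix a b (signs p q a * signs p q b) c s := by
  by_cases hs : signs p q a * signs p q b = 1
  · rw [hs, one_mul] at h
    have hnorm : ‖(⟨c, s⟩ : ℂ)‖ = 1 := by
      rw [Complex.norm_def, Complex.normSq_mk, ← sq, ← sq, h, Real.sqrt_one]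
    have hne : (⟨c, s⟩ : ℂ) ≠ 0 := by
      intro h0
      rw [h0, norm_zero] at hnorm
      exact zero_ne_one hnorm
    have h1 := Complex.cos_arg hne
    have h2 := Complex.sin_arg (⟨c, s⟩ : ℂ)
    rw [hnorm, div_one] at h1 h2
    obtain ⟨g, hg, hgm⟩ := exists_plane_path (p := p) (q := q) hab Real.continuous_cos
      Real.continuous_sin Real.cos_zero Real.sin_zero
      (fun x y => by rw [hs, one_mul, Real.cos_add]) (fun x y => Real.sin_add x y)
      (fun x => by rw [hs, one_mul, Real.cos_sq_add_sin_sq]) (Complex.arg ⟨c, s⟩)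
    exact ⟨g, hg, by rw [hgm, h1, h2]⟩
  · have hm : signs p q a * signs p q b = -1 := by
      rcases signs_eq a with ha | ha <;> rcases signs_eq b with hb | hb <;> simp_all
    have hc' := hc.resolve_left hs
    have h1 : Real.cosh (Real.arsinh s) = c := by
      rw [Real.cosh_arsinh]
      rw [show 1 + s ^ 2 = c ^ 2 by rw [hm] at h; linarith, Real.sqrt_sq hc'.le]
    obtain ⟨g, hg, hgm⟩ := exists_plane_path (p := p) (q := q) hab Real.continuous_cosh
      Real.continuous_sinh Real.cosh_zero Real.sinh_zero
      (fun x y => by rw [hm, Real.cosh_add]; ring) (fun x y => Real.sinh_add x y)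
      (fun x => by rw [hm]; linear_combination Real.cosh_sq_sub_sinh_sq x) (Real.arsinh s)
    exact ⟨g, hg, by rw [hgm, h1, Real.sinh_arsinh]⟩

/-- One of two coordinates of a vector that is not isotropic in their plane can be moved to zero. -/
theorem exists_plane_annihilating {p q : ℕ} {a b : Fin (p + q)} (hab : a ≠ b)
    {v : Fin (p + q) → ℝ} (ha : v a ≠ 0)
    (hpos : 0 < v a ^ 2 + signs p q a * signs p q b * v b ^ 2) :
    ∃ g ∈ SOPlus p q, g.1.mulVec v b = 0 ∧ (∀ w, w a = 0 → w b = 0 → g.1.mulVec w = w) ∧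
      ∀ w i, i ≠ a → i ≠ b → g.1.mulVec w i = w i := by
  have hr := Real.sqrt_pos.2 hpos
  have hr2 := Real.sq_sqrt hpos.le
  set r := Real.sqrt (v a ^ 2 + signs p q a * signs p q b * v b ^ 2)
  have habs : |v a| ≠ 0 := abs_ne_zero.2 ha
  have habs2 : |v a| ^ 2 = v a ^ 2 := sq_abs _
  -- The matrix with `c = v a / r`, `s = -v b / r` is multiplied by the sign of `v a`, so that `c >
  -- 0` as boosts require.
  obtain ⟨g, hg, hgm⟩ := exists_plane (p := p) (q := q) hab (c := |v a| / r)
    (s := -(v a / |v a| * v b / r))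
    (by
      have h1 : (v a / |v a|) ^ 2 = 1 := by rw [div_pow, habs2, div_self (pow_ne_zero 2 ha)]
      rw [neg_sq, div_pow, div_pow, mul_pow, h1, habs2, one_mul, ← mul_div_assoc, ← add_div, ← hr2,
        div_self (pow_ne_zero 2 hr.ne')])
    (Or.inr (div_pos (abs_pos.2 ha) hr))
  refine ⟨g, hg, ?_, ?_, ?_⟩
  · rw [hgm, planeMatrix_mulVec_snd]
    field_simp
    linear_combination v b * habs2
  · intro w h1 h2
    ext i
    rw [hgm]
    by_cases hia : i = a
    · rw [hia, planeMatrix_mulVec_fst hab, h1, h2]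
      ring
    · by_cases hib : i = b
      · rw [hib, planeMatrix_mulVec_snd, h1, h2]
        ring
      · rw [planeMatrix_mulVec_of_ne hia hib]
  · intro w i h1 h2
    rw [hgm, planeMatrix_mulVec_of_ne h1 h2]

/-- Three nonzero numbers cannot be pairwise opposite, and if exactly two are nonzero the sum
vanishes. So only one is nonzero. -/
theorem eq_zero_of_pairwise_add_eq_zero {n : ℕ} {t : Fin n → ℝ}
    (h : ∀ i j, i ≠ j → t i ≠ 0 → t j ≠ 0 → t i + t j = 0) (hsum : ∑ i, t i ≠ 0) {a : Fin n}
    (ha : t a ≠ 0) {b : Fin n} (hb : b ≠ a) : t b = 0 := by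
  by_contra htb
  apply hsum
  have h0 : ∀ d, d ≠ a → d ≠ b → t d = 0 := by
    intro d hda hdb
    by_contra htd
    apply ha
    linarith [h a b hb.symm ha htb, h d a hda htd ha, h d b hdb htd htb]
  rw [← Finset.add_sum_erase _ _ (Finset.mem_univ a),
    ← Finset.add_sum_erase _ _ (Finset.mem_erase.2 ⟨hb, Finset.mem_univ b⟩), Finset.sum_eq_zero,
    add_zero, h a b hb.symm ha htb]
  intro d hd
  rw [Finset.mem_erase, Finset.mem_erase] at hd
  exact h0 d hd.2.1 hd.1

theorem SOPlus_preserves {p q : ℕ} {g : GL (Fin (p + q)) ℝ} (hg : g ∈ SOPlus p q)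
    (x : Fin (p + q) → ℝ) :
    ∑ i, signs p q i * g.1.mulVec x i ^ 2 = ∑ i, signs p q i * x i ^ 2 :=
  transpose_mul_signs_mul_iff.1 (mem_SO_iff.1 (SOPlus_le_SO p q hg)).1 x

/-- A vector of length `±1` can be moved to a coordinate axis. -/
theorem exists_mulVec_eq_single {p q : ℕ} {T : Finset (Fin (p + q))} {k : Fin (p + q)}
    (hk : k ∉ T) (m : ℕ) : ∀ v : Fin (p + q) → ℝ, (Finset.univ.filter fun i => v i ≠ 0).card = m →
      (∀ i ∈ T, v i = 0) → ∑ i, signs p q i * v i ^ 2 = signs p q k →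
      ∃ g ∈ SOPlus p q, (∀ w, (∀ i, i ∉ T → w i = 0) → g.1.mulVec w = w) ∧
        ∃ δ : ℝ, (δ = 1 ∨ δ = -1) ∧ g.1.mulVec v = Pi.single k δ := by
  induction m using Nat.strong_induction_on with
  | _ m ih =>
  intro v hcard hT hQ
  -- Induction on the size of the support: while such a pair of coordinates exists, one of the two
  -- can be annihilated.
  by_cases hex : ∃ a b, a ≠ b ∧ v a ≠ 0 ∧ v b ≠ 0 ∧ 0 < v a ^ 2 + signs p q a * signs p q b * v b ^ 2
  · obtain ⟨a, b, hab, ha, hb, hpos⟩ := hex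
    have haT : a ∉ T := fun h => ha (hT a h)
    have hbT : b ∉ T := fun h => hb (hT b h)
    obtain ⟨g, hg, hgb, hgfix, hgne⟩ := exists_plane_annihilating hab ha hpos
    have hlt : (Finset.univ.filter fun i => g.1.mulVec v i ≠ 0).card < m := by
      rw [← hcard]
      apply Finset.card_lt_card
      rw [Finset.ssubset_iff_of_subset]
      · exact ⟨b, by simp [hb], by simp [hgb]⟩
      · intro i hi
        rw [Finset.mem_filter] at hi ⊢
        refine ⟨Finset.mem_univ i, fun h0 => hi.2 ?_⟩
        rw [hgne v i (fun h => ha (h ▸ h0)) (fun h => hb (h ▸ h0)), h0]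
    obtain ⟨g', hg', hfix', δ, hδ, hv'⟩ := ih _ hlt (g.1.mulVec v) rfl
      (fun i hi => by
        rw [hgne v i (fun h => haT (h ▸ hi)) (fun h => hbT (h ▸ hi)), hT i hi])
      (by rw [SOPlus_preserves hg, hQ])
    refine ⟨g' * g, mul_mem hg' hg, ?_, δ, hδ, ?_⟩
    · intro w hw
      rw [Units.val_mul, ← Matrix.mulVec_mulVec, hgfix w (hw a haT) (hw b hbT), hfix' w hw]
    · rw [Units.val_mul, ← Matrix.mulVec_mulVec, hv']
  -- Otherwise any two nonzero coordinates have opposite signs in the form, and the inequality in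
  -- both orders makes their squares equal. Their contributions cancel, so a nonzero total length
  -- leaves only one nonzero coordinate.
  · push Not at hex
    have hpair : ∀ i j, i ≠ j → signs p q i * v i ^ 2 ≠ 0 → signs p q j * v j ^ 2 ≠ 0 →
        signs p q i * v i ^ 2 + signs p q j * v j ^ 2 = 0 := by
      intro i j hij hi hj
      have hvi : v i ≠ 0 := fun h => hi (by rw [h]; ring)
      have hvj : v j ≠ 0 := fun h => hj (by rw [h]; ring)
      have h1 := hex i j hij hvi hvj
      have h2 := hex j i hij.symm hvj hvi
      have h3 := sq_pos_of_ne_zero hvi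
      have h4 := sq_pos_of_ne_zero hvj
      rcases signs_eq i with e1 | e1 <;> rcases signs_eq j with e2 | e2 <;>
        rw [e1, e2] at h1 h2 ⊢ <;> linarith
    have hsum : ∑ i, signs p q i * v i ^ 2 ≠ 0 := by
      rw [hQ]
      exact signs_ne_zero k
    obtain ⟨a, -, ha⟩ := Finset.exists_ne_zero_of_sum_ne_zero hsum
    have hzero : ∀ b, b ≠ a → v b = 0 := by
      intro b hb
      have := eq_zero_of_pairwise_add_eq_zero hpair hsum ha hb
      simpa [signs_ne_zero] using this
    have hva : v a ≠ 0 := fun h => ha (by rw [h]; ring)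
    have hvsingle : v = Pi.single a (v a) := by
      ext i
      by_cases hi : i = a
      · simp [hi]
      · simp [hi, hzero i hi]
    have hQ' : signs p q a * v a ^ 2 = signs p q k := by
      rw [← hQ, Finset.sum_eq_single a]
      · intro b _ hb
        rw [hzero b hb]
        ring
      · simp
    have hva2 : v a ^ 2 = 1 ∧ signs p q a = signs p q k := by
      have h3 := sq_pos_of_ne_zero hva
      rcases signs_eq a with e1 | e1 <;> rcases signs_eq k with e2 | e2 <;>
        rw [e1, e2] at hQ' ⊢ <;> refine ⟨?_, ?_⟩ <;> linarith
    have hδ : v a = 1 ∨ v a = -1 := by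
      rcases sq_eq_sq_iff_eq_or_eq_neg.1 (hva2.1.trans (one_pow 2).symm) with h | h
      exacts [Or.inl h, Or.inr h]
    by_cases hak : a = k
    · subst hak
      refine ⟨1, one_mem _, fun w _ => Matrix.one_mulVec w, v a, hδ, ?_⟩
      rw [Units.val_one, Matrix.one_mulVec]
      exact hvsingle
    · have haT : a ∉ T := fun h => hva (hT a h)
      have he : signs p q a * signs p q k = 1 := by rw [hva2.2, signs_mul_self]
      -- The remaining coordinate has the same sign in the form as `k`, so a quarter turn moves it
      -- to position `k`.
      obtain ⟨g, hg, hgm⟩ := exists_plane (p := p) (q := q) hak (c := 0) (s := 1)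
        (by rw [he]; ring) (Or.inl he)
      refine ⟨g, hg, ?_, v a, hδ, ?_⟩
      · intro w hw
        ext i
        rw [hgm]
        by_cases hia : i = a
        · rw [hia, planeMatrix_mulVec_fst hak, hw a haT, hw k hk]
          ring
        · by_cases hik : i = k
          · rw [hik, planeMatrix_mulVec_snd, hw a haT, hw k hk]
            ring
          · rw [planeMatrix_mulVec_of_ne hia hik]
      · ext i
        rw [hgm]
        by_cases hia : i = a
        · rw [hia, planeMatrix_mulVec_fst hak, hzero k (Ne.symm hak), Pi.single_eq_of_ne hak]
          ring
        · by_cases hik : i = k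
          · rw [hik, planeMatrix_mulVec_snd, Pi.single_eq_same]
            ring
          · rw [planeMatrix_mulVec_of_ne hia hik, hzero i hia, Pi.single_eq_of_ne hik]

/-- The columns are brought to coordinate axes one at a time; the next group element must fix the
columns already treated. -/
theorem exists_mul_eq_single_on {p q : ℕ} {A : Matrix (Fin (p + q)) (Fin (p + q)) ℝ}
    (hA : A.transpose * Matrix.diagonal (signs p q) * A = Matrix.diagonal (signs p q))
    (T : Finset (Fin (p + q))) :
    ∃ h ∈ SOPlus p q, ∃ δ : Fin (p + q) → ℝ, (∀ i, δ i = 1 ∨ δ i = -1) ∧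
      ∀ i ∈ T, (h.1 * A).mulVec (Pi.single i 1) = Pi.single i (δ i) := by
  induction T using Finset.induction_on with
  | empty => exact ⟨1, one_mem _, fun _ => 1, fun _ => Or.inl rfl, by simp⟩
  | insert k T hk ih =>
    obtain ⟨h, hh, δ, hδ, hT⟩ := ih
    have hB : (h.1 * A).transpose * Matrix.diagonal (signs p q) * (h.1 * A) =
        Matrix.diagonal (signs p q) := by
      have h1 := (mem_SO_iff.1 (SOPlus_le_SO p q hh)).1
      calc (h.1 * A).transpose * Matrix.diagonal (signs p q) * (h.1 * A)
          = A.transpose * (h.1.transpose * Matrix.diagonal (signs p q) * h.1) * A := by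
            rw [Matrix.transpose_mul]
            simp only [Matrix.mul_assoc]
        _ = _ := by rw [h1, hA]
    set B := h.1 * A with hBdef
    have hcol : ∀ i ∈ T, ∀ l, B l i = (Pi.single i (δ i) : Fin (p + q) → ℝ) l := by
      intro i hi l
      rw [← hT i hi]
      simp
    -- Column `k` is orthogonal to the columns treated so far, which are signed basis vectors.
    have hzero : ∀ i ∈ T, B.mulVec (Pi.single k 1) i = 0 := by
      intro i hi
      have hik : i ≠ k := fun h => hk (h ▸ hi)
      have h1 := congrFun (congrFun hB i) k
      rw [Matrix.diagonal_apply_ne _ hik, Matrix.mul_apply, Finset.sum_eq_single i] at h1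
      · rw [Matrix.mul_diagonal, Matrix.transpose_apply, hcol i hi, Pi.single_eq_same] at h1
        have h2 : δ i * signs p q i ≠ 0 := by
          rcases hδ i with e | e <;> simp [e, signs_ne_zero]
        simpa using (mul_eq_zero.1 h1).resolve_left h2
      · intro l _ hl
        rw [Matrix.mul_diagonal, Matrix.transpose_apply, hcol i hi, Pi.single_eq_of_ne hl]
        ring
      · simp
    have hQ : ∑ i, signs p q i * B.mulVec (Pi.single k 1) i ^ 2 = signs p q k := by
      rw [transpose_mul_signs_mul_iff.1 hB, Finset.sum_eq_single k]
      · simp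
      · intro i _ hi
        simp [hi]
      · simp
    obtain ⟨g, hg, hfix, d, hd, hgk⟩ := exists_mulVec_eq_single hk _ _ rfl hzero hQ
    refine ⟨g * h, mul_mem hg hh, Function.update δ k d, ?_, ?_⟩
    · intro i
      by_cases hi : i = k
      · rw [hi, Function.update_self]
        exact hd
      · rw [Function.update_of_ne hi]
        exact hδ i
    · intro i hi
      rw [Units.val_mul, Matrix.mul_assoc, ← hBdef, ← Matrix.mulVec_mulVec]
      rcases Finset.mem_insert.1 hi with rfl | hiT
      · rw [hgk, Function.update_self]
      · have hik : i ≠ k := fun h => hk (h ▸ hiT)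
        rw [hT i hiT, Function.update_of_ne hik]
        apply hfix
        intro l hl
        exact Pi.single_eq_of_ne (fun h : l = i => hl (h ▸ hiT)) _

/-- Every element of `O(p,q)` is a diagonal matrix of signs up to the identity component. -/
theorem exists_mul_eq_diagonal {p q : ℕ} {A : Matrix (Fin (p + q)) (Fin (p + q)) ℝ}
    (hA : A.transpose * Matrix.diagonal (signs p q) * A = Matrix.diagonal (signs p q)) :
    ∃ h ∈ SOPlus p q, ∃ δ : Fin (p + q) → ℝ, (∀ i, δ i = 1 ∨ δ i = -1) ∧
      h.1 * A = Matrix.diagonal δ := by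
  obtain ⟨h, hh, δ, hδ, hT⟩ := exists_mul_eq_single_on hA Finset.univ
  refine ⟨h, hh, δ, hδ, ?_⟩
  ext i j
  have := congrFun (hT j (Finset.mem_univ j)) i
  rw [Matrix.diagonal_apply]
  by_cases hij : i = j
  · subst hij
    simpa using this
  · simpa [hij] using this

/-- The entries `-1` are even in number, and a half turn in a coordinate plane removes two of them.
When all signs agree, every coordinate plane admits rotations. -/
theorem diagonal_mem_SOPlus {p q : ℕ} (hdef : ∀ a b, signs p q a * signs p q b = 1) (m : ℕ) :
    ∀ (g : GL (Fin (p + q)) ℝ) (δ : Fin (p + q) → ℝ), (∀ i, δ i = 1 ∨ δ i = -1) →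
      g.1 = Matrix.diagonal δ → ∏ i, δ i = 1 → (Finset.univ.filter fun i => δ i ≠ 1).card = m →
      g ∈ SOPlus p q := by
  induction m using Nat.strong_induction_on with
  | _ m ih =>
  intro g δ hδ hg hprod hcard
  by_cases hall : ∀ i, δ i = 1
  · have : g = 1 := by
      apply Units.ext
      rw [hg, Units.val_one, ← Matrix.diagonal_one]
      congr 1
      ext i
      exact hall i
    rw [this]
    exact one_mem _
  · push Not at hall
    obtain ⟨a, ha⟩ := hall
    have hb : ∃ b, b ≠ a ∧ δ b ≠ 1 := by
      by_contra! hcon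
      rw [Finset.prod_eq_single a (fun b _ hb => hcon b hb) (by simp)] at hprod
      exact ha hprod
    obtain ⟨b, hba, hb⟩ := hb
    have hab : a ≠ b := hba.symm
    obtain ⟨R, hR, hRm⟩ := exists_plane (p := p) (q := q) hab (c := -1) (s := 0)
      (by ring) (Or.inl (hdef a b))
    have hda := (hδ a).resolve_left ha
    have hdb := (hδ b).resolve_left hb
    let δ' := Function.update (Function.update δ a 1) b 1
    have ha' : δ' a = 1 := by simp [δ', hab]
    have hb' : δ' b = 1 := by simp [δ']
    have hne' : ∀ i, i ≠ a → i ≠ b → δ' i = δ i := fun i h1 h2 => by simp [δ', h1, h2]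
    have hprod' : R.1 * g.1 = Matrix.diagonal δ' := by
      apply matrix_ext_mulVec
      intro v i
      rw [← Matrix.mulVec_mulVec, hg, hRm, Matrix.mulVec_diagonal]
      by_cases hia : i = a
      · rw [hia, planeMatrix_mulVec_fst hab, Matrix.mulVec_diagonal, hda, ha']
        ring
      · by_cases hib : i = b
        · rw [hib, planeMatrix_mulVec_snd, Matrix.mulVec_diagonal, Matrix.mulVec_diagonal, hdb, hb']
          ring
        · rw [planeMatrix_mulVec_of_ne hia hib, Matrix.mulVec_diagonal, hne' i hia hib]
    have hlt : (Finset.univ.filter fun i => δ' i ≠ 1).card < m := by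
      rw [← hcard]
      apply Finset.card_lt_card
      rw [Finset.ssubset_iff_of_subset]
      · exact ⟨a, by simp [ha], by simp [ha']⟩
      · intro i hi
        rw [Finset.mem_filter] at hi ⊢
        refine ⟨Finset.mem_univ i, ?_⟩
        rw [← hne' i (fun h => hi.2 (h ▸ ha')) (fun h => hi.2 (h ▸ hb'))]
        exact hi.2
    have hmem : R * g ∈ SOPlus p q := by
      refine ih _ hlt (R * g) δ' ?_ hprod' ?_ rfl
      · intro i
        by_cases hia : i = a
        · rw [hia]
          exact Or.inl ha'
        · by_cases hib : i = b
          · rw [hib]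
            exact Or.inl hb'
          · rw [hne' i hia hib]
            exact hδ i
      · rw [← Finset.mul_prod_erase _ _ (Finset.mem_univ a),
          ← Finset.mul_prod_erase _ _ (Finset.mem_erase.2 ⟨hba, Finset.mem_univ b⟩)] at hprod ⊢
        rw [hda, hdb, neg_one_mul, neg_one_mul, neg_neg] at hprod
        rw [ha', hb', one_mul, one_mul, ← hprod]
        refine Finset.prod_congr rfl fun i hi => ?_
        rw [Finset.mem_erase, Finset.mem_erase] at hi
        exact hne' i hi.2.1 hi.1
    have := mul_mem (inv_mem hR) hmem
    rwa [inv_mul_cancel_left] at this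

theorem mem_SOPlus_iff_of_definite {p q : ℕ} (hpq : p = 0 ∨ q = 0) (g : GL (Fin (p + q)) ℝ) :
    g ∈ SOPlus p q ↔ g.1 ∈ Matrix.specialOrthogonalGroup (Fin (p + q)) ℝ := by
  obtain ⟨e, he, hsigns⟩ : ∃ e : ℝ, (e = 1 ∨ e = -1) ∧ ∀ i, signs p q i = e := by
    rcases hpq with rfl | rfl
    · exact ⟨-1, Or.inr rfl, fun i => Fin.addCases (fun i => i.elim0) (fun i => signs_natAdd i) i⟩
    · exact ⟨1, Or.inl rfl, fun i => Fin.addCases (fun i => signs_castAdd i) (fun i => i.elim0) i⟩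
  have he2 : e * e = 1 := by rcases he with rfl | rfl <;> norm_num
  have he0 : e ≠ 0 := fun h => by rw [h] at he2; norm_num at he2
  have hdiag : Matrix.diagonal (signs p q) = e • (1 : Matrix (Fin (p + q)) (Fin (p + q)) ℝ) := by
    rw [Matrix.smul_one_eq_diagonal]
    congr 1
    ext i
    exact hsigns i
  have hO : ∀ A : Matrix (Fin (p + q)) (Fin (p + q)) ℝ,
      A.transpose * Matrix.diagonal (signs p q) * A = Matrix.diagonal (signs p q) ↔
        A.transpose * A = 1 := by
    intro A
    rw [hdiag, Matrix.mul_smul, Matrix.mul_one, Matrix.smul_mul]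
    exact smul_right_inj he0
  rw [Matrix.mem_specialOrthogonalGroup_iff, Matrix.mem_orthogonalGroup_iff']
  constructor
  · intro h
    have h1 := mem_SO_iff.1 (SOPlus_le_SO p q h)
    exact ⟨(hO g.1).1 h1.1, h1.2⟩
  · rintro ⟨h1, h2⟩
    obtain ⟨h, hh, δ, hδ, hd⟩ := exists_mul_eq_diagonal ((hO g.1).2 h1)
    have h3 : h * g ∈ SOPlus p q := by
      refine diagonal_mem_SOPlus (fun a b => by rw [hsigns, hsigns, he2]) _ (h * g) δ hδ hd ?_ rfl
      rw [← Matrix.det_diagonal, ← hd, Matrix.det_mul, h2,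
        (mem_SO_iff.1 (SOPlus_le_SO p q hh)).2, one_mul]
    have := mul_mem (inv_mem hh) h3
    rwa [inv_mul_cancel_left] at this

/-! ### Configurations of real points -/

theorem isUnit_det_ofReal {n : ℕ} {a : Fin n → Fin n → ℝ} (h : IsUnit (Matrix.of a).det) :
    IsUnit (Matrix.of fun i j => (a i j : ℂ)).det := by
  have h1 : (Matrix.of fun i j => (a i j : ℂ)) = Complex.ofRealHom.mapMatrix (Matrix.of a) := rfl
  rw [h1, ← RingHom.map_det]
  exact h.map _

theorem realConfigIdeal_eq_of_rows {n r : ℕ} {a b : Fin r → Fin n → ℝ} (σ : Equiv.Perm (Fin r))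
    {c : Fin r → ℝ} (hc : ∀ i, c i ≠ 0) (h : ∀ i, a i = c i • b (σ i)) :
    realConfigIdeal a = realConfigIdeal b := by
  refine configIdeal_eq_of_rows σ (c := fun i => (c i : ℂ))
    (fun i => Complex.ofReal_ne_zero.2 (hc i)) fun i => ?_
  ext j
  simp [h i]

theorem exists_real_smul {n : ℕ} {v w : Fin n → ℝ} (hw : w ≠ 0) {c : ℂ} (hc : c ≠ 0)
    (h : (fun j => (v j : ℂ)) = c • fun j => (w j : ℂ)) : ∃ t : ℝ, t ≠ 0 ∧ v = t • w := by
  obtain ⟨j, hj⟩ := Function.ne_iff.1 hw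
  have h1 : c = ((v j / w j : ℝ) : ℂ) := by
    have := congrFun h j
    simp only [Pi.smul_apply, smul_eq_mul] at this
    rw [Complex.ofReal_div, this, mul_div_cancel_right₀ _ (Complex.ofReal_ne_zero.2 hj)]
  refine ⟨v j / w j, fun h0 => hc (by rw [h1, h0, Complex.ofReal_zero]), ?_⟩
  ext k
  have := congrFun h k
  rw [h1] at this
  simp only [Pi.smul_apply, smul_eq_mul] at this
  exact_mod_cast this

theorem exists_perm_of_realConfigIdeal_eq {n : ℕ} {a b : Fin n → Fin n → ℝ}
    (ha : IsUnit (Matrix.of a).det) (hb : IsUnit (Matrix.of b).det)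
    (h : realConfigIdeal a = realConfigIdeal b) :
    ∃ (σ : Equiv.Perm (Fin n)) (c : Fin n → ℝ), (∀ i, c i ≠ 0) ∧ ∀ i, a i = c i • b (σ i) := by
  obtain ⟨σ, c, hc, hσ⟩ :=
    exists_perm_of_configIdeal_eq (isUnit_det_ofReal ha) (isUnit_det_ofReal hb) h
  have h1 : ∀ i, ∃ t : ℝ, t ≠ 0 ∧ a i = t • b (σ i) := fun i =>
    exists_real_smul (row_ne_zero hb (σ i)) (hc i) (hσ i)
  choose t ht hat using h1
  exact ⟨σ, t, ht, hat⟩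

/-! ### Real decompositions and the group `SO⁺(p,q)` -/

theorem isUnit_det_GL {n : ℕ} (g : GL (Fin n) ℝ) : IsUnit (Matrix.of fun i => g.1 i).det :=
  (Matrix.isUnit_iff_isUnit_det _).1 g.isUnit

theorem preserves_inv_mul {p q : ℕ} {g : GL (Fin (p + q)) ℝ} (hg : g ∈ SOPlus p q)
    (L : GL (Fin (p + q)) ℝ) :
    (g⁻¹ * L).1.transpose * Matrix.diagonal (signs p q) * (g⁻¹ * L).1 =
      L.1.transpose * Matrix.diagonal (signs p q) * L.1 := by
  have h1 := (mem_SO_iff.1 (SOPlus_le_SO p q (inv_mem hg))).1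
  calc (g⁻¹ * L).1.transpose * Matrix.diagonal (signs p q) * (g⁻¹ * L).1
      = L.1.transpose * ((g⁻¹).1.transpose * Matrix.diagonal (signs p q) * (g⁻¹).1) * L.1 := by
        rw [Units.val_mul, Matrix.transpose_mul]
        simp only [Matrix.mul_assoc]
    _ = _ := by rw [h1]

theorem gram_signs {p q : ℕ} (A : Matrix (Fin (p + q)) (Fin (p + q)) ℝ) :
    gram (signs p q) (fun i => A i) = A.transpose * Matrix.diagonal (signs p q) * A := rfl

theorem isUnit_det_gram_signs {p q : ℕ} (L : GL (Fin (p + q)) ℝ) :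
    IsUnit (gram (signs p q) fun i => L.1 i).det := by
  rw [det_gram, isUnit_iff_ne_zero]
  exact mul_ne_zero (pow_ne_zero _ (isUnit_det_GL L).ne_zero)
    (Finset.prod_ne_zero_iff.2 fun i _ => signs_ne_zero i)

/-- Transitivity of the identity component. A normalized decomposition differs from `L` by an
element of `O(p,q)`, hence by one of `SO⁺(p,q)` up to a diagonal matrix of signs, and signs do not
change the points. -/
theorem mem_SSPReal_iff {p q : ℕ} {L : GL (Fin (p + q)) ℝ}
    (hf : HasSignature (linSubst L.1 (stdQuadric p q)) p q) {J : HilbPoint (p + q) (p + q)} :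
    J ∈ SSPReal (linSubst L.1 (stdQuadric p q)) ↔
      ∃ g ∈ SOPlus p q, J.ideal = realConfigIdeal fun i => (g⁻¹ * L).1 i := by
  constructor
  · rintro ⟨a, c, hdec, hJ⟩
    have hdec' := hdec
    rw [linSubst_stdQuadric] at hdec'
    have hgram : gram (signs p q) (fun i => L.1 i) = gram c a := sum_sq_eq_iff.1 hdec'
    have hunit := isUnit_det_gram_signs L
    rw [hgram] at hunit
    have ha := (isUnit_det_of_gram hunit).1
    obtain ⟨hp, hq⟩ := card_signs_of_decomposition hf ha hdec
    obtain ⟨σ, t, ht, hσ⟩ := exists_normalized (a := a) hp hq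
    let A : Fin (p + q) → Fin (p + q) → ℝ := fun i => t i • a (σ i)
    have hgramA : gram c a = gram (signs p q) A := sum_sq_eq_iff.1 hσ
    rw [hgramA] at hunit
    have hA := (isUnit_det_of_gram hunit).1
    have hpres : (L.1 * (Matrix.of A)⁻¹).transpose * Matrix.diagonal (signs p q) *
        (L.1 * (Matrix.of A)⁻¹) = Matrix.diagonal (signs p q) := by
      calc (L.1 * (Matrix.of A)⁻¹).transpose * Matrix.diagonal (signs p q) *
            (L.1 * (Matrix.of A)⁻¹)
          = (Matrix.of A)⁻¹.transpose * gram (signs p q) (fun i => L.1 i) * (Matrix.of A)⁻¹ := by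
            rw [gram_signs, Matrix.transpose_mul]
            simp only [Matrix.mul_assoc]
        _ = (Matrix.of A * (Matrix.of A)⁻¹).transpose * Matrix.diagonal (signs p q) *
            (Matrix.of A * (Matrix.of A)⁻¹) := by
            rw [hgram, hgramA, gram, Matrix.transpose_mul]
            simp only [Matrix.mul_assoc]
        _ = _ := by
            rw [Matrix.mul_nonsing_inv _ hA, Matrix.transpose_one, Matrix.one_mul, Matrix.mul_one]
    obtain ⟨h, hh, δ, hδ, hd⟩ := exists_mul_eq_diagonal hpres
    refine ⟨h⁻¹, inv_mem hh, ?_⟩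
    have hrow : (h⁻¹⁻¹ * L).1 = Matrix.diagonal δ * Matrix.of A := by
      rw [inv_inv, Units.val_mul, ← hd, Matrix.mul_assoc, Matrix.mul_assoc,
        Matrix.nonsing_inv_mul _ hA, Matrix.mul_one]
    have hδ0 : ∀ i, δ i ≠ 0 := fun i => by rcases hδ i with e | e <;> simp [e]
    rw [hJ]
    symm
    refine realConfigIdeal_eq_of_rows σ (c := fun i => δ i * t i)
      (fun i => mul_ne_zero (hδ0 i) (ht i)) fun i => ?_
    ext j
    rw [hrow, Matrix.diagonal_mul]
    simp [A, mul_assoc]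
  · rintro ⟨g, hg, hJ⟩
    refine ⟨_, signs p q, ?_, hJ⟩
    rw [linSubst_stdQuadric]
    exact sum_sq_eq_iff.2 (preserves_inv_mul hg L).symm

theorem linForm_injective {n : ℕ} {a b : Fin n → ℝ} (h : linForm a = linForm b) : a = b := by
  ext j
  have := congrArg (eval (Pi.single j 1)) h
  simpa [eval_linForm] using this

theorem linForm_single {n : ℕ} {K : Type*} [CommSemiring K] (j : Fin n) :
    linForm (Pi.single j 1 : Fin n → K) = X j := by
  simp [linForm, Pi.single_apply, apply_ite, ite_mul]

theorem changeCoords_X_sq {n : ℕ} (k : GL (Fin n) ℝ) (i : Fin n) :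
    changeCoords n k • (X i ^ 2 : MvPolynomial (Fin n) ℝ) = linForm ((k⁻¹).1 i) ^ 2 := by
  change linSubst (k⁻¹).1 (X i ^ 2) = _
  simp [linSubst]

/-- If the square of a linear form is `x_j²`, the form is `±x_j`; hence the inverse matrix is
monomial. -/
theorem exists_perm_of_mem_squaresStabilizer {p q : ℕ} {k : SOPlus p q}
    (hk : k ∈ squaresStabilizer p q) :
    ∃ (σ : Equiv.Perm (Fin (p + q))) (δ : Fin (p + q) → ℝ), (∀ i, δ i ≠ 0) ∧
      ∀ i, (k.1⁻¹).1 i = δ i • Pi.single (σ i) 1 := by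
  rw [squaresStabilizer, Subgroup.mem_subgroupOf, Subgroup.mem_comap, MulAction.mem_stabilizer_iff]
    at hk
  have h1 : ∀ i, ∃ j, changeCoords (p + q) k.1 • (X i ^ 2 : MvPolynomial (Fin (p + q)) ℝ) =
      X j ^ 2 := by
    have h2 : ∀ S : Set (MvPolynomial (Fin (p + q)) ℝ),
        S ∈ ({Set.range fun i : Fin p => X (Fin.castAdd q i) ^ 2,
          Set.range fun j : Fin q => X (Fin.natAdd p j) ^ 2} :
            Set (Set (MvPolynomial (Fin (p + q)) ℝ))) →
        ∀ f ∈ S, ∃ j, changeCoords (p + q) k.1 • f = X j ^ 2 := by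
      intro S hS f hfS
      have h3 := Set.smul_mem_smul_set (a := changeCoords (p + q) k.1) hS
      rw [hk] at h3
      have h4 := Set.smul_mem_smul_set (a := changeCoords (p + q) k.1) hfS
      rcases h3 with h3 | h3
      · rw [h3] at h4
        obtain ⟨j, hj⟩ := h4
        exact ⟨_, hj.symm⟩
      · rw [Set.mem_singleton_iff.1 h3] at h4
        obtain ⟨j, hj⟩ := h4
        exact ⟨_, hj.symm⟩
    intro i
    refine Fin.addCases (fun i => ?_) (fun i => ?_) i
    · exact h2 _ (Or.inl rfl) _ ⟨i, rfl⟩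
    · exact h2 _ (Or.inr rfl) _ ⟨i, rfl⟩
  have h5 : ∀ i, ∃ j, ∃ d : ℝ, d ≠ 0 ∧ (k.1⁻¹).1 i = d • Pi.single j 1 := by
    intro i
    obtain ⟨j, hj⟩ := h1 i
    rw [changeCoords_X_sq, ← linForm_single] at hj
    refine ⟨j, ?_⟩
    rcases sq_eq_sq_iff_eq_or_eq_neg.1 hj with h | h
    · exact ⟨1, one_ne_zero, by rw [one_smul]; exact linForm_injective h⟩
    · refine ⟨-1, by norm_num, linForm_injective ?_⟩
      rw [h]
      simp [linForm]
  choose σ δ hδ hrow using h5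
  have hinj : Function.Injective σ :=
    injective_of_row_eq_smul (isUnit_det_GL k.1⁻¹) (B := fun j => Pi.single j 1) hδ hrow
  exact ⟨Equiv.ofBijective σ (Finite.injective_iff_bijective.1 hinj), δ, hδ, hrow⟩

/-- Comparing the values of the standard quadric at basis vectors forces the entries to be `±1` and
the permutation to preserve signs. So each of the two sets of squares is mapped to itself. -/
theorem mem_squaresStabilizer_of_perm {p q : ℕ} {k : SOPlus p q} {σ : Equiv.Perm (Fin (p + q))}
    {δ : Fin (p + q) → ℝ} (hrow : ∀ i, (k.1⁻¹).1 i = δ i • Pi.single (σ i) 1) :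
    k ∈ squaresStabilizer p q := by
  have hentry : ∀ i j, (k.1⁻¹).1 i j = if j = σ i then δ i else 0 := by
    intro i j
    rw [hrow i]
    simp [Pi.single_apply]
  have hmv : ∀ i j, (k.1⁻¹).1.mulVec (Pi.single j 1) i = if j = σ i then δ i else 0 := by
    intro i j
    rw [Matrix.mulVec_single_one]
    exact hentry i j
  have hsign : ∀ i, signs p q i * δ i ^ 2 = signs p q (σ i) := by
    intro i
    have h1 := SOPlus_preserves (inv_mem k.2) (Pi.single (σ i) 1)
    simp only [hmv] at h1
    rw [Finset.sum_eq_single i, Finset.sum_eq_single (σ i)] at h1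
    · simpa using h1
    · intro j _ hj
      simp [hj]
    · simp
    · intro j _ hj
      simp [hj.symm]
    · simp
  have hδ : ∀ i, δ i ^ 2 = 1 ∧ signs p q (σ i) = signs p q i := by
    intro i
    have h1 := hsign i
    have h2 := sq_nonneg (δ i)
    rcases signs_eq i with e1 | e1 <;> rcases signs_eq (σ i) with e2 | e2 <;>
      rw [e1, e2] at h1 ⊢ <;> refine ⟨?_, ?_⟩ <;> linarith
  have hact : ∀ i, changeCoords (p + q) k.1 • (X i ^ 2 : MvPolynomial (Fin (p + q)) ℝ) =
      X (σ i) ^ 2 := by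
    intro i
    rw [changeCoords_X_sq, hrow i]
    have h1 : linForm (δ i • (Pi.single (σ i) 1 : Fin (p + q) → ℝ)) = C (δ i) * X (σ i) := by
      rw [← linForm_single]
      simp [linForm, Finset.mul_sum, mul_assoc]
    rw [h1, mul_pow, ← C_pow, (hδ i).1, C_1, one_mul]
  have hset : ∀ e : ℝ, changeCoords (p + q) k.1 •
      {f : MvPolynomial (Fin (p + q)) ℝ | ∃ i, signs p q i = e ∧ X i ^ 2 = f} =
      {f : MvPolynomial (Fin (p + q)) ℝ | ∃ i, signs p q i = e ∧ X i ^ 2 = f} := by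
    intro e
    ext f
    rw [Set.mem_smul_set]
    constructor
    · rintro ⟨_, ⟨i, hi, rfl⟩, rfl⟩
      exact ⟨σ i, (hδ i).2.trans hi, (hact i).symm⟩
    · rintro ⟨i, hi, rfl⟩
      refine ⟨_, ⟨σ.symm i, ?_, rfl⟩, ?_⟩
      · rw [← (hδ _).2, Equiv.apply_symm_apply, hi]
      · rw [hact, Equiv.apply_symm_apply]
  have hpos : (Set.range fun i : Fin p => (X (Fin.castAdd q i) ^ 2 : MvPolynomial _ ℝ)) =
      {f | ∃ i, signs p q i = 1 ∧ X i ^ 2 = f} := by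
    ext f
    constructor
    · rintro ⟨i, rfl⟩
      exact ⟨_, signs_castAdd i, rfl⟩
    · rintro ⟨i, hi, rfl⟩
      revert hi
      refine Fin.addCases (fun i _ => ⟨i, rfl⟩) (fun i hi => ?_) i
      rw [signs_natAdd] at hi
      norm_num at hi
  have hneg : (Set.range fun j : Fin q => (X (Fin.natAdd p j) ^ 2 : MvPolynomial _ ℝ)) =
      {f | ∃ i, signs p q i = -1 ∧ X i ^ 2 = f} := by
    ext f
    constructor
    · rintro ⟨i, rfl⟩
      exact ⟨_, signs_natAdd i, rfl⟩
    · rintro ⟨i, hi, rfl⟩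
      revert hi
      refine Fin.addCases (fun i hi => ?_) (fun i _ => ⟨i, rfl⟩) i
      rw [signs_castAdd] at hi
      norm_num at hi
  rw [squaresStabilizer, Subgroup.mem_subgroupOf, Subgroup.mem_comap, MulAction.mem_stabilizer_iff,
    hpos, hneg, ← Set.image_smul, Set.image_pair, hset, hset]

/-- Since `h⁻¹L = (g⁻¹h)⁻¹ (g⁻¹L)`, the configurations agree exactly if `(g⁻¹h)⁻¹` permutes rows up
to scalars. -/
theorem inv_mul_mem_squaresStabilizer_iff {p q : ℕ} (L : GL (Fin (p + q)) ℝ) (g h : SOPlus p q) :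
    g⁻¹ * h ∈ squaresStabilizer p q ↔
      realConfigIdeal (fun i => (g.1⁻¹ * L).1 i) = realConfigIdeal fun i => (h.1⁻¹ * L).1 i := by
  have hmul : (h.1⁻¹ * L).1 = ((g⁻¹ * h : SOPlus p q).1⁻¹).1 * (g.1⁻¹ * L).1 := by
    rw [← Units.val_mul]
    congr 1
    simp [mul_assoc]
  constructor
  · intro hk
    obtain ⟨σ, δ, hδ, hrow⟩ := exists_perm_of_mem_squaresStabilizer hk
    symm
    refine realConfigIdeal_eq_of_rows σ hδ fun i => ?_
    ext j
    rw [hmul, Matrix.mul_apply, hrow i]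
    simp [Pi.single_apply]
  · intro heq
    obtain ⟨σ, c, hc, hσ⟩ := exists_perm_of_realConfigIdeal_eq (isUnit_det_GL _) (isUnit_det_GL _)
      heq.symm
    refine mem_squaresStabilizer_of_perm (σ := σ) (δ := c) fun i => ?_
    have hD : (Matrix.of fun i => c i • (Pi.single (σ i) 1 : Fin (p + q) → ℝ)) =
        ((g⁻¹ * h : SOPlus p q).1⁻¹).1 := by
      have h1 : (Matrix.of fun i => c i • (Pi.single (σ i) 1 : Fin (p + q) → ℝ)) *
          (g.1⁻¹ * L).1 = ((g⁻¹ * h : SOPlus p q).1⁻¹).1 * (g.1⁻¹ * L).1 := by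
        rw [← hmul]
        ext i j
        rw [show (h.1⁻¹ * L).1 i j = _ from congrFun (hσ i) j, Matrix.mul_apply]
        simp [Pi.single_apply]
      exact (g.1⁻¹ * L).isUnit.mul_right_cancel h1
    rw [← hD]
    rfl

/-! ### Points of the Hilbert scheme are determined by their piece of degree `r` -/

/-- `linForm` as a linear map. -/
def linFormHom (n : ℕ) : (Fin n → ℂ) →ₗ[ℂ] MvPolynomial (Fin n) ℂ where
  toFun := linForm
  map_add' a b := by simp [linForm, add_mul, Finset.sum_add_distrib]
  map_smul' c a := by simp [linForm, Finset.smul_sum, smul_eq_C_mul, mul_assoc]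

/-- Over a saturated ideal some linear form is a nonzerodivisor. -/
theorem exists_linForm_regular {n : ℕ} {I : Ideal (MvPolynomial (Fin n) ℂ)}
    (hI : ∀ p, (∀ i, X i * p ∈ I) → p ∈ I) :
    ∃ a : Fin n → ℂ, ∀ p, linForm a * p ∈ I → p ∈ I := by
  let S := MvPolynomial (Fin n) ℂ
  have hfin : Finite (associatedPrimes S (S ⧸ I)) := associatedPrimes.finite S (S ⧸ I)
  let W : associatedPrimes S (S ⧸ I) → Submodule ℂ (Fin n → ℂ) := fun P =>
    (P.1.restrictScalars ℂ).comap (linFormHom n)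
  -- A vector space over `ℂ` is no finite union of proper subspaces. An associated prime containing
  -- all linear forms would contain all variables and annihilate a nonzero class, against
  -- saturation.
  have hW : ⋃ P, (W P : Set (Fin n → ℂ)) ≠ Set.univ := by
    intro h
    obtain ⟨⟨P, hP⟩, hPtop⟩ := Subspace.exists_eq_top_of_iUnion_eq_univ h
    obtain ⟨hprime, x, hx⟩ := isAssociatedPrime_iff.1 (AssociatedPrimes.mem_iff.1 hP)
    obtain ⟨p, rfl⟩ := Ideal.Quotient.mk_surjective x
    apply hprime.ne_top
    rw [Ideal.eq_top_iff_one, hx, Submodule.mem_colon_singleton, one_smul, Submodule.mem_bot]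
    rw [Ideal.Quotient.eq_zero_iff_mem]
    apply hI
    intro i
    have h1 : (Pi.single i 1 : Fin n → ℂ) ∈ W ⟨P, hP⟩ := by
      rw [hPtop]
      trivial
    have h2 : (X i : S) ∈ P := by
      have h3 : linForm (Pi.single i 1) ∈ P := h1
      rwa [linForm_single] at h3
    rw [hx, Submodule.mem_colon_singleton, Submodule.mem_bot] at h2
    rwa [← Ideal.Quotient.eq_zero_iff_mem]
  obtain ⟨a, ha⟩ := (Set.ne_univ_iff_exists_notMem _).1 hW
  refine ⟨a, fun p hp => ?_⟩
  by_contra hpI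
  apply ha
  have h1 : linForm a ∈ ⋃ P ∈ associatedPrimes S (S ⧸ I), (P : Set S) := by
    rw [biUnion_associatedPrimes_eq_zero_divisors]
    refine ⟨Ideal.Quotient.mk I p, fun h => hpI (Ideal.Quotient.eq_zero_iff_mem.1 h), ?_⟩
    change Ideal.Quotient.mk I (linForm a * p) = 0
    exact Ideal.Quotient.eq_zero_iff_mem.2 hp
  obtain ⟨P, hP, haP⟩ := Set.mem_iUnion₂.1 h1
  exact Set.mem_iUnion.2 ⟨⟨P, hP⟩, haP⟩

/-- The Hilbert function of an ideal. -/
def hilb {n : ℕ} (I : Ideal (MvPolynomial (Fin n) ℂ)) (d : ℕ) : ℕ :=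
  Module.finrank ℂ (homogeneousSubmodule (Fin n) ℂ d ⧸ degPart I d)

/-- Multiplication by a linear form. -/
def mulLinForm {n : ℕ} (a : Fin n → ℂ) (d : ℕ) :
    homogeneousSubmodule (Fin n) ℂ d →ₗ[ℂ] homogeneousSubmodule (Fin n) ℂ (d + 1) where
  toFun p := ⟨linForm a * p.1, by
    have := (isHomogeneous_linForm a).mul p.2
    rwa [add_comm] at this⟩
  map_add' p q := Subtype.ext (mul_add _ _ _)
  map_smul' c p := Subtype.ext (mul_smul_comm _ _ _)

/-- Multiplication by a regular linear form embeds each graded piece of the quotient ring in the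
next; equal dimensions mean that it is onto. -/
theorem hilb_regular {n : ℕ} {I : Ideal (MvPolynomial (Fin n) ℂ)} {a : Fin n → ℂ}
    (ha : ∀ p, linForm a * p ∈ I → p ∈ I) (d : ℕ) :
    hilb I d ≤ hilb I (d + 1) ∧ (hilb I d = hilb I (d + 1) ↔
      ∀ q : MvPolynomial (Fin n) ℂ, q.IsHomogeneous (d + 1) →
        ∃ r : MvPolynomial (Fin n) ℂ, r.IsHomogeneous d ∧ q - linForm a * r ∈ I) := by
  have hle : degPart I d ≤ (degPart I (d + 1)).comap (mulLinForm a d) :=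
    fun p hp => Ideal.mul_mem_left _ _ hp
  let T := (degPart I d).mapQ (degPart I (d + 1)) (mulLinForm a d) hle
  have hinj : Function.Injective T := by
    rw [← LinearMap.ker_eq_bot, LinearMap.ker_eq_bot']
    intro x
    obtain ⟨p, rfl⟩ := Submodule.Quotient.mk_surjective _ x
    intro h
    have h1 : Submodule.Quotient.mk (mulLinForm a d p) = (0 : _ ⧸ degPart I (d + 1)) := h
    rw [Submodule.Quotient.mk_eq_zero] at h1 ⊢
    exact ha _ h1
  have hsurj : Function.Surjective T ↔ ∀ q : MvPolynomial (Fin n) ℂ, q.IsHomogeneous (d + 1) →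
        ∃ r : MvPolynomial (Fin n) ℂ, r.IsHomogeneous d ∧ q - linForm a * r ∈ I := by
    constructor
    · intro h q hq
      obtain ⟨x, hx⟩ := h (Submodule.Quotient.mk ⟨q, hq⟩)
      obtain ⟨r, rfl⟩ := Submodule.Quotient.mk_surjective _ x
      have h1 : Submodule.Quotient.mk (mulLinForm a d r) =
          (Submodule.Quotient.mk ⟨q, hq⟩ : _ ⧸ degPart I (d + 1)) := hx
      exact ⟨r.1, r.2, (Submodule.Quotient.eq (degPart I (d + 1))).1 h1.symm⟩
    · intro h x
      obtain ⟨q, rfl⟩ := Submodule.Quotient.mk_surjective _ x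
      obtain ⟨r, hr, hqr⟩ := h q.1 q.2
      have h1 : q - mulLinForm a d ⟨r, hr⟩ ∈ degPart I (d + 1) := hqr
      exact ⟨Submodule.Quotient.mk ⟨r, hr⟩, ((Submodule.Quotient.eq _).2 h1).symm⟩
  refine ⟨LinearMap.finrank_le_finrank_of_injective hinj, ?_⟩
  rw [← hsurj]
  constructor
  · intro h
    exact (LinearMap.injective_iff_surjective_of_finrank_eq_finrank h).1 hinj
  · intro h
    exact (LinearEquiv.ofBijective T ⟨hinj, h⟩).finrank_eq

/-- Surjectivity propagates upwards: every monomial of degree `d + 2` is a variable times one of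
degree `d + 1`, which is a multiple of the linear form modulo `I`. -/
theorem hilb_eq_succ {n : ℕ} {I : Ideal (MvPolynomial (Fin n) ℂ)} {a : Fin n → ℂ}
    (ha : ∀ p, linForm a * p ∈ I → p ∈ I) {d : ℕ} (h : hilb I d = hilb I (d + 1)) :
    hilb I (d + 1) = hilb I (d + 1 + 1) := by
  rw [(hilb_regular ha _).2] at h ⊢
  intro q hq
  have key : ∀ s : Finset (Fin n →₀ ℕ), s ⊆ q.support → ∃ r : MvPolynomial (Fin n) ℂ,
      r.IsHomogeneous (d + 1) ∧
        ∑ m ∈ s, monomial m (coeff m q) - linForm a * r ∈ I := by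
    intro s
    induction s using Finset.induction_on with
    | empty => exact fun _ => ⟨0, isHomogeneous_zero _ _ _, by simp⟩
    | insert m s hm ih =>
      intro hs
      obtain ⟨r, hr, hrI⟩ := ih ((Finset.subset_insert m s).trans hs)
      have hdeg := degree_eq_of_mem_support hq (hs (Finset.mem_insert_self m s))
      obtain ⟨i, hi⟩ : ∃ i, m i ≠ 0 := by
        by_contra! hcon
        have : m = 0 := Finsupp.ext hcon
        rw [this, map_zero] at hdeg
        omega
      have hmi : m - Finsupp.single i 1 + Finsupp.single i 1 = m := by
        apply tsub_add_cancel_of_le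
        rw [Finsupp.single_le_iff]
        exact Nat.one_le_iff_ne_zero.2 hi
      have hdeg' : (m - Finsupp.single i 1).degree = d + 1 := by
        have := congrArg Finsupp.degree hmi
        rw [map_add, Finsupp.degree_single] at this
        omega
      obtain ⟨r', hr', hrI'⟩ := h (monomial (m - Finsupp.single i 1) (coeff m q))
        (isHomogeneous_monomial _ hdeg')
      refine ⟨X i * r' + r, ?_, ?_⟩
      · refine IsHomogeneous.add ?_ hr
        have := (isHomogeneous_X ℂ i).mul hr'
        rwa [add_comm] at this
      · have h1 : monomial m (coeff m q) =
            X i * monomial (m - Finsupp.single i 1) (coeff m q) := by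
          rw [X, monomial_mul, one_mul, add_comm, hmi]
        rw [Finset.sum_insert hm, h1]
        have h2 := I.add_mem (I.mul_mem_left (X i) hrI') hrI
        convert h2 using 1
        ring
  obtain ⟨r, hr, hrI⟩ := key q.support subset_rfl
  rw [support_sum_monomial_coeff] at hrI
  exact ⟨r, hr, hrI⟩

/-- If the Hilbert function of a proper saturated ideal has the value `r` in degree `r`, then it is
constant from there on. -/
theorem hilb_eq_of_le {n r : ℕ} {I : Ideal (MvPolynomial (Fin n) ℂ)} {a : Fin n → ℂ}
    (ha : ∀ p, linForm a * p ∈ I → p ∈ I) (h1 : (1 : MvPolynomial (Fin n) ℂ) ∉ I)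
    (hr : hilb I r = r) {e : ℕ} (he : r ≤ e) : hilb I e = r := by
  have h0 : 1 ≤ hilb I 0 := by
    rw [Nat.one_le_iff_ne_zero]
    intro h
    have h2 : Subsingleton (homogeneousSubmodule (Fin n) ℂ 0 ⧸ degPart I 0) :=
      Module.finrank_zero_iff.1 h
    rw [Submodule.Quotient.subsingleton_iff] at h2
    apply h1
    have h3 : (⟨1, isHomogeneous_one _ _⟩ : homogeneousSubmodule (Fin n) ℂ 0) ∈ degPart I 0 := by
      rw [h2]
      trivial
    exact h3
  -- Otherwise the Hilbert function grows strictly from a value `≥ 1` in degree `0` and is at least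
  -- `r + 1` in degree `r`.
  have hex : ∃ d, d < r ∧ hilb I d = hilb I (d + 1) := by
    by_contra! hcon
    have : ∀ d, d ≤ r → d + 1 ≤ hilb I d := by
      intro d
      induction d with
      | zero => exact fun _ => h0
      | succ d ih =>
        intro hd
        have h2 := ih (by omega)
        have h3 := (hilb_regular ha d).1
        have h4 := hcon d (by omega)
        omega
    have := this r le_rfl
    omega
  obtain ⟨d, hd, hdd⟩ := hex
  have hconst : ∀ k, hilb I (d + k) = hilb I (d + k + 1) := by
    intro k
    induction k with
    | zero => exact hdd
    | succ k ih => exact hilb_eq_succ ha ih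
  have hall : ∀ k, hilb I (d + k) = hilb I d := by
    intro k
    induction k with
    | zero => rfl
    | succ k ih => rw [← ih]; exact (hconst k).symm
  have h5 := hall (e - d)
  have h6 := hall (r - d)
  rw [show d + (e - d) = e by omega] at h5
  rw [show d + (r - d) = r by omega, hr] at h6
  rw [h5, h6]

/-- The intersection with `K` is saturated and has the same degree `r` piece as `J`. Its Hilbert
function is therefore also constant from there on, so it equals `J` in all degrees `≥ r`. A linear
form regular modulo `K` takes care of the lower degrees. -/
theorem ideal_le_of_degPart_le {n r : ℕ} (hr : 1 ≤ r) {J : HilbPoint n r}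
    {K : Ideal (MvPolynomial (Fin n) ℂ)} (hK : ∀ p, (∀ i, X i * p ∈ K) → p ∈ K)
    (h : degPart J.ideal r ≤ degPart K r) : J.ideal ≤ K := by
  have hsat : ∀ p, (∀ i, X i * p ∈ J.ideal ⊓ K) → p ∈ J.ideal ⊓ K := fun p hp =>
    ⟨J.isSaturated p fun i => (hp i).1, hK p fun i => (hp i).2⟩
  obtain ⟨a, ha⟩ := exists_linForm_regular hsat
  obtain ⟨b, hb⟩ := exists_linForm_regular hK
  have hJr : degPart (J.ideal ⊓ K) r = degPart J.ideal r :=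
    le_antisymm (fun p hp => hp.1) fun p hp => ⟨hp, h hp⟩
  have h1 : (1 : MvPolynomial (Fin n) ℂ) ∉ J.ideal ⊓ K := by
    intro h1
    have h2 : degPart J.ideal r = ⊤ := by
      rw [eq_top_iff]
      intro p _
      have := J.ideal.mul_mem_left p.1 h1.1
      rwa [mul_one] at this
    have h3 := J.hilbertFunction r le_rfl
    have h4 : Subsingleton (homogeneousSubmodule (Fin n) ℂ r ⧸ degPart J.ideal r) :=
      Submodule.Quotient.subsingleton_iff.2 h2
    rw [Module.finrank_zero_of_subsingleton] at h3
    omega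
  have hr' : hilb (J.ideal ⊓ K) r = r := by
    rw [hilb, hJr]
    exact J.hilbertFunction r le_rfl
  have heq : ∀ e, r ≤ e → degPart (J.ideal ⊓ K) e = degPart J.ideal e := by
    intro e he
    apply Submodule.eq_of_le_of_finrank_eq fun p (hp : p.1 ∈ J.ideal ⊓ K) => hp.1
    have h2 := Submodule.finrank_quotient_add_finrank (degPart (J.ideal ⊓ K) e)
    have h3 := Submodule.finrank_quotient_add_finrank (degPart J.ideal e)
    rw [J.hilbertFunction e he] at h3
    have h4 := hilb_eq_of_le ha h1 hr' he
    rw [hilb] at h4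
    omega
  have hpow : ∀ k p, linForm b ^ k * p ∈ K → p ∈ K := by
    intro k
    induction k with
    | zero => intro p hp; simpa using hp
    | succ k ih =>
      intro p hp
      rw [pow_succ, mul_assoc] at hp
      exact hb _ (ih _ hp)
  intro p hp
  rw [← sum_homogeneousComponent p]
  refine Ideal.sum_mem _ fun d _ => hpow r _ ?_
  have h2 : linForm b ^ r * homogeneousComponent d p ∈ J.ideal :=
    J.ideal.mul_mem_left _ (homogeneousComponent_mem_of_mem J.isHomogeneous hp d)
  have h3 : (linForm b ^ r * homogeneousComponent d p).IsHomogeneous (r + d) := by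
    simpa using ((isHomogeneous_linForm b).pow r).mul (homogeneousComponent_isHomogeneous d p)
  have h4 : (⟨_, h3⟩ : homogeneousSubmodule (Fin n) ℂ (r + d)) ∈ degPart J.ideal (r + d) := h2
  rw [← heq _ (by omega)] at h4
  exact h4.2

/-! ### Complex conjugation -/

theorem eval_map_conj {n : ℕ} (x : Fin n → ℂ) (p : MvPolynomial (Fin n) ℂ) :
    eval x (map (starRingEnd ℂ) p) = starRingEnd ℂ (eval (fun j => starRingEnd ℂ (x j)) p) := by
  rw [eval_map, ← coe_eval₂Hom, ← RingHom.comp_apply]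
  congr 1
  apply ringHom_ext <;> intros <;> simp

theorem isHomogeneous_map_conj {n d : ℕ} {p : MvPolynomial (Fin n) ℂ} (hp : p.IsHomogeneous d) :
    (map (starRingEnd ℂ) p).IsHomogeneous d := by
  rw [← mem_homogeneousSubmodule] at hp
  exact hp.map _

theorem functional_map_conj {n d : ℕ} (w : Mon n d → ℂ) (p : homogeneousSubmodule (Fin n) ℂ d) :
    functional w ⟨map (starRingEnd ℂ) p.1, isHomogeneous_map_conj p.2⟩ =
      starRingEnd ℂ (functional (fun m => starRingEnd ℂ (w m)) p) := by
  simp [functional_apply, coeff_map]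

theorem conj_row_mem_rowSpan {n r d : ℕ} {M : Frame n d r} {I : Ideal (MvPolynomial (Fin n) ℂ)}
    (hM : frameKernel M.1 = degPart I d) (hI : ∀ p ∈ I, map (starRingEnd ℂ) p ∈ I) (i : Fin r) :
    (fun m => starRingEnd ℂ (M.1 i m)) ∈ rowSpan M.1 := by
  rw [mem_rowSpan_iff]
  intro p hp
  have h1 : (⟨map (starRingEnd ℂ) p.1, isHomogeneous_map_conj p.2⟩ :
      homogeneousSubmodule (Fin n) ℂ d) ∈ frameKernel M.1 := by
    rw [hM] at hp ⊢
    exact hI _ hp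
  have h2 := mem_frameKernel.1 h1 i
  rw [functional_map_conj, map_eq_zero] at h2
  exact h2

/-- The conjugate ideal is saturated too, so reality need only be checked in degree `r`, where it
concerns the row span. -/
theorem isReal_of_conj_row_mem {n r : ℕ} (hr : 1 ≤ r) {J : HilbPoint n r} {M : Frame n r r}
    (hM : frameKernel M.1 = degPart J.ideal r)
    (h : ∀ i, (fun m => starRingEnd ℂ (M.1 i m)) ∈ rowSpan M.1) : J.IsReal := by
  have hle : J.ideal ≤ J.ideal.comap (map (starRingEnd ℂ)) := by
    apply ideal_le_of_degPart_le hr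
    · intro p hp
      rw [Ideal.mem_comap]
      apply J.isSaturated
      intro i
      have := hp i
      rwa [Ideal.mem_comap, map_mul, map_X] at this
    · intro p hp
      rw [mem_degPart, Ideal.mem_comap]
      have h1 : (⟨map (starRingEnd ℂ) p.1, isHomogeneous_map_conj p.2⟩ :
          homogeneousSubmodule (Fin n) ℂ r) ∈ frameKernel M.1 := by
        rw [mem_frameKernel]
        intro i
        rw [functional_map_conj, mem_rowSpan_iff.1 (h i) p (hM ▸ hp), map_zero]
      rw [hM] at h1
      exact h1
  exact fun p hp => hle hp

theorem configIdeal_conj_mem {n r : ℕ} {a : Fin r → Fin n → ℂ} {σ : Fin r → Fin r}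
    (hσ : ∀ i, (fun j => starRingEnd ℂ (a i j)) = a (σ i)) {p : MvPolynomial (Fin n) ℂ}
    (hp : p ∈ configIdeal a) : map (starRingEnd ℂ) p ∈ configIdeal a := by
  rw [mem_configIdeal_iff] at hp ⊢
  intro i c
  rw [eval_map_conj, map_eq_zero, ← hp (σ i) (starRingEnd ℂ c), ← hσ i]
  congr 2
  ext j
  simp

/-! ### The closure of the space of sums of powers -/

theorem map_sum_sq {n : ℕ} (c : Fin n → ℝ) (a : Fin n → Fin n → ℝ) :
    map Complex.ofRealHom (∑ i, C (c i) * linForm (a i) ^ 2) =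
      ∑ i, C ((c i : ℝ) : ℂ) * linForm (fun j => (a i j : ℂ)) ^ 2 := by
  simp [linForm]

theorem SSPReal_subset_powerSumConfigs {n : ℕ} (f : MvPolynomial (Fin n) ℝ) :
    SSPReal f ⊆ powerSumConfigs (map Complex.ofRealHom f) := by
  rintro J ⟨a, c, rfl, hJ⟩
  exact ⟨_, _, map_sum_sq c a, hJ⟩

theorem subset_zariskiClosure {n r : ℕ} (T : Set (HilbPoint n r)) : T ⊆ zariskiClosure T :=
  fun J hJ _ hP M hM => hP J hJ M hM

theorem isReal_of_mem_SSPReal {n : ℕ} {f : MvPolynomial (Fin n) ℝ} {J : HilbPoint n n}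
    (hJ : J ∈ SSPReal f) : J.IsReal := by
  obtain ⟨a, c, -, hJ⟩ := hJ
  intro p hp
  rw [hJ] at hp ⊢
  exact configIdeal_conj_mem (σ := id) (fun i => by ext j; simp) hp

theorem SSPReal_subset_VSPReal {n : ℕ} (f : MvPolynomial (Fin n) ℝ) : SSPReal f ⊆ VSPReal f :=
  fun _ hJ => ⟨subset_zariskiClosure _ (SSPReal_subset_powerSumConfigs f hJ),
    isReal_of_mem_SSPReal hJ⟩

/-- Polynomial equations in frames are closed in the Euclidean topology. Reality is closed because
conjugate rows remain in the row span in the limit. -/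
theorem closure_SSPReal_subset_VSPReal {n : ℕ} (hn : 1 ≤ n) (f : MvPolynomial (Fin n) ℝ) :
    closure (SSPReal f) ⊆ VSPReal f := by
  intro J hJ
  constructor
  · intro P hP M hM
    have h1 := mem_closure_frames hJ hM
    have h2 : IsClosed {M : Frame n n n | eval (fun im => M.1 im.1 im.2) P = 0} := by
      refine isClosed_eq ?_ continuous_const
      refine (continuous_eval P).comp (continuous_pi fun im => ?_)
      exact (continuous_apply im.2).comp ((continuous_apply im.1).comp continuous_subtype_val)
    refine closure_minimal ?_ h2 h1
    rintro M' ⟨K, hK, hM'⟩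
    exact hP K (SSPReal_subset_powerSumConfigs f hK) M' hM'
  · obtain ⟨M, hM⟩ := exists_frame _ (J.hilbertFunction n le_rfl)
    apply isReal_of_conj_row_mem hn hM
    intro i
    obtain ⟨𝒰, h𝒰, hlim⟩ := mem_closure_iff_ultrafilter.1 (mem_closure_frames hJ hM)
    refine mem_rowSpan_of_tendsto (l := (𝒰 : Filter (Frame n n n))) (M := id)
      (w := fun M m => starRingEnd ℂ (M.1 i m)) hlim ?_ ?_
    · have hc : Continuous fun M : Frame n n n => fun m => starRingEnd ℂ (M.1 i m) := by
        refine continuous_pi fun m => Complex.continuous_conj.comp ?_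
        exact (continuous_apply m).comp ((continuous_apply i).comp continuous_subtype_val)
      exact (hc.tendsto M).mono_left hlim
    · filter_upwards [h𝒰] with M' hM'
      obtain ⟨K, hK, hM'⟩ := hM'
      exact conj_row_mem_rowSpan hM' (isReal_of_mem_SSPReal hK) i

/-! ### Limits of real configurations -/

-- The matrices may diverge, but their normalized rows lie on a compact sphere. Their Veronese
-- vectors lie in the row spans of the converging frames, so each limit `u i` is a zero of the
-- degree `n` piece of `J`. Different indices may have the same limit point.
open Filter Topology in
theorem exists_ultrafilter_limit {n : ℕ} {B : Set (GL (Fin n) ℝ)} {J : HilbPoint n n}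
    (hJ : J ∈ closure {K : HilbPoint n n | ∃ A ∈ B, K.ideal = realConfigIdeal fun i => A.1 i}) :
    ∃ (𝒰 : Ultrafilter (GL (Fin n) ℝ)) (u : Fin n → Fin n → ℝ), B ∈ 𝒰 ∧ (∀ i, u i ≠ 0) ∧
      (∀ i, Tendsto (fun A : GL (Fin n) ℝ => ‖A.1 i‖⁻¹ • A.1 i) 𝒰 (𝓝 (u i))) ∧
      ∀ i, ∀ p ∈ degPart J.ideal n, eval (fun j => (u i j : ℂ)) p.1 = 0 := by
  classical
  obtain ⟨M, hM⟩ := exists_frame _ (J.hilbertFunction n le_rfl)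
  obtain ⟨𝒱, h𝒱, hlim⟩ := mem_closure_iff_ultrafilter.1 (mem_closure_frames hJ hM)
  have hch : ∀ N : Frame n n n, ∃ A : GL (Fin n) ℝ,
      N ∈ {M' : Frame n n n | ∃ K ∈ {K : HilbPoint n n | ∃ A ∈ B,
        K.ideal = realConfigIdeal fun i => A.1 i}, frameKernel M'.1 = degPart K.ideal n} →
      A ∈ B ∧ frameKernel N.1 = degPart (realConfigIdeal fun i => A.1 i) n := by
    intro N
    by_cases hN : ∃ K ∈ {K : HilbPoint n n | ∃ A ∈ B,
        K.ideal = realConfigIdeal fun i => A.1 i}, frameKernel N.1 = degPart K.ideal n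
    · obtain ⟨K, ⟨A, hA, hK⟩, hN'⟩ := hN
      exact ⟨A, fun _ => ⟨hA, hK ▸ hN'⟩⟩
    -- An arbitrary value, taken only outside a set belonging to the ultrafilter.
    · exact ⟨1, fun h => absurd h hN⟩
  choose φ hφ using hch
  have hsphere : ∀ i, ∃ v ∈ Metric.sphere (0 : Fin n → ℝ) 1,
      ((𝒱.map φ).map fun A : GL (Fin n) ℝ => ‖A.1 i‖⁻¹ • A.1 i : Filter (Fin n → ℝ)) ≤ 𝓝 v := by
    intro i
    apply (isCompact_sphere (0 : Fin n → ℝ) 1).ultrafilter_le_nhds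
    rw [le_principal_iff, Ultrafilter.mem_coe, Ultrafilter.mem_map]
    refine Filter.univ_mem' fun A => ?_
    rw [Set.mem_preimage, mem_sphere_zero_iff_norm, norm_smul, norm_inv, norm_norm]
    exact inv_mul_cancel₀ (norm_ne_zero_iff.2 (row_ne_zero (isUnit_det_GL A) i))
  choose u hu hulim using hsphere
  refine ⟨𝒱.map φ, u, ?_, ?_, hulim, ?_⟩
  · rw [Ultrafilter.mem_map]
    filter_upwards [h𝒱] with N hN using (hφ N hN).1
  · intro i h0
    have := hu i
    rw [h0] at this
    simp at this
  · intro i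
    rw [← monomialVec_mem_rowSpan_iff hM]
    refine mem_rowSpan_of_tendsto (l := (𝒱 : Filter (Frame n n n))) (M := id)
      (w := fun N => monomialVec n fun j => ((‖(φ N).1 i‖⁻¹ • (φ N).1 i) j : ℂ)) hlim ?_ ?_
    · have hc : Continuous fun v : Fin n → ℝ => monomialVec n fun j => (v j : ℂ) :=
        (continuous_monomialVec n n).comp
          (continuous_pi fun j => Complex.continuous_ofReal.comp (continuous_apply j))
      exact (hc.tendsto (u i)).comp (hulim i)
    · filter_upwards [h𝒱] with N hN
      rw [id, monomialVec_mem_rowSpan_iff (hφ N hN).2]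
      intro p hp
      have h1 := mem_configIdeal_iff.1 hp i ((‖(φ N).1 i‖⁻¹ : ℝ) : ℂ)
      rw [← h1]
      congr 2
      ext j
      simp

/-- The bilinear form with a given matrix. -/
def bilin {n : ℕ} (b : Matrix (Fin n) (Fin n) ℝ) (v w : Fin n → ℝ) : ℝ := v ⬝ᵥ b.mulVec w

theorem continuous_bilin {n : ℕ} (b : Matrix (Fin n) (Fin n) ℝ) :
    Continuous fun vw : (Fin n → ℝ) × (Fin n → ℝ) => bilin b vw.1 vw.2 := by
  unfold bilin
  exact continuous_fst.dotProduct (continuous_const.matrix_mulVec continuous_snd)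

theorem bilin_smul_smul {n : ℕ} (b : Matrix (Fin n) (Fin n) ℝ) (s t : ℝ) (v w : Fin n → ℝ) :
    bilin b (s • v) (t • w) = s * t * bilin b v w := by
  rw [bilin, Matrix.mulVec_smul, smul_dotProduct, dotProduct_smul, smul_eq_mul, smul_eq_mul,
    mul_assoc, bilin]

theorem mul_mul_transpose_apply {n : ℕ} (A b : Matrix (Fin n) (Fin n) ℝ) (i k : Fin n) :
    (A * b * A.transpose) i k = bilin b (A i) (A k) := by
  rw [Matrix.mul_assoc, Matrix.mul_apply, bilin, dotProduct]
  rfl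

theorem inv_signs {p q : ℕ} (i : Fin (p + q)) : (signs p q i)⁻¹ = signs p q i := by
  rcases signs_eq i with h | h <;> rw [h] <;> norm_num

theorem bilin_rows {p q : ℕ} {G : Matrix (Fin (p + q)) (Fin (p + q)) ℝ}
    {A : Matrix (Fin (p + q)) (Fin (p + q)) ℝ} (hG : IsUnit G.det)
    (hA : A.transpose * Matrix.diagonal (signs p q) * A = G) (i k : Fin (p + q)) :
    bilin G⁻¹ (A i) (A k) = if i = k then signs p q i else 0 := by
  subst hA
  have h1 := mul_inv_gram_mul (c := signs p q) (a := fun i => A i) hG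
  rw [← mul_mul_transpose_apply]
  refine (congrFun (congrFun h1 i) k).trans ?_
  rw [Matrix.diagonal_apply, inv_signs]

open Filter Topology in
theorem tendsto_bilin_normalized {n : ℕ} {b : Matrix (Fin n) (Fin n) ℝ} {ι : Type*} {l : Filter ι}
    {A : ι → Matrix (Fin n) (Fin n) ℝ} {u : Fin n → Fin n → ℝ}
    (hu : ∀ i, Tendsto (fun x => ‖A x i‖⁻¹ • A x i) l (𝓝 (u i))) (i k : Fin n) :
    Tendsto (fun x => ‖A x i‖⁻¹ * ‖A x k‖⁻¹ * bilin b (A x i) (A x k)) l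
      (𝓝 (bilin b (u i) (u k))) := by
  have h1 := ((continuous_bilin b).tendsto (u i, u k)).comp ((hu i).prodMk_nhds (hu k))
  refine h1.congr fun x => ?_
  exact bilin_smul_smul b _ _ _ _

open Filter Topology in
/-- A limit of real decompositions that is again a real decomposition is obtained from a limit in
the group. -/
theorem exists_mem_closure_of_mem_closure {p q : ℕ} {L : GL (Fin (p + q)) ℝ}
    {S : Set (GL (Fin (p + q)) ℝ)} (hS : S ⊆ SOPlus p q) {J : HilbPoint (p + q) (p + q)}
    (hJ : J ∈ closure {K : HilbPoint (p + q) (p + q) |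
      ∃ g ∈ S, K.ideal = realConfigIdeal fun i => (g⁻¹ * L).1 i})
    {g₀ : GL (Fin (p + q)) ℝ} (hg₀ : g₀ ∈ SOPlus p q)
    (hJ₀ : J.ideal = realConfigIdeal fun i => (g₀⁻¹ * L).1 i) :
    ∃ g ∈ closure S, J.ideal = realConfigIdeal fun i => (g⁻¹ * L).1 i := by
  set G := L.1.transpose * Matrix.diagonal (signs p q) * L.1 with hG
  have hGu : IsUnit G.det := isUnit_det_gram_signs L
  let B : Set (GL (Fin (p + q)) ℝ) := {A | L * A⁻¹ ∈ S}
  have hJB : J ∈ closure {K : HilbPoint (p + q) (p + q) |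
      ∃ A ∈ B, K.ideal = realConfigIdeal fun i => A.1 i} := by
    refine closure_mono ?_ hJ
    rintro K ⟨g, hg, hK⟩
    refine ⟨g⁻¹ * L, ?_, hK⟩
    change L * (g⁻¹ * L)⁻¹ ∈ S
    rwa [mul_inv_rev, inv_inv, mul_inv_cancel_left]
  obtain ⟨𝒰, u, hB, hu0, hulim, hu⟩ := exists_ultrafilter_limit hJB
  have hBpres : ∀ A ∈ B, A.1.transpose * Matrix.diagonal (signs p q) * A.1 = G := by
    intro A hA
    have h1 := preserves_inv_mul (hS hA) L
    rwa [mul_inv_rev, inv_inv, inv_mul_cancel_right] at h1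
  have hprop : ∀ i, ∃ k, ∃ t : ℝ, t ≠ 0 ∧ u i = t • (g₀⁻¹ * L).1 k := by
    intro i
    obtain ⟨k, c, hc, hk⟩ := exists_smul_row_of_eval_eq_zero
      (isUnit_det_ofReal (isUnit_det_GL (g₀⁻¹ * L))) (v := fun j => (u i j : ℂ))
      (by
        intro h
        apply hu0 i
        ext j
        exact Complex.ofReal_eq_zero.1 (congrFun h j))
      (by
        intro p hp
        apply hu i
        rw [hJ₀]
        exact hp)
    exact ⟨k, exists_real_smul (row_ne_zero (isUnit_det_GL (g₀⁻¹ * L)) k) hc hk⟩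
  choose σ t ht hσ using hprop
  -- The limits are multiples of the rows of a genuine decomposition, and these have length `±1` for
  -- the inverse form.
  have hβ : ∀ i, bilin G⁻¹ (u i) (u i) ≠ 0 := by
    intro i
    rw [hσ i, bilin_smul_smul, bilin_rows hGu (preserves_inv_mul hg₀ L), if_pos rfl]
    exact mul_ne_zero (mul_ne_zero (ht i) (ht i)) (signs_ne_zero _)
  let τ : Fin (p + q) → ℝ := fun i => signs p q i * bilin G⁻¹ (u i) (u i)
  have hτ0 : ∀ i, τ i ≠ 0 := fun i => mul_ne_zero (signs_ne_zero i) (hβ i)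
  -- The rows themselves have length `±1`, so the normalized ones have length `±‖A i‖⁻²`; the limit
  -- of the latter is nonzero, and the norms converge.
  have hnorm2 : ∀ i, Tendsto (fun A : GL (Fin (p + q)) ℝ => ‖A.1 i‖⁻¹ ^ 2) 𝒰 (𝓝 (τ i)) := by
    intro i
    have h1 := (tendsto_bilin_normalized (b := G⁻¹) hulim i i).const_mul (signs p q i)
    refine h1.congr' ?_
    filter_upwards [hB] with A hA
    rw [bilin_rows hGu (hBpres A hA), if_pos rfl]
    linear_combination ‖A.1 i‖⁻¹ ^ 2 * signs_mul_self i
  have hnorm : ∀ i, Tendsto (fun A : GL (Fin (p + q)) ℝ => ‖A.1 i‖) 𝒰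
      (𝓝 (Real.sqrt (τ i))⁻¹) := by
    intro i
    have hτ : 0 ≤ τ i := ge_of_tendsto' (hnorm2 i) fun A => sq_nonneg _
    have h1 : Real.sqrt (τ i) ≠ 0 := (Real.sqrt_pos.2 (lt_of_le_of_ne hτ (hτ0 i).symm)).ne'
    have h2 := ((Real.continuous_sqrt.tendsto (τ i)).comp (hnorm2 i)).inv₀ h1
    refine h2.congr fun A => ?_
    rw [Function.comp_apply, Real.sqrt_sq (inv_nonneg.2 (norm_nonneg _)), inv_inv]
  let A' : Matrix (Fin (p + q)) (Fin (p + q)) ℝ := Matrix.of fun i => (Real.sqrt (τ i))⁻¹ • u i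
  have hlim : Tendsto (fun A : GL (Fin (p + q)) ℝ => A.1) 𝒰 (𝓝 A') := by
    refine tendsto_pi_nhds.2 fun i => ?_
    refine ((hnorm i).smul (hulim i)).congr fun A => ?_
    rw [smul_smul, mul_inv_cancel₀ (norm_ne_zero_iff.2 (row_ne_zero (isUnit_det_GL A) i)), one_smul]
  -- The equation `Aᵗ D A = G` with `D` the diagonal matrix of signs gives the inverse as `G⁻¹ Aᵗ
  -- D`. This is continuous in `A`, so the limit matrix is invertible and convergence holds in `GL`.
  have hinv : ∀ A : GL (Fin (p + q)) ℝ, A ∈ B →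
      A.1 * (G⁻¹ * A.1.transpose * Matrix.diagonal (signs p q)) = 1 := by
    intro A hA
    have h1 : A.1 * G⁻¹ * A.1.transpose = Matrix.diagonal (signs p q) := by
      ext i k
      rw [mul_mul_transpose_apply, bilin_rows hGu (hBpres A hA), Matrix.diagonal_apply]
    rw [← Matrix.mul_assoc, ← Matrix.mul_assoc, h1, Matrix.diagonal_mul_diagonal,
      ← Matrix.diagonal_one]
    congr 1
    ext i
    exact signs_mul_self i
  have hcont : Continuous fun A : Matrix (Fin (p + q)) (Fin (p + q)) ℝ =>
      G⁻¹ * A.transpose * Matrix.diagonal (signs p q) :=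
    (continuous_const.matrix_mul continuous_id.matrix_transpose).matrix_mul continuous_const
  have hinv' : A' * (G⁻¹ * A'.transpose * Matrix.diagonal (signs p q)) = 1 := by
    have hc : Continuous fun A : Matrix (Fin (p + q)) (Fin (p + q)) ℝ =>
      A * (G⁻¹ * A.transpose * Matrix.diagonal (signs p q)) := continuous_id.matrix_mul hcont
    refine tendsto_nhds_unique ((hc.tendsto A').comp hlim) (tendsto_const_nhds.congr' ?_)
    filter_upwards [hB] with A hA using (hinv A hA).symm
  let A'' : GL (Fin (p + q)) ℝ :=
    ⟨A', G⁻¹ * A'.transpose * Matrix.diagonal (signs p q), hinv', mul_eq_one_comm.1 hinv'⟩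
  have hlimGL : Tendsto (fun A : GL (Fin (p + q)) ℝ => A) 𝒰 (𝓝 A'') := by
    rw [Units.isInducing_embedProduct.tendsto_nhds_iff]
    refine Tendsto.prodMk_nhds hlim ?_
    refine (MulOpposite.continuous_op.tendsto _).comp ?_
    refine ((hcont.tendsto A').comp hlim).congr' ?_
    filter_upwards [hB] with A hA
    have h2 : (A⁻¹).1 * (A.1 * (G⁻¹ * A.1.transpose * Matrix.diagonal (signs p q))) =
        (A⁻¹).1 := by rw [hinv A hA, Matrix.mul_one]
    rw [← Matrix.mul_assoc, ← Units.val_mul, inv_mul_cancel, Units.val_one, Matrix.one_mul] at h2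
    exact h2
  refine ⟨L * A''⁻¹, ?_, ?_⟩
  · have h1 : Tendsto (fun A : GL (Fin (p + q)) ℝ => L * A⁻¹) 𝒰 (𝓝 (L * A''⁻¹)) :=
      tendsto_const_nhds.mul hlimGL.inv
    exact mem_closure_of_tendsto h1 hB
  · have h1 : (L * A''⁻¹)⁻¹ * L = A'' := by
      rw [mul_inv_rev, inv_inv, inv_mul_cancel_right]
    rw [h1, hJ₀]
    have hs : ∀ i, (Real.sqrt (τ i))⁻¹ * t i ≠ 0 := by
      intro i
      have hτ : 0 ≤ τ i := ge_of_tendsto' (hnorm2 i) fun A => sq_nonneg _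
      exact mul_ne_zero
        (inv_ne_zero (Real.sqrt_pos.2 (lt_of_le_of_ne hτ (hτ0 i).symm)).ne') (ht i)
    have hrow : ∀ i, A''.1 i = ((Real.sqrt (τ i))⁻¹ * t i) • (g₀⁻¹ * L).1 (σ i) := by
      intro i
      rw [mul_smul, ← hσ i]
      rfl
    have hinj : Function.Injective σ := injective_of_row_eq_smul (isUnit_det_GL A'')
      (A := fun i => A''.1 i) (B := fun i => (g₀⁻¹ * L).1 i) hs hrow
    exact (realConfigIdeal_eq_of_rows
      (Equiv.ofBijective σ (Finite.injective_iff_bijective.1 hinj)) hs hrow).symm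

/-! ### The homeomorphism -/

theorem exists_homeomorph {p q : ℕ} (hn : 1 ≤ p + q) {L : GL (Fin (p + q)) ℝ}
    (hf : HasSignature (linSubst L.1 (stdQuadric p q)) p q) :
    ∃ Φ : (SOPlus p q ⧸ squaresStabilizer p q) ≃ₜ SSPReal (linSubst L.1 (stdQuadric p q)),
      ∀ g : SOPlus p q, (Φ (QuotientGroup.mk g)).1.ideal =
        realConfigIdeal fun i => (g.1⁻¹ * L : GL (Fin (p + q)) ℝ).1 i := by
  have hdet : ∀ g : SOPlus p q,
      IsUnit (Matrix.of fun i j => ((g.1⁻¹ * L : GL (Fin (p + q)) ℝ).1 i j : ℂ)).det := fun g =>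
    isUnit_det_ofReal (isUnit_det_GL (g.1⁻¹ * L))
  let φ : SOPlus p q → HilbPoint (p + q) (p + q) := fun g => configPoint hn _ (hdet g)
  have hφ : ∀ g, (φ g).ideal = realConfigIdeal fun i => (g.1⁻¹ * L).1 i := fun _ => rfl
  have hφc : Continuous φ := by
    refine continuous_hilbPoint (fun g => configFrame hn _ (hdet g)) ?_
      fun g => frameKernel_configFrame hn (hdet g)
    refine Continuous.subtype_mk (continuous_pi fun i => ?_) _
    refine (continuous_monomialVec _ _).comp (continuous_pi fun j => Complex.continuous_ofReal.comp ?_)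
    have h1 : Continuous fun g : SOPlus p q => (g.1⁻¹ * L : GL (Fin (p + q)) ℝ).1 :=
      Units.continuous_val.comp (continuous_subtype_val.inv.mul continuous_const)
    exact (continuous_apply j).comp ((continuous_apply i).comp h1)
  let φ' : SOPlus p q → SSPReal (linSubst L.1 (stdQuadric p q)) := fun g =>
    ⟨φ g, (mem_SSPReal_iff hf).2 ⟨g.1, g.2, hφ g⟩⟩
  have hφ' : Continuous φ' := hφc.subtype_mk _
  have hrel : ∀ g h : SOPlus p q, φ' g = φ' h ↔ g⁻¹ * h ∈ squaresStabilizer p q := by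
    intro g h
    rw [inv_mul_mem_squaresStabilizer_iff L, ← hφ, ← hφ, ← HilbPoint.ext_iff, Subtype.ext_iff]
  let Φ₀ : (SOPlus p q ⧸ squaresStabilizer p q) → SSPReal (linSubst L.1 (stdQuadric p q)) :=
    Quotient.lift φ' fun g h hgh => (hrel g h).2 (QuotientGroup.leftRel_apply.1 hgh)
  have hΦ₀ : ∀ g : SOPlus p q, Φ₀ (QuotientGroup.mk g) = φ' g := fun _ => rfl
  have hbij : Function.Bijective Φ₀ := by
    constructor
    · intro x y
      obtain ⟨g, rfl⟩ := QuotientGroup.mk_surjective x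
      obtain ⟨h, rfl⟩ := QuotientGroup.mk_surjective y
      intro hgh
      exact QuotientGroup.eq.2 ((hrel g h).1 hgh)
    · rintro ⟨J, hJ⟩
      obtain ⟨g, hg, hJg⟩ := (mem_SSPReal_iff hf).1 hJ
      exact ⟨QuotientGroup.mk ⟨g, hg⟩, Subtype.ext (HilbPoint.ext hJg.symm)⟩
  -- A limit of the image that is itself a real configuration comes from the closure of the preimage
  -- in the group, and this preimage is closed.
  have hclosed : IsClosedMap Φ₀ := by
    intro C hC
    let S : Set (GL (Fin (p + q)) ℝ) :=
      Subtype.val '' ((QuotientGroup.mk : SOPlus p q → _) ⁻¹' C)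
    have hS : IsClosed S := (isClosed_SOPlus p q).isClosedEmbedding_subtypeVal.isClosedMap _
      (hC.preimage continuous_quot_mk)
    have hSsub : S ⊆ SOPlus p q := by
      rintro _ ⟨g, -, rfl⟩
      exact g.2
    refine isClosed_of_closure_subset fun x hx => ?_
    rw [closure_subtype] at hx
    have hx' : x.1 ∈ closure {K : HilbPoint (p + q) (p + q) |
        ∃ g ∈ S, K.ideal = realConfigIdeal fun i => (g⁻¹ * L).1 i} := by
      refine closure_mono ?_ hx
      rintro _ ⟨_, ⟨y, hy, rfl⟩, rfl⟩
      obtain ⟨g, rfl⟩ := QuotientGroup.mk_surjective y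
      exact ⟨g.1, ⟨g, hy, rfl⟩, rfl⟩
    obtain ⟨g₀, hg₀, hx₀⟩ := (mem_SSPReal_iff hf).1 x.2
    obtain ⟨g, hg, hxg⟩ := exists_mem_closure_of_mem_closure hSsub hx' hg₀ hx₀
    rw [hS.closure_eq] at hg
    obtain ⟨g, hgC, rfl⟩ := hg
    exact ⟨QuotientGroup.mk g, hgC, Subtype.ext (HilbPoint.ext hxg.symm)⟩
  have hcont : Continuous Φ₀ := hφ'.quotient_lift _
  exact ⟨(Equiv.ofBijective Φ₀ hbij).toHomeomorphOfContinuousClosed hcont hclosed, fun g => hφ g⟩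

/-! ### Indefinite quadrics -/

theorem sum_eq_sum_of_pair {ι M : Type*} [Fintype ι] [DecidableEq ι] [AddCommMonoid M]
    {g h : ι → M} {k l : ι} (hkl : k ≠ l) (h1 : g k + g l = h k + h l)
    (h2 : ∀ i, i ≠ k → i ≠ l → g i = h i) : ∑ i, g i = ∑ i, h i := by
  rw [← Finset.add_sum_erase _ g (Finset.mem_univ k), ← Finset.add_sum_erase _ h (Finset.mem_univ k),
    ← Finset.add_sum_erase _ g (Finset.mem_erase.2 ⟨hkl.symm, Finset.mem_univ l⟩),
    ← Finset.add_sum_erase _ h (Finset.mem_erase.2 ⟨hkl.symm, Finset.mem_univ l⟩),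
    ← add_assoc, ← add_assoc, h1]
  congr 1
  refine Finset.sum_congr rfl fun i hi => ?_
  rw [Finset.mem_erase, Finset.mem_erase] at hi
  exact h2 i hi.2.1 hi.1

theorem sq_sub_sq_linForm {n : ℕ} (v w : Fin n → ℂ) :
    C (1 : ℂ) * linForm v ^ 2 + C (-1 : ℂ) * linForm w ^ 2 =
      C (1 / 2) * linForm (v + Complex.I • w) ^ 2 +
        C (1 / 2) * linForm (v - Complex.I • w) ^ 2 := by
  have e1 : linForm (v + Complex.I • w) = linForm v + C Complex.I * linForm w := by
    rw [C_mul']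
    exact ((linFormHom n).map_add v (Complex.I • w)).trans
      (congrArg _ ((linFormHom n).map_smul Complex.I w))
  have e2 : linForm (v - Complex.I • w) = linForm v - C Complex.I * linForm w := by
    rw [C_mul']
    exact ((linFormHom n).map_sub v (Complex.I • w)).trans
      (congrArg _ ((linFormHom n).map_smul Complex.I w))
  have e3 : (C Complex.I : MvPolynomial (Fin n) ℂ) * C Complex.I = -1 := by
    rw [← C_mul, Complex.I_mul_I, C_neg, C_1]
  have e4 : (C (1 / 2 : ℂ) : MvPolynomial (Fin n) ℂ) + C (1 / 2) = 1 := by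
    rw [← C_add, add_halves, C_1]
  rw [e1, e2, C_neg, C_1]
  linear_combination (linForm w ^ 2 - linForm v ^ 2) * e4 - 2 * C (1 / 2) * linForm w ^ 2 * e3

/-- A positive and a negative square are traded for the squares of two conjugate linear forms. The
new configuration is stable under conjugation, but two of its points are not real. -/
theorem exists_mem_VSPReal_notMem_closure_SSPReal {p q : ℕ} (hp : p ≠ 0) (hq : q ≠ 0) {L : GL (Fin (p + q)) ℝ}
    (hf : HasSignature (linSubst L.1 (stdQuadric p q)) p q) :
    ∃ J ∈ VSPReal (linSubst L.1 (stdQuadric p q)),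
      J ∉ closure (SSPReal (linSubst L.1 (stdQuadric p q))) := by
  set f := linSubst L.1 (stdQuadric p q) with hfdef
  have hn : 1 ≤ p + q := by omega
  let k : Fin (p + q) := Fin.castAdd q ⟨0, Nat.pos_of_ne_zero hp⟩
  let l : Fin (p + q) := Fin.natAdd p ⟨0, Nat.pos_of_ne_zero hq⟩
  have hk : signs p q k = 1 := signs_castAdd _
  have hl : signs p q l = -1 := signs_natAdd _
  have hkl : k ≠ l := fun h => by
    rw [h, hl] at hk
    norm_num at hk
  let v : Fin (p + q) → Fin (p + q) → ℂ := fun i j => (L.1 i j : ℂ)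
  let N : Fin (p + q) → Fin (p + q) → ℂ := fun i =>
    if i = k then v k + Complex.I • v l else if i = l then v k - Complex.I • v l else v i
  let c : Fin (p + q) → ℂ := fun i =>
    if i = k then 1 / 2 else if i = l then 1 / 2 else (signs p q i : ℂ)
  have hNk : N k = v k + Complex.I • v l := if_pos rfl
  have hNl : N l = v k - Complex.I • v l := by simp [N, hkl.symm]
  have hNi : ∀ i, i ≠ k → i ≠ l → N i = v i := fun i h1 h2 => by simp [N, h1, h2]
  have hmap : map Complex.ofRealHom f = ∑ i, C (signs p q i : ℂ) * linForm (v i) ^ 2 := by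
    rw [hfdef, linSubst_stdQuadric]
    exact map_sum_sq (signs p q) (fun i => L.1 i)
  have hdec : map Complex.ofRealHom f = ∑ i, C (c i) * linForm (N i) ^ 2 := by
    rw [hmap]
    refine sum_eq_sum_of_pair hkl ?_ fun i hik hil => ?_
    · have hck : c k = 1 / 2 := if_pos rfl
      have hcl : c l = 1 / 2 := by simp [c, hkl.symm]
      rw [hck, hcl, hNk, hNl, hk, hl, Complex.ofReal_neg, Complex.ofReal_one]
      exact sq_sub_sq_linForm (v k) (v l)
    · rw [hNi i hik hil]
      have hci : c i = (signs p q i : ℂ) := by simp [c, hik, hil]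
      rw [hci]
  have hNu : IsUnit (Matrix.of N).det := by
    have h1 : gram (fun i => (signs p q i : ℂ)) v = gram c N := by
      rw [← sum_sq_eq_iff, ← hdec, hmap]
    refine (isUnit_det_of_gram (c := c) ?_).1
    rw [← h1, det_gram, isUnit_iff_ne_zero]
    refine mul_ne_zero (pow_ne_zero _ (isUnit_det_ofReal (isUnit_det_GL L)).ne_zero)
      (Finset.prod_ne_zero_iff.2 fun i _ => Complex.ofReal_ne_zero.2 (signs_ne_zero i))
  let J := configPoint hn N hNu
  refine ⟨J, ⟨subset_zariskiClosure _ ⟨N, c, hdec, rfl⟩, ?_⟩, ?_⟩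
  · have hv : ∀ i j, starRingEnd ℂ (v i j) = v i j := fun i j => Complex.conj_ofReal _
    intro P hP
    refine configIdeal_conj_mem (σ := Equiv.swap k l) (fun i => ?_) hP
    by_cases hik : i = k
    · subst hik
      rw [Equiv.swap_apply_left, hNl, hNk]
      ext j
      simp [hv, sub_eq_add_neg]
    · by_cases hil : i = l
      · subst hil
        rw [Equiv.swap_apply_right, hNl, hNk]
        ext j
        simp [hv]
      · rw [Equiv.swap_apply_of_ne_of_ne hik hil, hNi i hik hil]
        ext j
        exact hv i j
  · intro hJ
    have hGu : IsUnit (L.1.transpose * Matrix.diagonal (signs p q) * L.1).det :=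
      isUnit_det_gram_signs L
    let B : Set (GL (Fin (p + q)) ℝ) := {A | A.1.transpose * Matrix.diagonal (signs p q) * A.1 =
      L.1.transpose * Matrix.diagonal (signs p q) * L.1}
    have hJB : J ∈ closure {K : HilbPoint (p + q) (p + q) |
        ∃ A ∈ B, K.ideal = realConfigIdeal fun i => A.1 i} := by
      refine closure_mono ?_ hJ
      intro K hK
      obtain ⟨g, hg, hKg⟩ := (mem_SSPReal_iff hf).1 hK
      exact ⟨g⁻¹ * L, preserves_inv_mul hg L, hKg⟩
    obtain ⟨𝒰, u, hB, hu0, hulim, hu⟩ := exists_ultrafilter_limit hJB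
    -- Orthogonality of the rows is unaffected by scaling and survives in the limit, however their
    -- norms behave.
    have horth : ∀ i m, i ≠ m →
        bilin (L.1.transpose * Matrix.diagonal (signs p q) * L.1)⁻¹ (u i) (u m) = 0 := by
      intro i m him
      refine tendsto_nhds_unique (tendsto_bilin_normalized hulim i m)
        (tendsto_const_nhds.congr' ?_)
      filter_upwards [hB] with A hA
      rw [bilin_rows hGu hA, if_neg him, mul_zero]
    have hprop : ∀ i, ∃ m, m ≠ k ∧ m ≠ l ∧ ∃ t : ℝ, t ≠ 0 ∧ u i = t • L.1 m := by
      intro i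
      obtain ⟨m, d, hd, hm⟩ := exists_smul_row_of_eval_eq_zero hNu (v := fun j => (u i j : ℂ))
        (by
          intro h
          apply hu0 i
          ext j
          exact Complex.ofReal_eq_zero.1 (congrFun h j)) (hu i)
      -- In the basis of the rows of `L`, the coordinates of the real vector `u i` at `l` and `k`
      -- would have the non-real ratio `e`.
      have hreal : ∀ s : ℂ, s ≠ 0 → ∀ e : ℂ, e.re = 0 → e ≠ 0 →
          (fun j => (u i j : ℂ)) ≠ s • (v k + e • v l) := by
        intro s hs e he he0 heq
        let w : Fin (p + q) → ℝ := Matrix.vecMul (u i) (L⁻¹).1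
        have hw : ∀ m, (w m : ℂ) = s * ((if m = k then 1 else 0) + e * if m = l then 1 else 0) := by
          intro m
          have h1 : ∀ r, ∑ j, v r j * (((L⁻¹).1 j m : ℝ) : ℂ) = if m = r then 1 else 0 := by
            intro r
            have h2 : (L.1 * (L⁻¹).1) r m = if m = r then 1 else 0 := by
              rw [← Units.val_mul, mul_inv_cancel, Units.val_one, Matrix.one_apply]
              simp only [eq_comm]
            rw [Matrix.mul_apply] at h2
            have h3 := congrArg (fun x : ℝ => (x : ℂ)) h2
            simp only [Complex.ofReal_sum, Complex.ofReal_mul] at h3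
            rw [h3]
            split_ifs <;> simp
          have h4 : (w m : ℂ) = ∑ j, (u i j : ℂ) * (((L⁻¹).1 j m : ℝ) : ℂ) := by
            simp only [w, Matrix.vecMul, dotProduct]
            push_cast
            rfl
          rw [h4]
          have h5 : ∀ j, (u i j : ℂ) = s * (v k j + e * v l j) := fun j => congrFun heq j
          simp only [h5, ← h1]
          rw [Finset.mul_sum, ← Finset.sum_add_distrib, Finset.mul_sum]
          exact Finset.sum_congr rfl fun j _ => by ring
        have hwk := hw k
        have hwl := hw l
        simp only [if_pos, if_neg hkl, if_neg hkl.symm, mul_zero, mul_one, add_zero, zero_add]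
          at hwk hwl
        have h6 : (w l : ℂ) = w k * e := by rw [hwl, hwk]
        have h7 := congrArg Complex.im h6
        rw [Complex.mul_im, Complex.ofReal_im, Complex.ofReal_im, Complex.ofReal_re, zero_mul,
          add_zero, eq_comm, mul_eq_zero] at h7
        rcases h7 with h7 | h7
        · rw [h7, Complex.ofReal_zero] at hwk
          exact hs hwk.symm
        · exact he0 (Complex.ext he h7)
      have hmk : m ≠ k := by
        rintro rfl
        rw [hNk] at hm
        exact hreal d hd Complex.I (by simp) Complex.I_ne_zero hm
      have hml : m ≠ l := by
        rintro rfl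
        rw [hNl] at hm
        refine hreal d hd (-Complex.I) (by simp) (neg_ne_zero.2 Complex.I_ne_zero) ?_
        rw [hm, neg_smul, sub_eq_add_neg]
      rw [hNi m hmk hml] at hm
      exact ⟨m, hmk, hml, exists_real_smul (row_ne_zero (isUnit_det_GL L) m) hd hm⟩
    choose σ hσk _ t ht hσ using hprop
    -- The index `k` is never attained, so two of the limits are proportional to the same row of
    -- `L`, which is not orthogonal to itself.
    have hninj : ¬ Function.Injective σ := by
      intro h
      obtain ⟨i, hi⟩ := Finite.injective_iff_surjective.1 h k
      exact hσk i hi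
    simp only [Function.Injective, not_forall] at hninj
    obtain ⟨i, m, him, hne⟩ := hninj
    have h1 := horth i m hne
    rw [hσ i, hσ m, bilin_smul_smul, him, bilin_rows hGu rfl, if_pos rfl] at h1
    exact mul_ne_zero (mul_ne_zero (ht i) (ht m)) (signs_ne_zero _) h1

/-! ### Contractions of the linear functionals on forms -/

/-- The matrix of the quadratic form that arises from a functional on forms of degree `d` by
contraction with the monomial `α` of degree `d - 2`. -/
def contraction {n d : ℕ} (α : Fin n →₀ ℕ) : (Mon n d → ℂ) →ₗ[ℂ] Matrix (Fin n) (Fin n) ℂ where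
  toFun w := Matrix.of fun j k =>
    if h : α + Finsupp.single j 1 + Finsupp.single k 1 ∈ Finset.finsuppAntidiag Finset.univ d then
      w ⟨_, h⟩ else 0
  map_add' v w := by
    ext j k
    simp only [Matrix.of_apply, Matrix.add_apply]
    split_ifs <;> simp
  map_smul' c w := by
    ext j k
    simp only [Matrix.of_apply, Matrix.smul_apply]
    split_ifs <;> simp

theorem contraction_apply {n d : ℕ} (α : Fin n →₀ ℕ) (w : Mon n d → ℂ) (j k : Fin n) :
    contraction α w j k =
      if h : α + Finsupp.single j 1 + Finsupp.single k 1 ∈ Finset.finsuppAntidiag Finset.univ d then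
        w ⟨_, h⟩ else 0 := rfl

theorem contraction_symm {n d : ℕ} (α : Fin n →₀ ℕ) (w : Mon n d → ℂ) (j k : Fin n) :
    contraction α w j k = contraction α w k j := by
  simp only [contraction_apply, add_right_comm α (Finsupp.single j 1)]

/-- If `α` has degree `d - 2`, contracting the evaluation at `a` leaves `a^α` times the square of
`a`; in any other degree the contraction is zero. -/
theorem contraction_monomialVec {n d : ℕ} (α : Fin n →₀ ℕ) (a : Fin n → ℂ) :
    ∃ t : ℂ, contraction α (monomialVec d a) = t • Matrix.vecMulVec a a := by
  have hdeg : ∀ j k : Fin n, (α + Finsupp.single j 1 + Finsupp.single k 1 ∈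
      Finset.finsuppAntidiag (Finset.univ : Finset (Fin n)) d) ↔ α.degree + 1 + 1 = d := by
    intro j k
    rw [mem_mon_iff, map_add, map_add, Finsupp.degree_single, Finsupp.degree_single]
  by_cases h : α.degree + 1 + 1 = d
  · refine ⟨∏ j, a j ^ α j, ?_⟩
    ext j k
    have hs : ∀ j : Fin n, ∏ i, a i ^ (Finsupp.single j 1 : Fin n →₀ ℕ) i = a j := by
      intro j
      rw [Finset.prod_eq_single j] <;> simp +contextual [eq_comm]
    rw [contraction_apply, dif_pos ((hdeg j k).2 h)]
    simp only [monomialVec, Finsupp.add_apply, pow_add, Finset.prod_mul_distrib, hs,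
      Matrix.smul_apply, Matrix.vecMulVec_apply, smul_eq_mul, mul_assoc]
  · refine ⟨0, ?_⟩
    ext j k
    rw [contraction_apply, dif_neg fun h' => h ((hdeg j k).1 h'), zero_smul, Matrix.zero_apply]

theorem contraction_re {n d : ℕ} (α : Fin n →₀ ℕ) (w : Mon n d → ℂ) :
    contraction α (fun m => ((w m).re : ℂ)) =
      ((contraction α w).map Complex.re).map Complex.ofRealHom := by
  ext j k
  simp only [contraction_apply, Matrix.map_apply]
  split_ifs <;> simp

theorem contraction_im {n d : ℕ} (α : Fin n →₀ ℕ) (w : Mon n d → ℂ) :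
    contraction α (fun m => ((w m).im : ℂ)) =
      ((contraction α w).map Complex.im).map Complex.ofRealHom := by
  ext j k
  simp only [contraction_apply, Matrix.map_apply]
  split_ifs <;> simp

theorem isHomogeneous_monomial_mul_linForm {n d : ℕ} {α : Fin n →₀ ℕ} (hα : α.degree + 2 = d)
    (u v : Fin n → ℂ) : (monomial α (1 : ℂ) * (linForm u * linForm v)).IsHomogeneous d := by
  rw [← hα]
  exact (isHomogeneous_monomial _ rfl).mul
    ((isHomogeneous_linForm u).mul (isHomogeneous_linForm v))

/-- The bridge back to the ideal: forms orthogonal for all contractions have a product whose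
monomial multiples of degree `d` are annihilated by the functionals. -/
theorem functional_monomial_mul_linForm {n d : ℕ} {α : Fin n →₀ ℕ} (hα : α.degree + 2 = d)
    (w : Mon n d → ℂ) (u v : Fin n → ℂ) :
    functional w ⟨monomial α 1 * (linForm u * linForm v),
      isHomogeneous_monomial_mul_linForm hα u v⟩ = u ⬝ᵥ (contraction α w).mulVec v := by
  have hpoly : monomial α (1 : ℂ) * (linForm u * linForm v) =
      ∑ j, ∑ k, monomial (α + Finsupp.single j 1 + Finsupp.single k 1) (u j * v k) := by
    simp only [linForm, Finset.mul_sum, Finset.sum_mul, C_mul_X_eq_monomial, monomial_mul, one_mul,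
      add_assoc]
    rw [Finset.sum_comm]
  have hmem : ∀ j k : Fin n, α + Finsupp.single j 1 + Finsupp.single k 1 ∈
      Finset.finsuppAntidiag (Finset.univ : Finset (Fin n)) d := by
    intro j k
    rw [mem_mon_iff, map_add, map_add, Finsupp.degree_single, Finsupp.degree_single, ← hα]
  rw [functional_apply]
  simp only [hpoly, coeff_sum, coeff_monomial, Finset.mul_sum, dotProduct, Matrix.mulVec]
  rw [Finset.sum_comm]
  refine Finset.sum_congr rfl fun j _ => ?_
  rw [Finset.sum_comm]
  refine Finset.sum_congr rfl fun k _ => ?_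
  rw [Finset.sum_eq_single (⟨_, hmem j k⟩ : Mon n d), if_pos rfl, contraction_apply,
    dif_pos (hmem j k)]
  · ring
  · intro m _ hm
    rw [if_neg fun h => hm (Subtype.ext h.symm), mul_zero]
  · simp

theorem mem_of_monomial_mul_mem {n : ℕ} {I : Ideal (MvPolynomial (Fin n) ℂ)}
    (hI : ∀ p, (∀ i, X i * p ∈ I) → p ∈ I) (d : ℕ) {p : MvPolynomial (Fin n) ℂ}
    (h : ∀ α : Fin n →₀ ℕ, α.degree = d → monomial α 1 * p ∈ I) : p ∈ I := by
  induction d generalizing p with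
  | zero => simpa using h 0 (by simp)
  | succ d ih =>
    refine hI p fun i => ih fun α hα => ?_
    have h1 := h (α + Finsupp.single i 1) (by rw [map_add, Finsupp.degree_single, hα])
    rwa [← mul_one (1 : ℂ), ← monomial_mul, mul_assoc] at h1

/-! ### Definite quadrics -/

theorem contraction_comm_of_mem_span {n d : ℕ} {b : Matrix (Fin n) (Fin n) ℂ}
    {S : Set (Mon n d → ℂ)}
    (hS : ∀ w ∈ S, ∀ w' ∈ S, ∀ α β,
      contraction α w * b * contraction β w' = contraction β w' * b * contraction α w)
    {w w' : Mon n d → ℂ} (hw : w ∈ Submodule.span ℂ S) (hw' : w' ∈ Submodule.span ℂ S)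
    (α β : Fin n →₀ ℕ) :
    contraction α w * b * contraction β w' = contraction β w' * b * contraction α w := by
  induction hw using Submodule.span_induction with
  | zero => simp
  | add x y _ _ hx hy => rw [map_add, add_mul, add_mul, mul_add, hx, hy]
  | smul c x _ hx => rw [map_smul, Matrix.smul_mul, Matrix.smul_mul, Matrix.mul_smul, hx]
  | mem x hx =>
    induction hw' using Submodule.span_induction with
    | zero => simp
    | add y z _ _ hy hz => rw [map_add, add_mul, add_mul, mul_add, hy, hz]
    | smul c y _ hy => rw [map_smul, Matrix.smul_mul, Matrix.smul_mul, Matrix.mul_smul, hy]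
    | mem y hy => exact hS x hx y hy α β

/-- The contractions of two functionals that vanish on a configuration of points, mutually
orthogonal for `b`, commute with respect to `b`. -/
theorem contraction_comm_of_orthogonal {n d : ℕ} {a : Fin n → Fin n → ℂ}
    {b : Matrix (Fin n) (Fin n) ℂ}
    (hb : ∀ k l, k ≠ l → Matrix.vecMulVec (a k) (a k) * b * Matrix.vecMulVec (a l) (a l) = 0)
    {w w' : Mon n d → ℂ} (hw : w ∈ Submodule.span ℂ (Set.range fun l => monomialVec d (a l)))
    (hw' : w' ∈ Submodule.span ℂ (Set.range fun l => monomialVec d (a l)))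
    (α β : Fin n →₀ ℕ) :
    contraction α w * b * contraction β w' = contraction β w' * b * contraction α w := by
  refine contraction_comm_of_mem_span ?_ hw hw' α β
  rintro _ ⟨k, rfl⟩ _ ⟨l, rfl⟩ α β
  obtain ⟨s, hs⟩ := contraction_monomialVec (d := d) α (a k)
  obtain ⟨t, ht⟩ := contraction_monomialVec (d := d) β (a l)
  simp only [hs, ht, Matrix.smul_mul, Matrix.mul_smul]
  by_cases hkl : k = l
  · rw [hkl, smul_comm]
  · rw [hb k l hkl, hb l k (Ne.symm hkl)]
    simp only [smul_zero]

/-- A commuting family of real symmetric matrices has a common orthonormal eigenbasis. -/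
theorem exists_orthogonal_diagonalization {n : ℕ} {ι : Type*}
    {T : ι → Matrix (Fin n) (Fin n) ℝ} (hT : ∀ i, (T i).IsSymm)
    (hC : ∀ i j, T i * T j = T j * T i) :
    ∃ O : Matrix (Fin n) (Fin n) ℝ, O * O.transpose = 1 ∧
      ∀ i, ∃ d : Fin n → ℝ, T i = O.transpose * Matrix.diagonal d * O := by
  classical
  let S : ι → Module.End ℝ (EuclideanSpace ℝ (Fin n)) := fun i => Matrix.toEuclideanLin (T i)
  have hS : ∀ i, (S i).IsSymmetric := fun i =>
    Matrix.isSymmetric_toEuclideanLin_iff.2 (by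
      rw [Matrix.IsHermitian, Matrix.conjTranspose_eq_transpose_of_trivial]
      exact hT i)
  have hSC : Pairwise (Function.onFun Commute S) := fun i j _ => by
    change S i * S j = S j * S i
    ext x : 1
    apply WithLp.ofLp_injective
    simp only [S, Module.End.mul_apply, Matrix.toLpLin_apply, Matrix.mulVec_mulVec, hC]
  -- The space is the orthogonal sum of the joint eigenspaces; orthonormal bases of the summands
  -- provide the rows of `O`.
  have hint := LinearMap.IsSymmetric.directSum_isInternal_of_pairwise_commute hS hSC
  let b := hint.collectedBasis fun χ =>
    (stdOrthonormalBasis ℝ ↥(⨅ j, Module.End.eigenspace (S j) (χ j))).toBasis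
  have hb : Orthonormal ℝ b := hint.collectedBasis_orthonormal
    (LinearMap.IsSymmetric.orthogonalFamily_iInf_eigenspaces hS) fun χ => by
      rw [OrthonormalBasis.coe_toBasis]
      exact OrthonormalBasis.orthonormal _
  have : Finite (Σ χ : ι → ℝ, Fin (Module.finrank ℝ
      ↥(⨅ j, Module.End.eigenspace (S j) (χ j)))) := Module.Finite.finite_basis b
  have : Fintype (Σ χ : ι → ℝ, Fin (Module.finrank ℝ
      ↥(⨅ j, Module.End.eigenspace (S j) (χ j)))) := Fintype.ofFinite _
  let e := Fintype.equivFinOfCardEq ((Module.finrank_eq_card_basis b).symm.trans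
    finrank_euclideanSpace_fin)
  let o : Fin n → EuclideanSpace ℝ (Fin n) := fun l => b (e.symm l)
  have ho : Orthonormal ℝ o := hb.comp _ e.symm.injective
  let O : Matrix (Fin n) (Fin n) ℝ := Matrix.of fun l j => o l j
  have hO : O * O.transpose = 1 := by
    ext l m
    rw [Matrix.one_apply, ← orthonormal_iff_ite.1 ho l m, Matrix.mul_apply, PiLp.inner_apply]
    exact Finset.sum_congr rfl fun j _ => mul_comm _ _
  refine ⟨O, hO, fun i => ⟨fun l => (e.symm l).1 i, ?_⟩⟩
  have h1 : T i * O.transpose = O.transpose * Matrix.diagonal fun l => (e.symm l).1 i := by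
    ext j l
    have h2 : o l ∈ ⨅ j, Module.End.eigenspace (S j) ((e.symm l).1 j) :=
      hint.collectedBasis_mem _ _
    have h3 := Module.End.mem_eigenspace_iff.1 ((Submodule.mem_iInf _).1 h2 i)
    have h4 : (S i (o l)) j = (((e.symm l).1 i) • o l) j := by rw [h3]
    rw [Matrix.mul_diagonal, Matrix.transpose_apply]
    exact h4.trans (mul_comm _ _)
  rw [← h1, mul_assoc, mul_eq_one_comm.1 hO, mul_one]

/-- The entries of a contraction are coordinates of the frame or zero. With `b` constant, the
commutation relations are polynomial equations in the frame, as the Zariski closure demands; `G` is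
the generic contraction. -/
theorem contraction_comm_of_mem_zariskiClosure {n r : ℕ} {T : Set (HilbPoint n r)}
    {b : Matrix (Fin n) (Fin n) ℂ}
    (hT : ∀ K ∈ T, ∀ M : Frame n r r, frameKernel M.1 = degPart K.ideal r → ∀ i i' α β,
      contraction α (M.1 i) * b * contraction β (M.1 i') =
        contraction β (M.1 i') * b * contraction α (M.1 i))
    {J : HilbPoint n r} (hJ : J ∈ zariskiClosure T) {M : Frame n r r}
    (hM : frameKernel M.1 = degPart J.ideal r) (i i' : Fin r) (α β : Fin n →₀ ℕ) :
    contraction α (M.1 i) * b * contraction β (M.1 i') =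
      contraction β (M.1 i') * b * contraction α (M.1 i) := by
  let G : Fin r → (Fin n →₀ ℕ) → Matrix (Fin n) (Fin n) (MvPolynomial (Fin r × Mon n r) ℂ) :=
    fun i α => Matrix.of fun j k =>
      if h : α + Finsupp.single j 1 + Finsupp.single k 1 ∈
        Finset.finsuppAntidiag Finset.univ r then X (i, ⟨_, h⟩) else 0
  have hG : ∀ (M : Frame n r r) i α,
      (G i α).map (eval fun im => M.1 im.1 im.2) = contraction α (M.1 i) := by
    intro M i α
    ext j k
    rw [Matrix.map_apply, contraction_apply]
    simp only [G, Matrix.of_apply]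
    split_ifs <;> simp
  have hb : ∀ M : Frame n r r,
      (b.map (C : ℂ →+* MvPolynomial (Fin r × Mon n r) ℂ)).map
        (eval fun im => M.1 im.1 im.2) = b := by
    intro M
    ext j k
    simp
  have hprod : ∀ (M : Frame n r r) i α i' β,
      (G i α * b.map (C : ℂ →+* MvPolynomial (Fin r × Mon n r) ℂ) * G i' β).map
        (eval fun im => M.1 im.1 im.2) = contraction α (M.1 i) * b * contraction β (M.1 i') := by
    intro M i α i' β
    rw [Matrix.map_mul, Matrix.map_mul, hG, hG, hb]
  ext j k
  have h1 := hJ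
    ((G i α * b.map (C : ℂ →+* MvPolynomial (Fin r × Mon n r) ℂ) * G i' β) j k -
      (G i' β * b.map (C : ℂ →+* MvPolynomial (Fin r × Mon n r) ℂ) * G i α) j k)
    (fun K hK M hM => by
      rw [map_sub, sub_eq_zero]
      have h2 := congrFun (congrFun (hT K hK M hM i i' α β) j) k
      rwa [← hprod, ← hprod, Matrix.map_apply, Matrix.map_apply] at h2) M hM
  rw [map_sub, sub_eq_zero] at h1
  rw [← hprod, ← hprod, Matrix.map_apply, Matrix.map_apply, h1]

/-- Every frame of the configuration is spanned by the evaluations at its points, and these points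
are orthogonal for the inverse of the quadric. -/
theorem contraction_comm_of_mem_powerSumConfigs {n : ℕ} (hn : 1 ≤ n)
    {c : Fin n → ℂ} {v : Fin n → Fin n → ℂ} (hv : IsUnit (gram c v).det) {K : HilbPoint n n}
    (hK : K ∈ powerSumConfigs (∑ i, C (c i) * linForm (v i) ^ 2)) {M : Frame n n n}
    (hM : frameKernel M.1 = degPart K.ideal n) (i i' : Fin n) (α β : Fin n →₀ ℕ) :
    contraction α (M.1 i) * (gram c v)⁻¹ * contraction β (M.1 i') =
      contraction β (M.1 i') * (gram c v)⁻¹ * contraction α (M.1 i) := by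
  obtain ⟨a, d, had, hKa⟩ := hK
  rw [sum_sq_eq_iff] at had
  rw [had] at hv ⊢
  have ha := (isUnit_det_of_gram hv).1
  rw [hKa, ← frameKernel_configFrame hn ha] at hM
  have hspan : ∀ i, M.1 i ∈ Submodule.span ℂ (Set.range fun l => monomialVec n (a l)) := by
    intro i
    have h1 := row_mem_rowSpan M.1 i
    rw [rowSpan_eq_of_frameKernel_eq hM] at h1
    exact h1
  refine contraction_comm_of_orthogonal (fun k l hkl => ?_) (hspan i) (hspan i') α β
  have h1 : a k ⬝ᵥ (gram d a)⁻¹.mulVec (a l) = 0 := by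
    have h2 := congrFun (congrFun (mul_inv_gram_mul hv) k) l
    rw [Matrix.diagonal_apply_ne _ hkl, Matrix.mul_assoc, Matrix.mul_apply] at h2
    exact h2
  rw [Matrix.vecMulVec_mul, Matrix.vecMulVec_mul_vecMulVec, ← Matrix.dotProduct_mulVec, h1, zero_smul,
    Matrix.vecMulVec_zero]

/-- The real contractions commute with respect to a definite form, so the spectral theorem gives a
common orthogonal basis. The ideal then contains the products of distinct dual forms of this basis.
-/
theorem VSPReal_subset_SSPReal {p q : ℕ} (hn : 1 ≤ p + q) (hpq : p = 0 ∨ q = 0)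
    (L : GL (Fin (p + q)) ℝ) :
    VSPReal (linSubst L.1 (stdQuadric p q)) ⊆ SSPReal (linSubst L.1 (stdQuadric p q)) := by
  rintro J ⟨hJ, hJR⟩
  obtain ⟨ε, hεε, hε⟩ : ∃ ε : ℝ, ε * ε = 1 ∧ ∀ i, signs p q i = ε := by
    rcases hpq with rfl | rfl
    · exact ⟨-1, by norm_num, fun i => Fin.addCases (fun j => j.elim0) signs_natAdd i⟩
    · exact ⟨1, by norm_num, fun i => Fin.addCases signs_castAdd (fun j => j.elim0) i⟩
  obtain ⟨M, hM⟩ := exists_frame _ (J.hilbertFunction _ le_rfl)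
  let F := gram (signs p q) (fun i => L.1 i)
  have hdiagε : Matrix.diagonal (signs p q) =
      ε • (1 : Matrix (Fin (p + q)) (Fin (p + q)) ℝ) := by
    ext i j
    rw [Matrix.smul_apply, Matrix.diagonal_apply, Matrix.one_apply, hε, smul_ite, smul_zero,
      smul_eq_mul, mul_one]
  have hF : F = ε • (L.1.transpose * L.1) := by
    rw [show F = _ from gram_signs L.1, hdiagε, Matrix.mul_smul, Matrix.smul_mul, mul_one]
  let β := ε • ((L⁻¹).1 * (L⁻¹).1.transpose)
  have hLL : (L⁻¹).1 * L.1 = 1 := by rw [← Units.val_mul, inv_mul_cancel, Units.val_one]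
  have hLL' : L.1 * (L⁻¹).1 = 1 := by rw [← Units.val_mul, mul_inv_cancel, Units.val_one]
  have hLLt : L.1.transpose * (L⁻¹).1.transpose = 1 := by
    rw [← Matrix.transpose_mul, hLL, Matrix.transpose_one]
  have hFβ : F * β = 1 := by
    rw [hF, Matrix.smul_mul, Matrix.mul_smul, smul_smul, hεε, one_smul, mul_assoc,
      ← mul_assoc L.1, hLL', one_mul, hLLt]
  let v : Fin (p + q) → Fin (p + q) → ℂ := fun i j => (L.1 i j : ℂ)
  have hgv : gram (fun i => (signs p q i : ℂ)) v = F.map Complex.ofRealHom := by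
    ext j k
    rw [Matrix.map_apply, gram_apply, show F j k = _ from gram_apply _ _ j k]
    simp [v]
  have hgβ : gram (fun i => (signs p q i : ℂ)) v * β.map Complex.ofRealHom = 1 := by
    rw [hgv, ← Matrix.map_mul, hFβ]
    simp
  have hgu : IsUnit (gram (fun i => (signs p q i : ℂ)) v).det :=
    (Matrix.isUnit_iff_isUnit_det _).1 (IsUnit.of_mul_eq_one _ hgβ)
  have hmap : map Complex.ofRealHom (linSubst L.1 (stdQuadric p q)) =
      ∑ i, C (signs p q i : ℂ) * linForm (v i) ^ 2 := by
    rw [linSubst_stdQuadric]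
    exact map_sum_sq (signs p q) (fun i => L.1 i)
  have hcomm : ∀ i i' α α', contraction α (M.1 i) * β.map Complex.ofRealHom *
      contraction α' (M.1 i') = contraction α' (M.1 i') * β.map Complex.ofRealHom *
        contraction α (M.1 i) := by
    intro i i' α α'
    rw [← Matrix.inv_eq_right_inv hgβ]
    refine contraction_comm_of_mem_zariskiClosure (fun K hK M hM i i' α β => ?_) hJ hM i i' α α'
    rw [hmap] at hK
    exact contraction_comm_of_mem_powerSumConfigs hn hgu hK hM i i' α β
  -- Real and imaginary parts of the rows. They stay in the row span because the conjugates of the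
  -- rows do, the ideal being real.
  let w : Fin (p + q) × Bool → Mon (p + q) (p + q) → ℂ := fun i m =>
    if i.2 then ((M.1 i.1 m).re : ℂ) else ((M.1 i.1 m).im : ℂ)
  have hw : ∀ i, w i ∈ rowSpan M.1 := by
    rintro ⟨i, _ | _⟩
    · have h1 : w (i, false) = (1 / (2 * Complex.I)) •
          (M.1 i - fun m => starRingEnd ℂ (M.1 i m)) := by
        ext m
        simp only [w, Pi.smul_apply, Pi.sub_apply, smul_eq_mul, Complex.sub_conj]
        field_simp
        simp [mul_comm]
      rw [h1]
      exact Submodule.smul_mem _ _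
        (sub_mem (row_mem_rowSpan M.1 i) (conj_row_mem_rowSpan hM hJR i))
    · have h1 : w (i, true) = (1 / 2 : ℂ) • (M.1 i + fun m => starRingEnd ℂ (M.1 i m)) := by
        ext m
        simp only [w, Pi.smul_apply, Pi.add_apply, smul_eq_mul, Complex.add_conj]
        simp
      rw [h1]
      exact Submodule.smul_mem _ _
        (add_mem (row_mem_rowSpan M.1 i) (conj_row_mem_rowSpan hM hJR i))
  let R : (Fin (p + q) × Bool) × (Fin (p + q) →₀ ℕ) → Matrix (Fin (p + q)) (Fin (p + q)) ℝ :=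
    fun i => (contraction i.2 (M.1 i.1.1)).map (if i.1.2 then Complex.re else Complex.im)
  have hR : ∀ i, (R i).map Complex.ofRealHom = contraction i.2 (w i.1) := by
    rintro ⟨⟨i, _ | _⟩, α⟩
    · exact (contraction_im α (M.1 i)).symm
    · exact (contraction_re α (M.1 i)).symm
  have hRcomm : ∀ i j, R i * β * R j = R j * β * R i := by
    intro i j
    apply Matrix.map_injective Complex.ofReal_injective
    have h1 := contraction_comm_of_mem_span (b := β.map Complex.ofRealHom)
      (fun x hx y hy α α' => by
        obtain ⟨i, rfl⟩ := hx
        obtain ⟨i', rfl⟩ := hy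
        exact hcomm i i' α α') (hw i.1) (hw j.1) i.2 j.2
    rw [← hR, ← hR, ← Matrix.map_mul, ← Matrix.map_mul, ← Matrix.map_mul, ← Matrix.map_mul] at h1
    exact h1
  have hRsymm : ∀ i, (R i).transpose = R i := by
    intro i
    ext j k
    simp only [R, Matrix.transpose_apply, Matrix.map_apply, contraction_symm _ _ k j]
  -- In the coordinates `L x` the inverse form `β` is `ε` times the identity, so commuting with
  -- respect to `β` becomes ordinary commuting.
  let T := fun i => (L⁻¹).1.transpose * R i * (L⁻¹).1
  obtain ⟨O, hO, hdiag⟩ := exists_orthogonal_diagonalization (T := T)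
    (fun i => by
      simp only [T, Matrix.IsSymm, Matrix.transpose_mul, Matrix.transpose_transpose, hRsymm,
        mul_assoc])
    (fun i j => by
      have h1 := congrArg (fun A => ε • ((L⁻¹).1.transpose * A * (L⁻¹).1)) (hRcomm i j)
      simp only [β, Matrix.smul_mul, Matrix.mul_smul, smul_smul, hεε, one_smul] at h1
      simpa only [T, mul_assoc] using h1)
  have hRT : ∀ i, ∃ d : Fin (p + q) → ℝ,
      R i = (O * L.1).transpose * Matrix.diagonal d * (O * L.1) := by
    intro i
    obtain ⟨d, hd⟩ := hdiag i
    refine ⟨d, ?_⟩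
    have h1 : R i = L.1.transpose * T i * L.1 := by
      simp only [T, mul_assoc, hLL, mul_one]
      rw [← mul_assoc, hLLt, one_mul]
    rw [h1, hd, Matrix.transpose_mul]
    simp only [mul_assoc]
  let A : Fin (p + q) → Fin (p + q) → ℝ := fun i => (O * L.1) i
  have hA : IsUnit (Matrix.of A).det := by
    change IsUnit (O * L.1).det
    rw [Matrix.det_mul]
    exact ((Matrix.isUnit_iff_isUnit_det _).1 (IsUnit.of_mul_eq_one _ hO)).mul (isUnit_det_GL L)
  refine ⟨A, signs p q, ?_, ?_⟩
  · rw [linSubst_stdQuadric]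
    refine sum_sq_eq_iff.2 (hF.trans ?_)
    rw [show gram (signs p q) A = _ from gram_signs (O * L.1), hdiagε, Matrix.mul_smul,
      Matrix.smul_mul, mul_one, Matrix.transpose_mul, mul_assoc, ← mul_assoc O.transpose,
      mul_eq_one_comm.1 hO, one_mul]
  · have hA' := isUnit_det_ofReal hA
    refine ideal_eq_configIdeal hn hA' fun k l hkl => ?_
    have h2 : p + q - 2 + 2 = p + q := by
      have := Fin.val_ne_of_ne hkl
      omega
    -- By saturation it is enough to test the product of two dual forms after multiplication by all
    -- monomials of degree `n - 2`. There the contractions are diagonal in the basis `A`, so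
    -- distinct indices give zero.
    refine mem_of_monomial_mul_mem J.isSaturated (p + q - 2) fun α hα => ?_
    rw [← hα] at h2
    let Z := Matrix.of fun i j => (A i j : ℂ)
    have hzero : ∀ i, (fun j => Z⁻¹ j k) ⬝ᵥ (contraction α (w i)).mulVec (fun j => Z⁻¹ j l) = 0 := by
      intro i
      obtain ⟨d, hd⟩ := hRT (i, α)
      have hZ : (O * L.1).map Complex.ofRealHom = Z := rfl
      have h3 : contraction α (w i) =
          Z.transpose * (Matrix.diagonal d).map Complex.ofRealHom * Z := by
        rw [← hR (i, α), hd, Matrix.map_mul, Matrix.map_mul, ← hZ, Matrix.transpose_map]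
      have h4 : Z⁻¹.transpose * contraction α (w i) * Z⁻¹ =
          (Matrix.diagonal d).map Complex.ofRealHom := by
        rw [h3, mul_assoc, mul_assoc, Matrix.mul_nonsing_inv _ hA', mul_one, ← mul_assoc,
          ← Matrix.transpose_mul, Matrix.mul_nonsing_inv _ hA', Matrix.transpose_one, one_mul]
      have h5 := congrFun (congrFun h4 k) l
      rw [Matrix.map_apply, Matrix.diagonal_apply_ne _ hkl, map_zero, mul_assoc,
        Matrix.mul_apply] at h5
      exact h5
    have hmem : (⟨_, isHomogeneous_monomial_mul_linForm h2 (fun j => Z⁻¹ j k) fun j => Z⁻¹ j l⟩ :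
        homogeneousSubmodule (Fin (p + q)) ℂ (p + q)) ∈ frameKernel M.1 := by
      rw [mem_frameKernel]
      intro i
      have h6 : M.1 i = w (i, true) + Complex.I • w (i, false) := by
        ext m
        simp only [w, Pi.add_apply, Pi.smul_apply, smul_eq_mul, if_true, Bool.false_eq_true,
          if_false]
        rw [mul_comm, Complex.re_add_im]
      rw [functional_monomial_mul_linForm h2, h6, map_add, map_smul, Matrix.add_mulVec,
        Matrix.smul_mulVec, dotProduct_add, dotProduct_smul, hzero, hzero, smul_zero, add_zero]
    rw [hM] at hmem
    exact hmem

end PowerSums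

end

/-! ### The three assertions together -/

theorem mainTheorem5 (p q : ℕ) (hn : 1 ≤ p + q) (f : MvPolynomial (Fin (p + q)) ℝ)
    (hf : PowerSums.HasSignature f p q) :
    ((∃ L : GL (Fin (p + q)) ℝ, PowerSums.linSubst L.1 (PowerSums.stdQuadric p q) = f) ∧
      ∀ L : GL (Fin (p + q)) ℝ, PowerSums.linSubst L.1 (PowerSums.stdQuadric p q) = f →
        ∃ Φ : (PowerSums.SOPlus p q ⧸ PowerSums.squaresStabilizer p q) ≃ₜ PowerSums.SSPReal f,
          ∀ g : PowerSums.SOPlus p q,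
            (Φ (QuotientGroup.mk g)).1.ideal =
              PowerSums.realConfigIdeal (fun i => ((g.1⁻¹ * L : GL (Fin (p + q)) ℝ).1 i))) ∧
    (PowerSums.IsDefinite f →
      PowerSums.SSPReal f = PowerSums.VSPReal f ∧
      ∀ g : GL (Fin (p + q)) ℝ, g ∈ PowerSums.SOPlus p q ↔
        g.1 ∈ Matrix.specialOrthogonalGroup (Fin (p + q)) ℝ) ∧
    (¬ PowerSums.IsDefinite f →
      closure (PowerSums.SSPReal f) ⊂ PowerSums.VSPReal f) := by
  obtain ⟨L, hL⟩ := PowerSums.exists_linSubst_stdQuadric hf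
  refine ⟨⟨⟨L, hL⟩, fun L hL => ?_⟩, fun hdef => ?_, fun hdef => ?_⟩
  · subst hL
    exact PowerSums.exists_homeomorph hn hf
  · subst hL
    rw [PowerSums.isDefinite_iff hn] at hdef
    exact ⟨(PowerSums.SSPReal_subset_VSPReal _).antisymm
      (PowerSums.VSPReal_subset_SSPReal hn hdef L), PowerSums.mem_SOPlus_iff_of_definite hdef⟩
  · subst hL
    rw [PowerSums.isDefinite_iff hn, not_or] at hdef
    obtain ⟨J, hJ, hJ'⟩ := PowerSums.exists_mem_VSPReal_notMem_closure_SSPReal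
      hdef.1 hdef.2 hf
    exact ⟨PowerSums.closure_SSPReal_subset_VSPReal hn _, fun h => hJ' (h hJ)⟩
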